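/- Write $x=(x_1,x_2)=(z,r)\in\mathbb R^2$, $\Pi=\{x\in\mathbb R^2: x_2>0\}$, and let $H=(H_1,H_2)$ be the axisymmetric (swirl-free) Biot--Savart kernel $$H_1(x,y)=\frac1{2\pi}\int_0^\pi \frac{y_2(y_2-x_2\cos\theta)}{[|x-y|^2+2x_2y_2(1-\cos\theta)]^{3/2}}\,d\theta,\qquad H_2(x,y)=\frac1{2\pi}\int_0^\pi \frac{y_2(x_1-y_1)\cos\theta}{[|x-y|^2+2x_2y_2(1-\cos\theta)]^{3/2}}\,d\theta .$$ Let $\zeta^0=(z_0,r_0)\in\Pi$ and $M,C_F,L,T>0$. There is a constant $C>0$, depending only on $\zeta^0,M,C_F,L,T$, such that the following holds for every $\varepsilon\in(0,1)$ with $\varepsilon<r_0/2$. Let $F^\varepsilon:\mathbb R^2\times[0,\infty)\to\mathbb R^2$ be continuous, with $\partial_{x_1}(x_2F_1^\varepsilon)+\partial_{x_2}(x_2F_2^\varepsilon)=0$ in $\Pi$ (in the sense of distributions) at each time, and $$|F^\varepsilon(x,t)|\le \frac{C_F}{|\log\varepsilon|},\qquad |F^\varepsilon(x,t)-F^\varepsilon(y,t)|\le\frac{L}{|\log\varepsilon|}\,|x-y|\qquad\forall\,x,y\in\mathbb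 R^2,\ t\ge0 .$$ Let $\omega_\varepsilon$ be a solution on $[0,\infty)$ of the reduced system with external field $F^\varepsilon$, that is, $$u(x,t)=\int H(x,y)\,\omega_\varepsilon(y,t)\,dy,\qquad \dot x(t)=u(x(t),t)+F^\varepsilon(x(t),t),\qquad \omega_\varepsilon(x(t),t)=\frac{x_2(t)}{x_2(0)}\,\omega_\varepsilon(x(0),0),$$ where the trajectories $x(t)$ form a continuous flow of bijections of $\Pi$ and $\omega_\varepsilon(x,t)=0$ for $x_2\le0$. Suppose that the initial vorticity is measurable and satisfies $$0\le\omega_\varepsilon(x,0)\le\frac{M}{\varepsilon^2|\log\varepsilon|}\quad\forall\,x\in\mathbb R^2,\qquad |\log\varepsilon|\int\omega_\varepsilon(y,0)\,dy=1,\qquad \operatorname{supp}\omega_\varepsilon(\cdot,0)\subset\{x:|x-\zeta^0|<\varepsilon\}.$$ Put $$T^0_\varepsilon=\max\Big\{t\in[0,T]:\ \tfrac{r_0}2\le x_2\le\tfrac32r_0\ \ \forall\,x\in\operatorname{supp}\omega_\varepsilon(\cdot,s)\ \ \forall\,s\in[0,t]\Big\},$$ $$B_\varepsilon(t)=\frac{\int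 x\,\omega_\varepsilon(x,t)\,dx}{\int\omega_\varepsilon(x,t)\,dx},\qquad I_\varepsilon(t)=\int\big(x_2-B_{\varepsilon,2}(t)\big)^2\omega_\varepsilon(x,t)\,dx .$$ Then $$I_\varepsilon(t)\le\frac{C}{|\log\varepsilon|^2}\qquad\forall\,t\in[0,T^0_\varepsilon].$$ -/

import Mathlib

noncomputable section

open MeasureTheory Set Real

namespace VortexRing

/-- The plane of the points `x = (x₁, x₂) = (z, r)`; the axial coordinate `x₁` is `x 0`, the radial
coordinate `x₂` is `x 1`. -/
abbrev Plane : Type := EuclideanSpace ℝ (Fin 2)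

/-- The open half-plane `{x : x₂ > 0}`. -/
def halfPlane : Set Plane := {x | 0 < x 1}

/-- The bracket `|x - y|² + 2 x₂ y₂ (1 - cos θ)`. -/
def bracket (x y : Plane) (θ : ℝ) : ℝ :=
  ‖x - y‖ ^ 2 + 2 * x 1 * y 1 * (1 - cos θ)

/-- Axial component of the axisymmetric Biot–Savart kernel. -/
def H₁ (x y : Plane) : ℝ :=
  1 / (2 * π) * ∫ θ in (0 : ℝ)..π,
    y 1 * (y 1 - x 1 * cos θ) / (bracket x y θ) ^ (3 / 2 : ℝ)

/-- Radial component of the axisymmetric Biot–Savart kernel. -/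
def H₂ (x y : Plane) : ℝ :=
  1 / (2 * π) * ∫ θ in (0 : ℝ)..π,
    y 1 * (x 0 - y 0) * cos θ / (bracket x y θ) ^ (3 / 2 : ℝ)

/-- The velocity `u(x) = ∫ H(x, y) w(y) dy` generated by the vorticity `w`. -/
def velocity (w : Plane → ℝ) (x : Plane) : Plane :=
  !₂[∫ y, H₁ x y * w y, ∫ y, H₂ x y * w y]

/-- The hypotheses on the external field at the parameter `ε`, with constants `C_F` and `L`. -/
structure IsExternalField (ε C_F L : ℝ) (F : ℝ → Plane → Plane) : Prop where
  continuousOn : ContinuousOn (fun p : ℝ × Plane => F p.1 p.2) (Ici 0 ×ˢ univ)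
  /-- `∂₁(x₂ F₁) + ∂₂(x₂ F₂) = 0` on the half-plane. A Lipschitz field need not be differentiable
  everywhere, so the equation is read against test functions
  (`fderiv ℝ f x (F t x)` is `F · ∇f`). -/
  divergence_free : ∀ t, 0 ≤ t → ∀ f : Plane → ℝ, ContDiff ℝ ((⊤ : ℕ∞) : WithTop ℕ∞) f → HasCompactSupport f →
    tsupport f ⊆ halfPlane → ∫ x, x 1 * fderiv ℝ f x (F t x) = 0
  bound : ∀ t, 0 ≤ t → ∀ x, ‖F t x‖ ≤ C_F / |log ε|
  lipschitz : ∀ t, 0 ≤ t → ∀ x y, ‖F t x - F t y‖ ≤ L / |log ε| * ‖x - y‖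

/-- The hypotheses on the initial vorticity at the parameter `ε` (unit vortex intensity). -/
structure IsInitialDatum (ε M : ℝ) (ζ₀ : Plane) (w : Plane → ℝ) : Prop where
  measurable : Measurable w
  nonneg : ∀ x, 0 ≤ w x
  bound : ∀ x, w x ≤ M / (ε ^ 2 * |log ε|)
  intensity : |log ε| * ∫ y, w y = 1
  support : tsupport w ⊆ Metric.ball ζ₀ ε

/-- `φ` is the flow on the half-plane of `ẋ = u(x, t) + F(x, t)`, where `u(·, t)` is the velocity
generated by `ω(·, t)`, and `ω / x₂` is constant along this flow. The vorticity is extended by zero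
outside the half-plane. -/
structure IsReducedFlow (F : ℝ → Plane → Plane) (ω : ℝ → Plane → ℝ) (φ : ℝ → Plane → Plane) :
    Prop where
  continuousOn : ContinuousOn (fun p : ℝ × Plane => φ p.1 p.2) (Ici 0 ×ˢ halfPlane)
  bijOn : ∀ t, 0 ≤ t → BijOn (φ t) halfPlane halfPlane
  initial : ∀ x ∈ halfPlane, φ 0 x = x
  ode : ∀ x ∈ halfPlane, ∀ t, 0 ≤ t →
    HasDerivWithinAt (fun s => φ s x) (velocity (ω t) (φ t x) + F t (φ t x)) (Ici 0) t
  transport : ∀ x ∈ halfPlane, ∀ t, 0 ≤ t → ω t (φ t x) = φ t x 1 / x 1 * ω 0 x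
  extension : ∀ t, 0 ≤ t → ∀ x ∉ halfPlane, ω t x = 0

/-- `ω` solves the reduced system with external field `F` on `[0, ∞)`. -/
def IsReducedSolution (F : ℝ → Plane → Plane) (ω : ℝ → Plane → ℝ) : Prop :=
  ∃ φ : ℝ → Plane → Plane, IsReducedFlow F ω φ

/-- The times `t ∈ [0, T]` such that the vorticity stays in the strip `r₀ / 2 ≤ x₂ ≤ 3 r₀ / 2`
during `[0, t]`. -/
def confinedTimes (r₀ T : ℝ) (ω : ℝ → Plane → ℝ) : Set ℝ :=
  {t ∈ Icc 0 T | ∀ s ∈ Icc 0 t, ∀ x ∈ tsupport (ω s), r₀ / 2 ≤ x 1 ∧ x 1 ≤ 3 / 2 * r₀}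

/-- The largest time up to which the vorticity stays in the strip. -/
def confinementTime (r₀ T : ℝ) (ω : ℝ → Plane → ℝ) : ℝ :=
  sSup (confinedTimes r₀ T ω)

/-- The center of vorticity `∫ x w(x) dx / ∫ w(x) dx`. -/
def center (w : Plane → ℝ) : Plane :=
  (∫ x, w x)⁻¹ • ∫ x, w x • x

/-- The axial moment of inertia `∫ (x₂ - B₂)² w(x) dx`, with `B` the center of vorticity. -/
def axialMoment (w : Plane → ℝ) : ℝ :=
  ∫ x, (x 1 - center w 1) ^ 2 * w x

end VortexRing

end

/-!
Since `ω / x₂` is constant along the flow, the moments of `ω` are integrals over the initial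
vorticity as soon as the flow preserves the measure `x₂ dx`. The velocity is not Lipschitz, but it
is within a constant times `√δ` of the velocity of a regularized kernel, a Lipschitz field which
preserves `x₂ dx` and whose Lipschitz constant is of order `log (1 / δ)`. Over a short time the flow
is therefore an Euler scheme of solenoidal fields up to an error that vanishes with `δ`.

The derivative of the axial moment is `2 ∫ (x₂ - B₂) (u₂ + F₂) ω`. The kernel `x₂ H₂ (x, y)` is
antisymmetric, so that `∫ x₂ u₂ ω = 0`; what remains of the self-interaction is `B₂ ∫ u₂ ω`, a
double integral in which only the symmetric part of `H₂` counts, and there the singularity cancels.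
Hence the self-interaction is at most of the order of the square of the total vorticity
`1 / |log ε|`, and the external field contributes at most the width of the strip times
`C_F / |log ε|` times `1 / |log ε|`.
-/

noncomputable section

open MeasureTheory Set Filter Topology Real
open scoped NNReal

namespace VortexRing

section Coordinates

lemma abs_coord_le (x : Plane) (i : Fin 2) : |x i| ≤ ‖x‖ := PiLp.norm_apply_le x i

lemma continuous_coord (i : Fin 2) : Continuous fun x : Plane => x i := by fun_prop

/-- The `i`-th unit vector of the plane. -/
def unitVec (i : Fin 2) : Plane := EuclideanSpace.single i 1

@[simp]
lemma norm_unitVec (i : Fin 2) : ‖unitVec i‖ = 1 := by simp [unitVec]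

variable (B : Plane →L[ℝ] Plane)

lemma abs_entry_le (i j : Fin 2) : |B (unitVec i) j| ≤ ‖B‖ :=
  (abs_coord_le _ _).trans ((B.le_opNorm _).trans (by rw [norm_unitVec, mul_one]))

lemma trace_eq_entries :
    LinearMap.trace ℝ Plane B = B (unitVec 0) 0 + B (unitVec 1) 1 := by
  rw [LinearMap.trace_eq_matrix_trace ℝ (EuclideanSpace.basisFun (Fin 2) ℝ).toBasis,
    Matrix.trace_fin_two]
  simp [LinearMap.toMatrix_apply, unitVec]

lemma det_eq_entries :
    B.det = B (unitVec 0) 0 * B (unitVec 1) 1 - B (unitVec 1) 0 * B (unitVec 0) 1 := by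
  rw [ContinuousLinearMap.det,
    ← LinearMap.det_toMatrix (EuclideanSpace.basisFun (Fin 2) ℝ).toBasis, Matrix.det_fin_two]
  simp [LinearMap.toMatrix_apply, unitVec]

lemma abs_trace_le : |LinearMap.trace ℝ Plane B| ≤ 2 * ‖B‖ := by
  rw [trace_eq_entries]
  linarith [abs_add_le (B (unitVec 0) 0) (B (unitVec 1) 1), abs_entry_le B 0 0, abs_entry_le B 1 1]

lemma abs_det_le : |B.det| ≤ 2 * ‖B‖ ^ 2 := by
  have hmul (i j k l : Fin 2) : |B (unitVec i) j * B (unitVec k) l| ≤ ‖B‖ ^ 2 := by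
    rw [abs_mul, sq]
    gcongr <;> exact abs_entry_le B _ _
  rw [det_eq_entries]
  linarith [abs_sub (B (unitVec 0) 0 * B (unitVec 1) 1) (B (unitVec 1) 0 * B (unitVec 0) 1),
    hmul 0 0 1 1, hmul 1 0 0 1]

lemma det_id_add_smul (h : ℝ) :
    (ContinuousLinearMap.id ℝ Plane + h • B).det =
      1 + h * LinearMap.trace ℝ Plane B + h ^ 2 * B.det := by
  rw [det_eq_entries, det_eq_entries, trace_eq_entries]
  simp only [unitVec, add_apply, ContinuousLinearMap.id_apply, smul_apply, PiLp.add_apply,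
    PiLp.smul_apply, smul_eq_mul, PiLp.single_apply, if_true, one_ne_zero, zero_ne_one, if_false]
  ring

end Coordinates

/-- The measure `x₂ dx` on the half-plane: up to the factor `2π`, the volume of the set obtained by
rotating around the axis. -/
def ringVolume : Measure Plane := volume.withDensity fun x => ENNReal.ofReal (x 1)

instance : IsFiniteMeasureOnCompacts ringVolume := by
  have : IsLocallyFiniteMeasure ringVolume :=
    IsLocallyFiniteMeasure.withDensity_ofReal (continuous_coord 1)
  infer_instance

/-- The weighted divergence `∂₁(x₂ w₁) + ∂₂(x₂ w₂)`, expanded by the product rule. -/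
def ringDiv (w : Plane → Plane) (x : Plane) : ℝ :=
  x 1 * LinearMap.trace ℝ Plane (fderiv ℝ w x) + w x 1

/-- A field on `R` that is Lipschitz, bounded and whose weighted divergence vanishes almost
everywhere. By Rademacher's theorem `ringDiv` is not a junk value almost everywhere in an open
`R`. -/
structure IsSolenoidalField (R : Set Plane) (Λ : ℝ≥0) (V : ℝ) (w : Plane → Plane) : Prop where
  lipschitzOnWith : LipschitzOnWith Λ w R
  norm_le : ∀ x ∈ R, ‖w x‖ ≤ V
  ringDiv_eq_zero : ∀ᵐ x : Plane, x ∈ R → ringDiv w x = 0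

section EulerStep

/-- The factor of `h²` in the largest proportion of ring volume which an Euler step of size `h`
along a solenoidal field in the strip `a ≤ x₂ ≤ b` can lose. -/
def stepLoss (a b Λ V : ℝ) : ℝ := (2 * V * Λ + 2 * b * Λ ^ 2 + 2 * V * Λ ^ 2) / a

-- The relation `x τ + v = 0` cancels the terms of first order in `h`.
lemma one_sub_stepLoss_mul_le {a b Λ V h x v τ d : ℝ} (ha : 0 < a) (hx : x ∈ Icc a b)
    (hv : |v| ≤ V) (hτ : |τ| ≤ 2 * Λ) (hd : |d| ≤ 2 * Λ ^ 2) (hdiv : x * τ + v = 0)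
    (hh : |h| ≤ 1) :
    (1 - stepLoss a b Λ V * h ^ 2) * x ≤ (1 + h * τ + h ^ 2 * d) * (x + h * v) := by
  have hV : 0 ≤ V := (abs_nonneg _).trans hv
  have hx0 : 0 < x := ha.trans_le hx.1
  have expand : (1 + h * τ + h ^ 2 * d) * (x + h * v) =
      x + h ^ 2 * (v * τ + x * d + h * (v * d)) := by linear_combination h * hdiv
  set N := 2 * V * Λ + 2 * b * Λ ^ 2 + 2 * V * Λ ^ 2 with hN
  have remainder : |v * τ + x * d + h * (v * d)| ≤ N := by
    have h1 : |v * τ| ≤ V * (2 * Λ) := by rw [abs_mul]; gcongr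
    have h2 : |x * d| ≤ b * (2 * Λ ^ 2) := by
      rw [abs_mul, abs_of_pos hx0]
      exact mul_le_mul hx.2 hd (abs_nonneg _) (hx0.le.trans hx.2)
    have h3 : |h * (v * d)| ≤ 1 * (V * (2 * Λ ^ 2)) := by
      rw [abs_mul, abs_mul]; gcongr
    linarith [abs_add_three (v * τ) (x * d) (h * (v * d))]
  have scale : N ≤ stepLoss a b Λ V * x := by
    rw [stepLoss, ← hN, div_mul_eq_mul_div, le_div_iff₀ ha]
    exact mul_le_mul_of_nonneg_left hx.1 ((abs_nonneg _).trans remainder)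
  rw [expand]
  linarith [mul_le_mul_of_nonneg_left scale (sq_nonneg h),
    mul_le_mul_of_nonneg_left (abs_le.1 remainder).1 (sq_nonneg h)]

lemma injOn_id_add_smul {E : Type*} [NormedAddCommGroup E] [NormedSpace ℝ E]
    {R : Set E} {Λ : ℝ≥0} {w : E → E} {h : ℝ} (hw : LipschitzOnWith Λ w R) (hh : |h| * Λ < 1) :
    InjOn (fun x => x + h • w x) R := by
  intro x hx y hy hxy
  have hsub : x - y = h • (w y - w x) := by
    rw [smul_sub, sub_eq_sub_iff_add_eq_add, add_comm (h • w y)]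
    exact hxy
  have hle : ‖x - y‖ ≤ |h| * Λ * ‖x - y‖ := calc
    ‖x - y‖ = |h| * ‖w y - w x‖ := by rw [hsub, norm_smul, Real.norm_eq_abs]
    _ ≤ |h| * (Λ * ‖y - x‖) := by gcongr; exact hw.norm_sub_le hy hx
    _ = |h| * Λ * ‖x - y‖ := by rw [norm_sub_rev]; ring
  have hzero : ‖x - y‖ = 0 := by nlinarith [norm_nonneg (x - y)]
  exact sub_eq_zero.1 (norm_eq_zero.1 hzero)

variable {R A : Set Plane} {Λ : ℝ≥0} {V a b h : ℝ} {w : Plane → Plane}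

lemma IsSolenoidalField.one_sub_stepLoss_mul_le (hw : IsSolenoidalField R Λ V w) (hR : IsOpen R)
    (ha : 0 < a) (hRab : ∀ x ∈ R, x 1 ∈ Icc a b) (hh : |h| ≤ 1) {x : Plane} (hx : x ∈ R)
    (hdiv : ringDiv w x = 0) :
    (1 - stepLoss a b Λ V * h ^ 2) * x 1 ≤
      (ContinuousLinearMap.id ℝ Plane + h • fderiv ℝ w x).det * (x + h • w x) 1 := by
  have hB : ‖fderiv ℝ w x‖ ≤ Λ :=
    norm_fderiv_le_of_lipschitzOn ℝ (hR.mem_nhds hx) hw.lipschitzOnWith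
  rw [det_id_add_smul]
  refine VortexRing.one_sub_stepLoss_mul_le ha (hRab x hx)
    ((abs_coord_le _ 1).trans (hw.norm_le x hx)) ((abs_trace_le _).trans (by gcongr))
    ((abs_det_le _).trans (by gcongr)) hdiv hh

lemma IsSolenoidalField.exists_ae_eq_differentiableAt (hw : IsSolenoidalField R Λ V w)
    (hR : IsOpen R) (hA : MeasurableSet A) (hAR : A ⊆ R) :
    ∃ s ⊆ A, MeasurableSet s ∧ s =ᵐ[volume] A ∧
      ∀ x ∈ s, DifferentiableAt ℝ w x ∧ ringDiv w x = 0 := by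
  have hgood : ∀ᵐ x : Plane, x ∈ R → DifferentiableAt ℝ w x ∧ ringDiv w x = 0 := by
    filter_upwards [hw.lipschitzOnWith.ae_differentiableWithinAt_of_mem, hw.ringDiv_eq_zero]
      with x hx hdiv hxR
    exact ⟨(hx hxR).differentiableAt (hR.mem_nhds hxR), hdiv hxR⟩
  obtain ⟨t, ht, htm, htR⟩ := hgood.exists_measurable_mem
  exact ⟨A ∩ t, inter_subset_left, hA.inter htm,
    inter_ae_eq_left_of_ae_eq_univ (eventuallyEq_univ.2 ht), fun x hx => htR x hx.2 (hAR hx.1)⟩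

lemma IsSolenoidalField.ringVolume_image_ge (hw : IsSolenoidalField R Λ V w) (hR : IsOpen R)
    (ha : 0 < a) (hRab : ∀ x ∈ R, x 1 ∈ Icc a b) (hh : |h| ≤ 1) (hhΛ : |h| * Λ < 1)
    (hhV : |h| * V ≤ a) (hA : MeasurableSet A) (hAR : A ⊆ R) :
    ENNReal.ofReal (1 - stepLoss a b Λ V * h ^ 2) * ringVolume A ≤
      ringVolume ((fun x => x + h • w x) '' A) := by
  set E : Plane → Plane := fun x => x + h • w x
  set D : Plane → Plane →L[ℝ] Plane := fun x => ContinuousLinearMap.id ℝ Plane + h • fderiv ℝ w x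
  obtain ⟨s, hsA, hs, hAs, hgood⟩ := hw.exists_ae_eq_differentiableAt hR hA hAR
  have hpos : ∀ x ∈ s, 0 ≤ E x 1 := fun x hx => by
    have hw1 : |h * w x 1| ≤ a := by
      rw [abs_mul]
      exact (mul_le_mul_of_nonneg_left ((abs_coord_le _ 1).trans (hw.norm_le x (hAR (hsA hx))))
        (abs_nonneg h)).trans hhV
    have hE : E x 1 = x 1 + h * w x 1 := rfl
    linarith [(abs_le.1 hw1).1, (hRab x (hAR (hsA hx))).1]
  calc ENNReal.ofReal (1 - stepLoss a b Λ V * h ^ 2) * ringVolume A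
      = ∫⁻ x in s, ENNReal.ofReal (1 - stepLoss a b Λ V * h ^ 2) * ENNReal.ofReal (x 1) := by
        rw [ringVolume, withDensity_apply _ hA, ← setLIntegral_congr hAs,
          lintegral_const_mul _ (continuous_coord 1).measurable.ennreal_ofReal]
    _ ≤ ∫⁻ x in s, ENNReal.ofReal |(D x).det| * ENNReal.ofReal (E x 1) := by
        refine setLIntegral_mono' hs fun x hx => ?_
        rw [← ENNReal.ofReal_mul' (ha.le.trans (hRab x (hAR (hsA hx))).1),
          ← ENNReal.ofReal_mul' (hpos x hx)]
        exact ENNReal.ofReal_le_ofReal <|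
          (hw.one_sub_stepLoss_mul_le hR ha hRab hh (hAR (hsA hx)) (hgood x hx).2).trans
            (mul_le_mul_of_nonneg_right (le_abs_self _) (hpos x hx))
    _ = ∫⁻ x in E '' s, ENNReal.ofReal (x 1) :=
        (lintegral_image_eq_lintegral_abs_det_fderiv_mul volume hs
          (fun x hx => ((hasFDerivAt_id x).add
            ((hgood x hx).1.hasFDerivAt.const_smul h)).hasFDerivWithinAt)
          ((injOn_id_add_smul hw.lipschitzOnWith hhΛ).mono (hsA.trans hAR))
          fun y => ENNReal.ofReal (y 1)).symm
    _ = ringVolume (E '' s) := by rw [ringVolume, withDensity_apply']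
    _ ≤ ringVolume (E '' A) := measure_mono (image_mono hsA)

end EulerStep

section EulerScheme

/-- The Euler scheme with step `h` for the fields `w 0, w 1, …`, started at `x₀`. -/
def eulerScheme {E : Type*} [AddCommGroup E] [Module ℝ E] (h : ℝ) (w : ℕ → E → E) (x₀ : E) : ℕ → E
  | 0 => x₀
  | k + 1 => eulerScheme h w x₀ k + h • w k (eulerScheme h w x₀ k)

lemma dist_eulerScheme_le {E : Type*} [NormedAddCommGroup E] [NormedSpace ℝ E] {R : Set E}
    {Λ : ℝ≥0} {h e η : ℝ} {w : ℕ → E → E} {x : ℕ → E} {N : ℕ} (he : 0 ≤ e)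
    (hw : ∀ k < N, LipschitzOnWith Λ (w k) R)
    (hstep : ∀ k < N, ‖x (k + 1) - x k - h • w k (x k)‖ ≤ |h| * e)
    (hxR : ∀ k ≤ N, Metric.closedBall (x k) η ⊆ R) (hη : N * |h| * e * (1 + Λ * |h|) ^ N ≤ η) :
    ∀ k ≤ N, dist (eulerScheme h w (x 0) k) (x k) ≤ η := by
  set P := eulerScheme h w (x 0)
  have h1 : 1 ≤ 1 + Λ * |h| := le_add_of_nonneg_right (by positivity)
  have hη0 : 0 ≤ η := le_trans (by positivity) hη
  have of_growth {k : ℕ} (hk : k ≤ N) (hP : ‖P k - x k‖ ≤ k * |h| * e * (1 + Λ * |h|) ^ k) :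
      dist (P k) (x k) ≤ η := by
    rw [dist_eq_norm]
    exact hP.trans (le_trans (by gcongr) hη)
  suffices growth : ∀ k ≤ N, ‖P k - x k‖ ≤ k * |h| * e * (1 + Λ * |h|) ^ k from
    fun k hk => of_growth hk (growth k hk)
  intro k
  induction k with
  | zero => exact fun _ => by simp [P, eulerScheme]
  | succ k ih =>
    intro hk
    have hkN : k < N := hk
    have hPR : P k ∈ R := hxR k hkN.le (of_growth hkN.le (ih hkN.le))
    have hsplit : P (k + 1) - x (k + 1) =
        (P k - x k) + h • (w k (P k) - w k (x k)) - (x (k + 1) - x k - h • w k (x k)) := by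
      simp only [P, eulerScheme, smul_sub]
      abel
    calc ‖P (k + 1) - x (k + 1)‖
        ≤ ‖P k - x k‖ + |h| * ‖w k (P k) - w k (x k)‖ + ‖x (k + 1) - x k - h • w k (x k)‖ := by
          rw [hsplit, ← Real.norm_eq_abs, ← norm_smul]
          exact (norm_sub_le _ _).trans (by gcongr; exact norm_add_le _ _)
      _ ≤ ‖P k - x k‖ + |h| * (Λ * ‖P k - x k‖) + |h| * e := by
          gcongr
          · exact (hw k hkN).norm_sub_le hPR (hxR k hkN.le (Metric.mem_closedBall_self hη0))
          · exact hstep k hkN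
      _ = (1 + Λ * |h|) * ‖P k - x k‖ + |h| * e := by ring
      _ ≤ (1 + Λ * |h|) * (k * |h| * e * (1 + Λ * |h|) ^ k) +
            |h| * e * (1 + Λ * |h|) ^ (k + 1) := by
          gcongr ?_ * ?_ + ?_
          · exact ih hkN.le
          · exact le_mul_of_one_le_right (by positivity) (one_le_pow₀ h1)
      _ = (k + 1 : ℕ) * |h| * e * (1 + Λ * |h|) ^ (k + 1) := by push_cast; ring

lemma continuousOn_eulerScheme {E : Type*} [NormedAddCommGroup E] [NormedSpace ℝ E] {R A : Set E}
    {h : ℝ} {w : ℕ → E → E} {N : ℕ} (hw : ∀ k < N, ContinuousOn (w k) R)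
    (hAR : ∀ k < N, MapsTo (fun x => eulerScheme h w x k) A R) :
    ∀ k ≤ N, ContinuousOn (fun x => eulerScheme h w x k) A := by
  intro k
  induction k with
  | zero => exact fun _ => continuousOn_id
  | succ k ih =>
    intro hk
    have hP := ih (Nat.le_of_succ_le hk)
    exact hP.add (((hw k hk).comp hP (hAR k hk)).const_smul h)

lemma pow_mul_ringVolume_le_eulerScheme {R A : Set Plane} {Λ : ℝ≥0} {V a b h : ℝ}
    {w : ℕ → Plane → Plane} {N : ℕ} (hR : IsOpen R) (ha : 0 < a)
    (hRab : ∀ x ∈ R, x 1 ∈ Icc a b) (hh : |h| ≤ 1) (hhΛ : |h| * Λ < 1) (hhV : |h| * V ≤ a)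
    (hA : IsCompact A) (hw : ∀ k < N, IsSolenoidalField R Λ V (w k))
    (hAR : ∀ k < N, MapsTo (fun x => eulerScheme h w x k) A R) :
    ENNReal.ofReal (1 - stepLoss a b Λ V * h ^ 2) ^ N * ringVolume A ≤
      ringVolume ((fun x => eulerScheme h w x N) '' A) := by
  have hcont := continuousOn_eulerScheme (fun k hk => (hw k hk).lipschitzOnWith.continuousOn) hAR
  suffices ∀ k ≤ N, ENNReal.ofReal (1 - stepLoss a b Λ V * h ^ 2) ^ k * ringVolume A ≤
      ringVolume ((fun x => eulerScheme h w x k) '' A) from this N le_rfl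
  intro k
  induction k with
  | zero => simp [eulerScheme]
  | succ k ih =>
    intro hk
    have hmeas := (hA.image_of_continuousOn (hcont k (Nat.le_of_succ_le hk))).measurableSet
    have hle := (hw k hk).ringVolume_image_ge hR ha hRab hh hhΛ hhV hmeas (hAR k hk).image_subset
    rw [image_image] at hle
    refine le_trans ?_ hle
    rw [pow_succ', mul_assoc]
    gcongr
    exact ih (Nat.le_of_succ_le hk)

end EulerScheme

section Liouville

variable {R A : Set Plane} {X : ℝ → Plane → Plane} {Λ : ℝ≥0} {a b e p q η : ℝ}

/-- During the times of `I`, sufficiently short displacements `X s' x - X s x` of the points `x ∈ A`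
are Euler steps along one solenoidal field, up to an error `|s' - s| * e`. -/
def HasEulerSteps (R A : Set Plane) (I : Set ℝ) (X : ℝ → Plane → Plane) (Λ : ℝ≥0) (e : ℝ) : Prop :=
  ∃ V, ∃ h₀ > 0, ∀ s ∈ I, ∀ s' ∈ I, |s' - s| ≤ h₀ → ∃ w, IsSolenoidalField R Λ V w ∧
    ∀ x ∈ A, ‖X s' x - X s x - (s' - s) • w (X s x)‖ ≤ |s' - s| * e

lemma HasEulerSteps.mono {A' : Set Plane} {I I' : Set ℝ} (h : HasEulerSteps R A I X Λ e)
    (hA : A' ⊆ A) (hI : I' ⊆ I) : HasEulerSteps R A' I' X Λ e := by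
  obtain ⟨V, h₀, hh₀, hstep⟩ := h
  refine ⟨V, h₀, hh₀, fun s hs s' hs' hss => ?_⟩
  obtain ⟨w, hw, hX⟩ := hstep s (hI hs) s' (hI hs') hss
  exact ⟨w, hw, fun x hx => hX x (hA hx)⟩

lemma add_mul_sub_div_mem_uIcc (p q : ℝ) {k n : ℕ} (hk : k ≤ n) :
    p + k * ((q - p) / n) ∈ uIcc p q := by
  rw [← segment_eq_uIcc, segment_eq_image']
  exact ⟨k / n, ⟨by positivity, div_le_one_of_le₀ (by exact_mod_cast hk) (by positivity)⟩,
    by simp only [smul_eq_mul]; ring⟩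

lemma mul_one_add_pow_le_exp {n : ℕ} {h D : ℝ} (he : 0 ≤ e) (hnh : n * |h| = D) :
    n * |h| * e * (1 + Λ * |h|) ^ n ≤ D * e * exp (Λ * D) := by
  have hD : 0 ≤ D := hnh ▸ by positivity
  rw [hnh]
  gcongr
  calc (1 + Λ * |h|) ^ n ≤ exp (Λ * |h|) ^ n := by
        gcongr
        rw [add_comm]
        exact Real.add_one_le_exp _
    _ = exp (Λ * D) := by rw [← Real.exp_nat_mul, ← hnh]; ring_nf

lemma tendsto_ofReal_one_sub_mul_div_sq_pow (C D : ℝ) :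
    Tendsto (fun n : ℕ => ENNReal.ofReal (1 - C * (D / n) ^ 2) ^ n) atTop (𝓝 1) := by
  have hlim : Tendsto (fun n : ℕ => D / (n : ℝ)) atTop (𝓝 0) :=
    tendsto_const_div_atTop_nhds_zero_nat D
  have hpow : Tendsto (fun n : ℕ => (1 + -(C * (D / n) ^ 2)) ^ n) atTop (𝓝 (exp 0)) := by
    refine Real.tendsto_one_add_pow_exp_of_tendsto ?_
    refine (tendsto_const_div_atTop_nhds_zero_nat (-(C * D ^ 2))).congr' ?_
    filter_upwards [eventually_gt_atTop 0] with n hn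
    field_simp
  have hpos : ∀ᶠ n : ℕ in atTop, C * (D / (n : ℝ)) ^ 2 < 1 :=
    ((hlim.pow 2).const_mul C).eventually_lt_const (by simp)
  rw [Real.exp_zero] at hpow
  rw [← ENNReal.ofReal_one]
  refine (ENNReal.tendsto_ofReal hpow).congr' ?_
  filter_upwards [hpos] with n hn
  rw [← sub_eq_add_neg, ENNReal.ofReal_pow (by linarith)]

lemma eventually_pow_mul_ringVolume_image_le (hR : IsOpen R) (ha : 0 < a)
    (hRab : ∀ x ∈ R, x 1 ∈ Icc a b) (hA : IsCompact A) (hXp : ContinuousOn (X p) A)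
    (hXR : ∀ s ∈ uIcc p q, ∀ x ∈ A, Metric.closedBall (X s x) η ⊆ R)
    (he : 0 ≤ e) (hX : HasEulerSteps R A (uIcc p q) X Λ e)
    (hη : |q - p| * e * exp (Λ * |q - p|) ≤ η) :
    ∃ C, ∀ᶠ n : ℕ in atTop, ENNReal.ofReal (1 - C * ((q - p) / n) ^ 2) ^ n * ringVolume (X p '' A) ≤
      ringVolume (Metric.cthickening η (X q '' A)) := by
  obtain ⟨V, h₀, hh₀, hstep⟩ := hX
  refine ⟨stepLoss a b Λ V, ?_⟩
  have hlim : Tendsto (fun n : ℕ => |(q - p) / (n : ℝ)|) atTop (𝓝 0) := by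
    simpa using (tendsto_const_div_atTop_nhds_zero_nat (q - p)).abs
  filter_upwards [hlim.eventually_lt_const one_pos, hlim.eventually_lt_const hh₀,
    (hlim.mul_const (Λ : ℝ)).eventually_lt_const (u := 1) (by simp),
    (hlim.mul_const V).eventually_lt_const (u := a) (by simpa using ha), eventually_gt_atTop 0]
    with n hone hshort hΛ hV hn
  set h := (q - p) / n
  have : (0 : ℝ) < n := by exact_mod_cast hn
  have hnh : n * |h| = |q - p| := by rw [abs_div, Nat.abs_cast]; field_simp
  set t : ℕ → ℝ := fun k => p + k * h with ht
  have ht0 : t 0 = p := by simp [ht]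
  have htn : t n = q := by simp only [ht, h]; field_simp; ring
  have htmem : ∀ k ≤ n, t k ∈ uIcc p q := fun k hk => add_mul_sub_div_mem_uIcc p q hk
  have hfield : ∀ k < n, ∃ w, IsSolenoidalField R Λ V w ∧
      ∀ x ∈ A, ‖X (t (k + 1)) x - X (t k) x - h • w (X (t k) x)‖ ≤ |h| * e := fun k hk => by
    have hdiff : t (k + 1) - t k = h := by simp only [ht]; push_cast; ring
    simpa only [hdiff] using
      hstep _ (htmem k hk.le) _ (htmem (k + 1) hk) (by rw [hdiff]; exact hshort.le)
  choose! w hw hwX using hfield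
  have hdist : ∀ x ∈ A, ∀ k ≤ n, dist (eulerScheme h w (X p x) k) (X (t k) x) ≤ η := fun x hx => by
    simpa only [ht0] using dist_eulerScheme_le (x := fun k => X (t k) x) he
      (fun k hk => (hw k hk).lipschitzOnWith) (fun k hk => hwX k hk x hx)
      (fun k hk => hXR _ (htmem k hk) x hx) ((mul_one_add_pow_le_exp he hnh).trans hη)
  refine (pow_mul_ringVolume_le_eulerScheme hR ha hRab hone.le hΛ hV.le
    (hA.image_of_continuousOn hXp) hw ?_).trans (measure_mono ?_)
  · rintro k hk _ ⟨x, hx, rfl⟩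
    exact hXR _ (htmem k hk.le) x hx (hdist x hx k hk.le)
  · rintro _ ⟨_, ⟨x, hx, rfl⟩, rfl⟩
    exact Metric.mem_cthickening_of_dist_le _ (X q x) _ _ (mem_image_of_mem _ hx)
      (htn ▸ hdist x hx n le_rfl)

lemma ringVolume_image_le_of_hasEulerSteps (hR : IsOpen R) (ha : 0 < a)
    (hRab : ∀ x ∈ R, x 1 ∈ Icc a b) {ρ : ℝ} (hρ : 0 < ρ) (hA : IsCompact A)
    (hXp : ContinuousOn (X p) A) (hXq : ContinuousOn (X q) A)
    (hXR : ∀ s ∈ uIcc p q, ∀ x ∈ A, Metric.closedBall (X s x) ρ ⊆ R)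
    (hX : ∀ η > 0, ∃ Λ e, 0 ≤ e ∧ HasEulerSteps R A (uIcc p q) X Λ e ∧
      |q - p| * e * exp (Λ * |q - p|) ≤ η) :
    ringVolume (X p '' A) ≤ ringVolume (X q '' A) := by
  have hthick : ∀ η ∈ Ioc 0 ρ,
      ringVolume (X p '' A) ≤ ringVolume (Metric.cthickening η (X q '' A)) := by
    rintro η ⟨hη, hηρ⟩
    obtain ⟨Λ, e, he, hsteps, hsmall⟩ := hX η hη
    obtain ⟨C, hC⟩ := eventually_pow_mul_ringVolume_image_le hR ha hRab hA hXp
      (fun s hs x hx => (Metric.closedBall_subset_closedBall hηρ).trans (hXR s hs x hx))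
      he hsteps hsmall
    have hlim := ENNReal.Tendsto.mul_const (b := ringVolume (X p '' A))
      (tendsto_ofReal_one_sub_mul_div_sq_pow C (q - p)) (Or.inl one_ne_zero)
    simpa only [one_mul] using le_of_tendsto hlim hC
  have hlim := tendsto_measure_cthickening_of_isCompact (μ := ringVolume)
    (hA.image_of_continuousOn hXq)
  refine ge_of_tendsto (hlim.mono_left (nhdsWithin_le_nhds (s := Ioi 0))) ?_
  filter_upwards [Ioc_mem_nhdsGT hρ] with η hη using hthick η hη

end Liouville

section Box

/-- The bounded open region `{x : a < x₂, |x| < b}`; for `0 < a` it stays away from the axis, where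
the kernel estimates degenerate. -/
def box (a b : ℝ) : Set Plane := {x | a < x 1} ∩ Metric.ball 0 b

variable {a b : ℝ} {x : Plane}

lemma isOpen_box (a b : ℝ) : IsOpen (box a b) :=
  (isOpen_lt continuous_const (continuous_coord 1)).inter Metric.isOpen_ball

lemma convex_box (a b : ℝ) : Convex ℝ (box a b) :=
  (convex_halfSpace_gt (f := fun x : Plane => x 1) ⟨fun _ _ => rfl, fun _ _ => rfl⟩ a).inter
    (convex_ball 0 b)

lemma norm_lt_of_mem_box (hx : x ∈ box a b) : ‖x‖ < b := mem_ball_zero_iff.1 hx.2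

lemma pos_of_mem_box (hx : x ∈ box a b) : 0 < b := (norm_nonneg x).trans_lt (norm_lt_of_mem_box hx)

lemma coord_mem_Icc_of_mem_box (hx : x ∈ box a b) : x 1 ∈ Icc a b :=
  ⟨hx.1.le, (le_abs_self _).trans ((abs_coord_le x 1).trans (norm_lt_of_mem_box hx).le)⟩

end Box

section RegularizedKernel

/-- Numerators of the two components of the Biot–Savart kernel. -/
def kernelNum (i : Fin 2) (x y : Plane) (θ : ℝ) : ℝ :=
  ![y 1 * (y 1 - x 1 * cos θ), y 1 * (x 0 - y 0) * cos θ] i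

/-- The regularized distance whose cube is the denominator of the regularized kernel. -/
def regDist (δ : ℝ) (x y : Plane) (θ : ℝ) : ℝ := √(bracket x y θ + δ ^ 2)

/-- Integrand of the regularized Biot–Savart kernel; `δ = 0` is the kernel itself. -/
def regKernel (i : Fin 2) (δ : ℝ) (x y : Plane) (θ : ℝ) : ℝ :=
  kernelNum i x y θ / regDist δ x y θ ^ 3

/-- Derivative in `x` of the numerators. -/
def kernelNumDeriv (i : Fin 2) (y : Plane) (θ : ℝ) : Plane →L[ℝ] ℝ :=
  ![(-(y 1 * cos θ)) • EuclideanSpace.proj (𝕜 := ℝ) (1 : Fin 2),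
    (y 1 * cos θ) • EuclideanSpace.proj (𝕜 := ℝ) (0 : Fin 2)] i

/-- Derivative in `x` of the bracket. -/
def bracketDeriv (x y : Plane) (θ : ℝ) : Plane →L[ℝ] ℝ :=
  (2 : ℝ) • innerSL ℝ (x - y) +
    (2 * y 1 * (1 - cos θ)) • EuclideanSpace.proj (𝕜 := ℝ) (1 : Fin 2)

/-- Derivative in `x` of the regularized kernel. -/
def regKernelDeriv (i : Fin 2) (δ : ℝ) (x y : Plane) (θ : ℝ) : Plane →L[ℝ] ℝ :=
  (regDist δ x y θ ^ 3)⁻¹ • kernelNumDeriv i y θ -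
    (3 / 2 * kernelNum i x y θ / regDist δ x y θ ^ 5) • bracketDeriv x y θ

variable {δ θ : ℝ} {x y : Plane}

lemma hasFDerivAt_coord (i : Fin 2) (x : Plane) :
    HasFDerivAt (fun x : Plane => x i) (EuclideanSpace.proj (𝕜 := ℝ) i) x :=
  (EuclideanSpace.proj (𝕜 := ℝ) i : Plane →L[ℝ] ℝ).hasFDerivAt

lemma hasFDerivAt_kernelNum (i : Fin 2) (x y : Plane) (θ : ℝ) :
    HasFDerivAt (fun x => kernelNum i x y θ) (kernelNumDeriv i y θ) x := by
  fin_cases i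
  · refine ((((hasFDerivAt_coord 1 x).mul_const (cos θ)).const_sub (y 1)).const_mul
      (y 1)).congr_fderiv ?_
    ext v
    simp only [kernelNumDeriv, Fin.zero_eta, Matrix.cons_val_zero, neg_apply, smul_apply,
      smul_eq_mul]
    ring
  · refine ((((hasFDerivAt_coord 0 x).sub_const (y 0)).const_mul (y 1)).mul_const
      (cos θ)).congr_fderiv ?_
    ext v
    simp only [kernelNumDeriv, Fin.mk_one, Matrix.cons_val_one, Matrix.cons_val_fin_one, smul_apply,
      smul_eq_mul]
    ring

lemma hasFDerivAt_bracket (x y : Plane) (θ : ℝ) :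
    HasFDerivAt (fun x => bracket x y θ) (bracketDeriv x y θ) x := by
  refine (((hasFDerivAt_id x).sub_const y).norm_sq.add
    ((((hasFDerivAt_coord 1 x).const_mul 2).mul_const (y 1)).mul_const
      (1 - cos θ))).congr_fderiv ?_
  ext v
  simp only [bracketDeriv, id_eq, ContinuousLinearMap.comp_id, add_apply, smul_apply, nsmul_eq_mul,
    Nat.cast_ofNat, smul_eq_mul]
  ring

lemma hasFDerivAt_regKernel (i : Fin 2) (h : 0 < bracket x y θ + δ ^ 2) :
    HasFDerivAt (fun x => regKernel i δ x y θ) (regKernelDeriv i δ x y θ) x := by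
  have hpos : 0 < regDist δ x y θ := Real.sqrt_pos.2 h
  have hdist : HasFDerivAt (fun x => regDist δ x y θ)
      ((1 / (2 * regDist δ x y θ)) • bracketDeriv x y θ) x :=
    ((hasFDerivAt_bracket x y θ).add_const (δ ^ 2)).sqrt h.ne'
  refine ((hasFDerivAt_kernelNum i x y θ).mul
    ((hasDerivAt_inv (pow_pos hpos 3).ne').comp_hasFDerivAt x (hdist.pow 3))).congr_fderiv ?_
  ext v
  simp only [regKernelDeriv, Function.comp_apply, add_apply, sub_apply, smul_apply, smul_eq_mul,
    nsmul_eq_mul, Nat.cast_ofNat]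
  field_simp
  ring

lemma bracket_nonneg (hx : 0 ≤ x 1) (hy : 0 ≤ y 1) (θ : ℝ) : 0 ≤ bracket x y θ := by
  have := sub_nonneg.2 (Real.cos_le_one θ)
  unfold bracket
  positivity

lemma regDist_nonneg : 0 ≤ regDist δ x y θ := Real.sqrt_nonneg _

lemma regDist_sq (hx : 0 ≤ x 1) (hy : 0 ≤ y 1) : regDist δ x y θ ^ 2 = bracket x y θ + δ ^ 2 :=
  Real.sq_sqrt (add_nonneg (bracket_nonneg hx hy θ) (sq_nonneg δ))

lemma le_regDist (hx : 0 ≤ x 1) (hy : 0 ≤ y 1) : δ ≤ regDist δ x y θ :=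
  Real.le_sqrt_of_sq_le (le_add_of_nonneg_left (bracket_nonneg hx hy θ))

lemma norm_sub_le_regDist (hx : 0 ≤ x 1) (hy : 0 ≤ y 1) : ‖x - y‖ ≤ regDist δ x y θ := by
  refine Real.le_sqrt_of_sq_le ?_
  have := sub_nonneg.2 (Real.cos_le_one θ)
  rw [bracket, add_assoc]
  exact le_add_of_nonneg_right (by positivity)

lemma two_mul_sq_mul_one_sub_cos_le {a : ℝ} (ha : 0 ≤ a) (hx : a ≤ x 1) (hy : a ≤ y 1) :
    2 * a ^ 2 * (1 - cos θ) ≤ bracket x y θ + δ ^ 2 := by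
  have hcos := sub_nonneg.2 (Real.cos_le_one θ)
  have hmul : a * a ≤ x 1 * y 1 := mul_le_mul hx hy ha (ha.trans hx)
  rw [bracket]
  nlinarith [mul_le_mul_of_nonneg_right hmul hcos, sq_nonneg δ, sq_nonneg ‖x - y‖]

lemma mul_one_sub_cos_le_regDist {a : ℝ} (ha : 0 ≤ a) (hx : a ≤ x 1) (hy : a ≤ y 1) :
    a * (1 - cos θ) ≤ regDist δ x y θ := by
  refine Real.le_sqrt_of_sq_le (le_trans ?_ (two_mul_sq_mul_one_sub_cos_le ha hx hy))
  have hcos := sub_nonneg.2 (Real.cos_le_one θ)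
  have hcos2 : 1 - cos θ ≤ 2 := by linarith [Real.neg_one_le_cos θ]
  nlinarith [mul_nonneg (sq_nonneg a) (mul_nonneg hcos (sub_nonneg.2 hcos2))]

lemma mul_abs_angle_le_regDist {a : ℝ} (ha : 0 ≤ a) (hx : a ≤ x 1) (hy : a ≤ y 1)
    (hθ : |θ| ≤ π) : 2 * a / π * |θ| ≤ regDist δ x y θ := by
  refine Real.le_sqrt_of_sq_le (le_trans ?_ (two_mul_sq_mul_one_sub_cos_le ha hx hy))
  calc (2 * a / π * |θ|) ^ 2 = 2 * a ^ 2 * (2 / π ^ 2 * θ ^ 2) := by rw [mul_pow, sq_abs]; ring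
    _ ≤ 2 * a ^ 2 * (1 - cos θ) := by
        gcongr
        exact le_sub_comm.1 (Real.cos_le_one_sub_mul_cos_sq hθ)

/-- The constant of comparison between the regularized distance and the distance in the variables
`(y, θ)` for points at distance at least `a` from the axis. -/
def lowerConst (a : ℝ) : ℝ := min 1 (2 * a / π)

lemma lowerConst_pos {a : ℝ} (ha : 0 < a) : 0 < lowerConst a :=
  lt_min one_pos (by have := Real.pi_pos; positivity)

lemma lowerConst_mul_norm_le {a : ℝ} (ha : 0 < a) (hx : a ≤ x 1) (hy : a ≤ y 1) (hθ : |θ| ≤ π) :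
    lowerConst a * ‖(y, θ) - (x, 0)‖ ≤ regDist δ x y θ := by
  rw [Prod.mk_sub_mk, sub_zero, Prod.norm_mk, mul_max_of_nonneg _ _ (lowerConst_pos ha).le]
  refine max_le ?_ ?_
  · rw [norm_sub_rev]
    exact (mul_le_of_le_one_left (norm_nonneg _) (min_le_left _ _)).trans
      (norm_sub_le_regDist (ha.le.trans hx) (ha.le.trans hy))
  · exact (mul_le_mul_of_nonneg_right (min_le_right _ _) (norm_nonneg _)).trans
      (mul_abs_angle_le_regDist ha.le hx hy hθ)

variable {a b : ℝ}

lemma mul_one_sub_cos_le (ha : 0 < a) (hx : x ∈ box a b) (hy : y ∈ box a b) :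
    b * (1 - cos θ) ≤ b / a * regDist δ x y θ := by
  have hb := pos_of_mem_box hx
  calc b * (1 - cos θ) = b / a * (a * (1 - cos θ)) := by field_simp
    _ ≤ b / a * regDist δ x y θ := by
        gcongr
        exact mul_one_sub_cos_le_regDist ha.le hx.1.le hy.1.le

lemma abs_kernelNum_le (ha : 0 < a) (hx : x ∈ box a b) (hy : y ∈ box a b) (i : Fin 2) :
    |kernelNum i x y θ| ≤ b * (1 + b / a) * regDist δ x y θ := by
  have hb := pos_of_mem_box hx
  have hx0 : 0 ≤ x 1 := ha.le.trans hx.1.le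
  have hy0 : 0 ≤ y 1 := ha.le.trans hy.1.le
  have hyb : y 1 ≤ b := (coord_mem_Icc_of_mem_box hy).2
  have hcoord (j : Fin 2) : |(x - y) j| ≤ regDist δ x y θ :=
    (abs_coord_le _ j).trans (norm_sub_le_regDist hx0 hy0)
  have hcos := sub_nonneg.2 (Real.cos_le_one θ)
  have hdist : 0 ≤ regDist δ x y θ := regDist_nonneg
  fin_cases i
  · have hsplit : y 1 - x 1 * cos θ = -((x - y) 1) + x 1 * (1 - cos θ) := by
      simp only [PiLp.sub_apply]
      ring
    have hdiff : |y 1 - x 1 * cos θ| ≤ regDist δ x y θ + b / a * regDist δ x y θ := by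
      rw [hsplit]
      refine (abs_add_le _ _).trans (add_le_add ((abs_neg _).trans_le (hcoord 1)) ?_)
      rw [abs_of_nonneg (mul_nonneg hx0 hcos)]
      exact (mul_le_mul_of_nonneg_right (coord_mem_Icc_of_mem_box hx).2 hcos).trans
        (mul_one_sub_cos_le ha hx hy)
    calc |y 1 * (y 1 - x 1 * cos θ)| = y 1 * |y 1 - x 1 * cos θ| := by
          rw [abs_mul, abs_of_nonneg hy0]
      _ ≤ b * (regDist δ x y θ + b / a * regDist δ x y θ) := by gcongr
      _ = b * (1 + b / a) * regDist δ x y θ := by ring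
  · calc |y 1 * (x - y) 0 * cos θ| = y 1 * |(x - y) 0| * |cos θ| := by
          rw [abs_mul, abs_mul, abs_of_nonneg hy0]
      _ ≤ b * regDist δ x y θ * 1 := by
          gcongr
          · exact hcoord 0
          · exact Real.abs_cos_le_one θ
      _ ≤ b * (1 + b / a) * regDist δ x y θ := by
          rw [mul_one]
          gcongr
          exact le_mul_of_one_le_right hb.le (le_add_of_nonneg_right (by positivity))

lemma norm_proj_le (i : Fin 2) : ‖(EuclideanSpace.proj i : Plane →L[ℝ] ℝ)‖ ≤ 1 :=
  ContinuousLinearMap.opNorm_le_bound _ zero_le_one fun x =>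
    (abs_coord_le x i).trans (one_mul _).ge

lemma norm_kernelNumDeriv_le (ha : 0 ≤ a) (hy : y ∈ box a b) (i : Fin 2) :
    ‖kernelNumDeriv i y θ‖ ≤ b := by
  have hy0 : 0 ≤ y 1 := ha.trans hy.1.le
  have hcoeff : |y 1 * cos θ| ≤ b := by
    rw [abs_mul, abs_of_nonneg hy0]
    exact (mul_le_of_le_one_right hy0 (Real.abs_cos_le_one θ)).trans
      (coord_mem_Icc_of_mem_box hy).2
  have hsmul (c : ℝ) (hc : |c| ≤ b) (j : Fin 2) :
      ‖c • (EuclideanSpace.proj j : Plane →L[ℝ] ℝ)‖ ≤ b := by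
    rw [norm_smul, Real.norm_eq_abs]
    exact (mul_le_of_le_one_right (abs_nonneg _) (norm_proj_le j)).trans hc
  fin_cases i
  · exact hsmul _ (by rwa [abs_neg]) 1
  · exact hsmul _ hcoeff 0

lemma norm_bracketDeriv_le (ha : 0 < a) (hx : x ∈ box a b) (hy : y ∈ box a b) :
    ‖bracketDeriv x y θ‖ ≤ 2 * (1 + b / a) * regDist δ x y θ := by
  have hy0 : 0 ≤ y 1 := ha.le.trans hy.1.le
  have hcos := sub_nonneg.2 (Real.cos_le_one θ)
  calc ‖bracketDeriv x y θ‖ ≤ ‖(2 : ℝ) • innerSL ℝ (x - y)‖ + ‖(2 * y 1 * (1 - cos θ)) •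
        (EuclideanSpace.proj (1 : Fin 2) : Plane →L[ℝ] ℝ)‖ := norm_add_le _ _
    _ ≤ 2 * ‖x - y‖ + 2 * y 1 * (1 - cos θ) * 1 := by
        rw [norm_smul, norm_smul, innerSL_apply_norm, Real.norm_eq_abs, Real.norm_eq_abs,
          abs_of_nonneg (by positivity : 0 ≤ 2 * y 1 * (1 - cos θ)), abs_two]
        gcongr
        exact norm_proj_le 1
    _ ≤ 2 * ‖x - y‖ + 2 * (b * (1 - cos θ)) := by
        rw [mul_one, mul_assoc]
        gcongr
        exact (coord_mem_Icc_of_mem_box hy).2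
    _ ≤ 2 * regDist δ x y θ + 2 * (b / a * regDist δ x y θ) := by
        gcongr 2 * ?_ + 2 * ?_
        · exact norm_sub_le_regDist (ha.le.trans hx.1.le) hy0
        · exact mul_one_sub_cos_le ha hx hy
    _ = 2 * (1 + b / a) * regDist δ x y θ := by ring

lemma norm_regKernelDeriv_le (ha : 0 < a) (hδ : 0 < δ) (hx : x ∈ box a b) (hy : y ∈ box a b)
    (i : Fin 2) :
    ‖regKernelDeriv i δ x y θ‖ ≤
      (b + 3 * (b * (1 + b / a) * (1 + b / a))) / regDist δ x y θ ^ 3 := by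
  have hb := pos_of_mem_box hx
  have hd : 0 < regDist δ x y θ :=
    hδ.trans_le (le_regDist (ha.le.trans hx.1.le) (ha.le.trans hy.1.le))
  have hnum := abs_kernelNum_le (δ := δ) (θ := θ) ha hx hy i
  have hnumD := norm_kernelNumDeriv_le (θ := θ) ha.le hy i
  have hbracketD := norm_bracketDeriv_le (δ := δ) (θ := θ) ha hx hy
  set d := regDist δ x y θ
  calc ‖regKernelDeriv i δ x y θ‖ ≤ ‖(d ^ 3)⁻¹ • kernelNumDeriv i y θ‖ +
        ‖(3 / 2 * kernelNum i x y θ / d ^ 5) • bracketDeriv x y θ‖ := norm_sub_le _ _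
    _ = (d ^ 3)⁻¹ * ‖kernelNumDeriv i y θ‖ +
          3 / 2 * |kernelNum i x y θ| / d ^ 5 * ‖bracketDeriv x y θ‖ := by
        rw [norm_smul, norm_smul, Real.norm_eq_abs, Real.norm_eq_abs, abs_inv, abs_div, abs_mul,
          abs_of_pos (pow_pos hd 3), abs_of_pos (pow_pos hd 5)]
        norm_num
    _ ≤ (d ^ 3)⁻¹ * b + 3 / 2 * (b * (1 + b / a) * d) / d ^ 5 * (2 * (1 + b / a) * d) := by
        gcongr
    _ = (b + 3 * (b * (1 + b / a) * (1 + b / a))) / d ^ 3 := by field_simp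

lemma abs_regKernel_le (ha : 0 < a) (hx : x ∈ box a b) (hy : y ∈ box a b) (i : Fin 2) :
    |regKernel i δ x y θ| ≤ b * (1 + b / a) / regDist δ x y θ ^ 2 := by
  rcases (regDist_nonneg (δ := δ) (x := x) (y := y) (θ := θ)).eq_or_lt with h | h
  · simp [regKernel, ← h]
  · rw [regKernel, abs_div, abs_of_pos (pow_pos h 3), div_le_div_iff₀ (by positivity)
      (by positivity)]
    calc |kernelNum i x y θ| * regDist δ x y θ ^ 2
        ≤ b * (1 + b / a) * regDist δ x y θ * regDist δ x y θ ^ 2 := by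
          gcongr
          exact abs_kernelNum_le ha hx hy i
      _ = b * (1 + b / a) * regDist δ x y θ ^ 3 := by ring

-- `e - d ≤ √δ √e` trades part of the singularity for a factor that vanishes with `δ`.
lemma mul_inv_cube_sub_inv_cube_le {d e : ℝ} (hd : 0 < d) (hde : d ≤ e) (hed : e ≤ d + δ) :
    d * (1 / d ^ 3 - 1 / e ^ 3) ≤ 3 * √δ * d ^ (-(5 / 2) : ℝ) := by
  have he : 0 < e := hd.trans_le hde
  have hse : √e * √e = e := Real.mul_self_sqrt he.le
  have hsub : e - d ≤ √δ * √e := by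
    rw [← Real.sqrt_mul (by linarith)]
    refine Real.le_sqrt_of_sq_le ?_
    nlinarith
  have hsum : e ^ 2 + e * d + d ^ 2 ≤ 3 * e ^ 2 := by nlinarith
  have hrpow : d ^ (-(5 / 2) : ℝ) = d / (d ^ 3 * √d) := by
    rw [Real.rpow_neg hd.le, show (5 / 2 : ℝ) = 2 + 1 / 2 by norm_num, Real.rpow_add hd,
      ← Real.sqrt_eq_rpow]
    norm_cast
    field_simp
  calc d * (1 / d ^ 3 - 1 / e ^ 3)
      = d * ((e - d) * (e ^ 2 + e * d + d ^ 2) / (d ^ 3 * e ^ 3)) := by field_simp; ring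
    _ ≤ d * ((√δ * √e) * (3 * e ^ 2) / (d ^ 3 * e ^ 3)) := by gcongr
    _ = d * (3 * √δ / (d ^ 3 * √e)) := by
        congr 1
        rw [div_eq_div_iff (by positivity) (by positivity)]
        linear_combination (3 * √δ * e ^ 2 * d ^ 3) * hse
    _ ≤ d * (3 * √δ / (d ^ 3 * √d)) := by gcongr
    _ = 3 * √δ * d ^ (-(5 / 2) : ℝ) := by rw [hrpow]; ring

lemma abs_regKernel_zero_sub_le (ha : 0 < a) (hδ : 0 < δ) (hx : x ∈ box a b) (hy : y ∈ box a b)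
    (i : Fin 2) (hpos : 0 < regDist 0 x y θ) :
    |regKernel i 0 x y θ - regKernel i δ x y θ| ≤
      3 * (b * (1 + b / a)) * √δ * (regDist 0 x y θ) ^ (-(5 / 2) : ℝ) := by
  have hb := pos_of_mem_box hx
  have hnum := abs_kernelNum_le (δ := 0) (θ := θ) ha hx hy i
  have hsq (δ : ℝ) : regDist δ x y θ ^ 2 = bracket x y θ + δ ^ 2 :=
    regDist_sq (ha.le.trans hx.1.le) (ha.le.trans hy.1.le)
  have hsq0 := hsq 0
  have hsqδ := hsq δ
  have he : 0 ≤ regDist δ x y θ := regDist_nonneg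
  set d := regDist 0 x y θ with hd
  set e := regDist δ x y θ with he
  have hde : d ≤ e := by nlinarith [sq_nonneg δ]
  have hed : e ≤ d + δ := by nlinarith
  have hinv : 0 ≤ 1 / d ^ 3 - 1 / e ^ 3 := sub_nonneg.2 (by gcongr)
  have hsub : regKernel i 0 x y θ - regKernel i δ x y θ =
      kernelNum i x y θ * (1 / d ^ 3 - 1 / e ^ 3) := by
    simp only [regKernel, ← hd, ← he]
    ring
  calc |regKernel i 0 x y θ - regKernel i δ x y θ|
      = |kernelNum i x y θ| * (1 / d ^ 3 - 1 / e ^ 3) := by rw [hsub, abs_mul, abs_of_nonneg hinv]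
    _ ≤ b * (1 + b / a) * d * (1 / d ^ 3 - 1 / e ^ 3) := by gcongr
    _ = b * (1 + b / a) * (d * (1 / d ^ 3 - 1 / e ^ 3)) := by ring
    _ ≤ b * (1 + b / a) * (3 * √δ * d ^ (-(5 / 2) : ℝ)) := by
        gcongr b * (1 + b / a) * ?_
        exact mul_inv_cube_sub_inv_cube_le hpos hde hed
    _ = 3 * (b * (1 + b / a)) * √δ * d ^ (-(5 / 2) : ℝ) := by ring

end RegularizedKernel

section RadialMajorant

/-- The measure `dy dθ` on the plane times `(0, π]`, against which the Biot–Savart kernel is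
integrated. -/
def angleMeasure : Measure (Plane × ℝ) :=
  (volume : Measure Plane).prod (volume.restrict (Ioc 0 π))

instance : SFinite angleMeasure := by
  unfold angleMeasure
  infer_instance

instance : (volume : Measure (Plane × ℝ)).IsAddHaarMeasure := by
  rw [Measure.volume_eq_prod]
  infer_instance

lemma angleMeasure_le : angleMeasure ≤ (volume : Measure (Plane × ℝ)) := by
  rw [angleMeasure, Measure.volume_eq_prod]
  exact Measure.prod_mono le_rfl Measure.restrict_le_self

lemma ae_angleMeasure : ∀ᵐ z ∂angleMeasure, z.2 ∈ Ioc 0 π :=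
  Measure.quasiMeasurePreserving_snd.ae (ae_restrict_mem measurableSet_Ioc)

lemma finrank_plane_prod : Module.finrank ℝ (Plane × ℝ) = 3 := by simp

variable {a b δ r : ℝ} {x : Plane} {z : Plane × ℝ}

lemma sub_mem_ball_of_mem_box (hx : x ∈ box a b) (hz : z.1 ∈ box a b) (hθ : z.2 ∈ Ioc 0 π) :
    z - (x, 0) ∈ Metric.ball (0 : Plane × ℝ) (2 * b + 4) := by
  have hxb := norm_lt_of_mem_box hx
  have hzb := norm_lt_of_mem_box hz
  rw [mem_ball_zero_iff, Prod.norm_def]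
  refine max_lt ((norm_sub_le _ _).trans_lt (by linarith)) ?_
  simp only [Prod.snd_sub, sub_zero, Real.norm_eq_abs, abs_of_pos hθ.1]
  linarith [hθ.2, Real.pi_lt_four, pos_of_mem_box hx]

lemma norm_sub_pos_of_angle_pos (hθ : 0 < z.2) : 0 < ‖z - (x, 0)‖ :=
  norm_pos_iff.2 fun h => hθ.ne' (congrArg Prod.snd (sub_eq_zero.1 h))

lemma lowerConst_mul_norm_le_of_mem_box (ha : 0 < a) (hx : x ∈ box a b) (hz : z.1 ∈ box a b)
    (hθ : z.2 ∈ Ioc 0 π) : lowerConst a * ‖z - (x, 0)‖ ≤ regDist δ x z.1 z.2 :=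
  lowerConst_mul_norm_le ha hx.1.le hz.1.le ((abs_of_pos hθ.1).trans_le hθ.2)

lemma integrable_and_integral_norm_le_of_radial_bound {E : Type*} [NormedAddCommGroup E]
    {K : Plane × ℝ → E} {G : ℝ → ℝ} (hG0 : ∀ t, 0 ≤ t → 0 ≤ G t)
    (hG : IntegrableOn (fun z : Plane × ℝ => G ‖z‖) (Metric.ball 0 (2 * b + 4)))
    (hK : AEStronglyMeasurable K angleMeasure) (hx : x ∈ box a b)
    (hsupp : ∀ z : Plane × ℝ, z.1 ∉ box a b → K z = 0)
    (hKG : ∀ z : Plane × ℝ, z.1 ∈ box a b → z.2 ∈ Ioc 0 π → ‖K z‖ ≤ G ‖z - (x, 0)‖) :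
    Integrable K angleMeasure ∧ ∫ z, ‖K z‖ ∂angleMeasure ≤
      ∫ z in Metric.ball (0 : Plane × ℝ) (2 * b + 4), G ‖z‖ := by
  set Φ : Plane × ℝ → ℝ := (Metric.ball 0 (2 * b + 4)).indicator fun z => G ‖z‖ with hΦdef
  have hΦ : Integrable Φ := (integrable_indicator_iff Metric.isOpen_ball.measurableSet).2 hG
  have hΦ0 (z) : 0 ≤ Φ z := indicator_nonneg (fun _ _ => hG0 _ (norm_nonneg _)) z
  have hΦx : Integrable (fun z : Plane × ℝ => Φ (z - (x, 0))) := hΦ.comp_sub_right _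
  have hΦa := hΦx.mono_measure angleMeasure_le
  have hKΦ : ∀ᵐ z ∂angleMeasure, ‖K z‖ ≤ Φ (z - (x, 0)) := by
    filter_upwards [ae_angleMeasure] with z hθ
    by_cases hz : z.1 ∈ box a b
    · rw [hΦdef, indicator_of_mem (sub_mem_ball_of_mem_box hx hz hθ)]
      exact hKG z hz hθ
    · rw [hsupp z hz, norm_zero]
      exact hΦ0 _
  refine ⟨hΦa.mono' hK hKΦ, ?_⟩
  calc ∫ z, ‖K z‖ ∂angleMeasure ≤ ∫ z, Φ (z - (x, 0)) ∂angleMeasure :=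
        integral_mono_of_nonneg (Eventually.of_forall fun z => norm_nonneg _) hΦa hKΦ
    _ ≤ ∫ z : Plane × ℝ, Φ (z - (x, 0)) :=
        integral_mono_measure angleMeasure_le (Eventually.of_forall fun z => hΦ0 _) hΦx
    _ = ∫ z, Φ z := integral_sub_right_eq_self Φ _
    _ = ∫ z in Metric.ball (0 : Plane × ℝ) (2 * b + 4), G ‖z‖ :=
        integral_indicator Metric.isOpen_ball.measurableSet

lemma integrableOn_norm_rpow (r : ℝ) :
    IntegrableOn (fun z : Plane × ℝ => ‖z‖ ^ (-(5 / 2) : ℝ)) (Metric.ball 0 r) := by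
  rw [integrableOn_fun_norm_addHaar (μ := volume) (f := fun t : ℝ => t ^ (-(5 / 2) : ℝ)),
    finrank_plane_prod]
  have h : IntegrableOn (fun t : ℝ => t ^ (-(1 / 2) : ℝ)) (Ioo 0 r) :=
    (intervalIntegral.intervalIntegrable_rpow' (a := 0) (b := r) (by norm_num)).1.mono_set
      Ioo_subset_Ioc_self
  refine h.congr_fun (fun t ht => ?_) measurableSet_Ioo
  change t ^ (-(1 / 2) : ℝ) = t ^ (3 - 1) * t ^ (-(5 / 2) : ℝ)
  rw [← Real.rpow_natCast, ← Real.rpow_add ht.1]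
  norm_num

/-- The volume of the unit ball of the plane times the line, which carries the maximum of the two
norms. -/
def ballVolume : ℝ := (volume : Measure (Plane × ℝ)).real (Metric.ball 0 1)

lemma integrableOn_one_div_norm_add_cube (hδ : 0 < δ) (r : ℝ) :
    IntegrableOn (fun z : Plane × ℝ => 1 / (‖z‖ + δ) ^ 3) (Metric.ball 0 r) := by
  have hcont : Continuous fun z : Plane × ℝ => 1 / (‖z‖ + δ) ^ 3 :=
    continuous_const.div (by fun_prop) fun z => by positivity
  exact (hcont.continuousOn.integrableOn_compact (isCompact_closedBall 0 r)).mono_set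
    Metric.ball_subset_closedBall

lemma integral_sq_div_add_cube_le (hr : 0 ≤ r) (hδ : 0 < δ) :
    ∫ t in Ioo (0 : ℝ) r, t ^ 2 / (t + δ) ^ 3 ≤ log ((r + δ) / δ) := by
  have hlog : ∫ t in (0 : ℝ)..r, (t + δ)⁻¹ = log ((r + δ) / δ) := by
    rw [intervalIntegral.integral_comp_add_right (fun t => t⁻¹) δ, zero_add,
      integral_inv_of_pos hδ (by positivity)]
  have hinv : ContinuousOn (fun t : ℝ => (t + δ)⁻¹) (Icc 0 r) :=
    ContinuousOn.inv₀ (by fun_prop) fun t ht => (add_pos_of_nonneg_of_pos ht.1 hδ).ne'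
  have hcube : ContinuousOn (fun t : ℝ => t ^ 2 / (t + δ) ^ 3) (Icc 0 r) :=
    ContinuousOn.div (by fun_prop) (by fun_prop) fun t ht =>
      (pow_pos (add_pos_of_nonneg_of_pos ht.1 hδ) 3).ne'
  rw [← hlog, intervalIntegral.integral_of_le hr, integral_Ioc_eq_integral_Ioo]
  refine setIntegral_mono_on (hcube.integrableOn_Icc.mono_set Ioo_subset_Icc_self)
    (hinv.integrableOn_Icc.mono_set Ioo_subset_Icc_self) measurableSet_Ioo fun t ht => ?_
  have ht0 : 0 < t := ht.1
  calc t ^ 2 / (t + δ) ^ 3 ≤ (t + δ) ^ 2 / (t + δ) ^ 3 := by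
        gcongr
        exact le_add_of_nonneg_right hδ.le
    _ = (t + δ)⁻¹ := by field_simp

lemma integral_one_div_norm_add_cube_le (hr : 0 ≤ r) (hδ : 0 < δ) :
    ∫ z in Metric.ball (0 : Plane × ℝ) r, 1 / (‖z‖ + δ) ^ 3 ≤
      3 * ballVolume * log ((r + δ) / δ) := by
  have hball : ∫ z in Metric.ball (0 : Plane × ℝ) r, 1 / (‖z‖ + δ) ^ 3 =
      ∫ z : Plane × ℝ, (Iio r).indicator (fun t : ℝ => 1 / (t + δ) ^ 3) ‖z‖ := by
    rw [← integral_indicator Metric.isOpen_ball.measurableSet]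
    simp [indicator]
  have hpolar : ∫ t in Ioi (0 : ℝ),
      t ^ (3 - 1) • (Iio r).indicator (fun t : ℝ => 1 / (t + δ) ^ 3) t =
      ∫ t in Ioo (0 : ℝ) r, t ^ 2 / (t + δ) ^ 3 := by
    have (t : ℝ) : t ^ (3 - 1) • (Iio r).indicator (fun t : ℝ => 1 / (t + δ) ^ 3) t =
        (Iio r).indicator (fun t : ℝ => t ^ 2 / (t + δ) ^ 3) t := by
      by_cases ht : t < r <;> simp [indicator, ht, div_eq_mul_inv]
    simp_rw [this]
    rw [setIntegral_indicator measurableSet_Iio, Ioi_inter_Iio]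
  rw [hball, integral_fun_norm_addHaar volume ((Iio r).indicator fun t : ℝ => 1 / (t + δ) ^ 3),
    finrank_plane_prod, hpolar, nsmul_eq_mul, smul_eq_mul, ← mul_assoc]
  exact mul_le_mul_of_nonneg_left (integral_sq_div_add_cube_le hr hδ)
    (mul_nonneg (Nat.cast_nonneg 3) measureReal_nonneg)

/-- The integral of the majorant `‖z‖ ^ (-5/2)` over the largest ball that occurs for points of
`box a b`. -/
def powerIntegral (b : ℝ) : ℝ :=
  ∫ z in Metric.ball (0 : Plane × ℝ) (2 * b + 4), ‖z‖ ^ (-(5 / 2) : ℝ)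

lemma powerIntegral_nonneg (b : ℝ) : 0 ≤ powerIntegral b :=
  integral_nonneg fun z => by positivity

lemma integrable_and_integral_abs_le_of_power_bound {K : Plane × ℝ → ℝ} {c : ℝ} (hc : 0 ≤ c)
    (hK : AEStronglyMeasurable K angleMeasure) (hx : x ∈ box a b)
    (hsupp : ∀ z : Plane × ℝ, z.1 ∉ box a b → K z = 0)
    (hKc : ∀ z : Plane × ℝ, z.1 ∈ box a b → z.2 ∈ Ioc 0 π →
      |K z| ≤ c * ‖z - (x, 0)‖ ^ (-(5 / 2) : ℝ)) :
    Integrable K angleMeasure ∧ ∫ z, |K z| ∂angleMeasure ≤ c * powerIntegral b := by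
  rw [powerIntegral, ← integral_const_mul]
  exact integrable_and_integral_norm_le_of_radial_bound (G := fun t => c * t ^ (-(5 / 2) : ℝ))
    (fun t ht => by positivity) ((integrableOn_norm_rpow (2 * b + 4)).const_mul c) hK hx hsupp hKc

end RadialMajorant

section RegularizedVelocity

/-- A measurable vorticity, bounded by `m` and supported in `box a b`. -/
structure IsVorticity (a b m : ℝ) (w : Plane → ℝ) : Prop where
  measurable : Measurable w
  abs_le : ∀ y, |w y| ≤ m
  eq_zero_of_notMem : ∀ y ∉ box a b, w y = 0

/-- The components of the velocity generated by the regularized kernel. -/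
def regVel (i : Fin 2) (δ : ℝ) (w : Plane → ℝ) (x : Plane) : ℝ :=
  1 / (2 * π) * ∫ z, regKernel i δ x z.1 z.2 * w z.1 ∂angleMeasure

/-- The derivative in `x` of the components of the regularized velocity, for `δ ≠ 0`. -/
def regVelDeriv (i : Fin 2) (δ : ℝ) (w : Plane → ℝ) (x : Plane) : Plane →L[ℝ] ℝ :=
  (1 / (2 * π)) • ∫ z, w z.1 • regKernelDeriv i δ x z.1 z.2 ∂angleMeasure

/-- Bound of the components of the velocity on `box a b`. -/
def velBound (a b m : ℝ) : ℝ :=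
  m * (b * (1 + b / a) / lowerConst a ^ 2 * √(2 * b + 4)) * powerIntegral b

/-- Bound of the error of the regularized velocity on `box a b`, up to the factor `√δ`. -/
def regErr (a b m : ℝ) : ℝ :=
  m * (3 * (b * (1 + b / a))) * lowerConst a ^ (-(5 / 2) : ℝ) * powerIntegral b

/-- The factor in front of the logarithm in the Lipschitz constant of the regularized velocity. -/
def regLip (a b m : ℝ) : ℝ :=
  m * ((b + 3 * (b * (1 + b / a) * (1 + b / a))) * (2 / lowerConst a) ^ 3) * (3 * ballVolume)

lemma one_div_two_pi_mul_le {c : ℝ} (hc : 0 ≤ c) : 1 / (2 * π) * c ≤ c := by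
  have hpi := Real.pi_gt_three
  refine mul_le_of_le_one_left hc ?_
  rw [div_le_one (by positivity)]
  linarith

lemma continuous_regDist (δ : ℝ) :
    Continuous fun p : Plane × Plane × ℝ => regDist δ p.1 p.2.1 p.2.2 := by
  have := continuous_coord 1
  unfold regDist bracket
  fun_prop

lemma continuous_kernelNum (i : Fin 2) :
    Continuous fun p : Plane × Plane × ℝ => kernelNum i p.1 p.2.1 p.2.2 := by
  have := continuous_coord 0
  have := continuous_coord 1
  fin_cases i
  · change Continuous fun p : Plane × Plane × ℝ => p.2.1 1 * (p.2.1 1 - p.1 1 * cos p.2.2)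
    fun_prop
  · change Continuous fun p : Plane × Plane × ℝ => p.2.1 1 * (p.1 0 - p.2.1 0) * cos p.2.2
    fun_prop

lemma measurable_regKernel (i : Fin 2) (δ : ℝ) :
    Measurable fun p : Plane × Plane × ℝ => regKernel i δ p.1 p.2.1 p.2.2 :=
  (continuous_kernelNum i).measurable.div ((continuous_regDist δ).measurable.pow_const 3)

lemma stronglyMeasurable_regKernelDeriv (i : Fin 2) (δ : ℝ) (x : Plane) :
    StronglyMeasurable fun z : Plane × ℝ => regKernelDeriv i δ x z.1 z.2 := by
  have := continuous_coord 1
  have hnumDeriv : Continuous fun z : Plane × ℝ => kernelNumDeriv i z.1 z.2 := by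
    fin_cases i
    · change Continuous fun z : Plane × ℝ => (-(z.1 1 * cos z.2)) •
        (EuclideanSpace.proj (1 : Fin 2) : Plane →L[ℝ] ℝ)
      fun_prop
    · change Continuous fun z : Plane × ℝ => (z.1 1 * cos z.2) •
        (EuclideanSpace.proj (0 : Fin 2) : Plane →L[ℝ] ℝ)
      fun_prop
  have hbracketDeriv : Continuous fun z : Plane × ℝ => bracketDeriv x z.1 z.2 := by
    unfold bracketDeriv
    fun_prop
  have hdist := (continuous_regDist δ).measurable.comp (measurable_prodMk_left (x := x))
  have hnum := (continuous_kernelNum i).measurable.comp (measurable_prodMk_left (x := x))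
  exact ((hdist.pow_const 3).inv.stronglyMeasurable.smul hnumDeriv.stronglyMeasurable).sub
    (((hnum.const_mul (3 / 2)).div (hdist.pow_const 5)).stronglyMeasurable.smul
      hbracketDeriv.stronglyMeasurable)

variable {a b m δ : ℝ} {w : Plane → ℝ} {x y : Plane}

lemma regDist_pos (ha : 0 < a) (hδ : 0 < δ) (hx : x ∈ box a b) (hy : y ∈ box a b) (θ : ℝ) :
    0 < regDist δ x y θ :=
  hδ.trans_le (le_regDist (ha.le.trans hx.1.le) (ha.le.trans hy.1.le))

lemma abs_regKernel_zero_le_rpow {z : Plane × ℝ} (ha : 0 < a) (hx : x ∈ box a b)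
    (hz : z.1 ∈ box a b) (hθ : z.2 ∈ Ioc 0 π) (i : Fin 2) :
    |regKernel i 0 x z.1 z.2| ≤ b * (1 + b / a) / lowerConst a ^ 2 * √(2 * b + 4) *
      ‖z - (x, 0)‖ ^ (-(5 / 2) : ℝ) := by
  have hb := pos_of_mem_box hx
  have hc := lowerConst_pos ha
  have hρ : 0 < ‖z - (x, 0)‖ := norm_sub_pos_of_angle_pos hθ.1
  have hlow := lowerConst_mul_norm_le_of_mem_box (δ := 0) ha hx hz hθ
  have hρb := (mem_ball_zero_iff.1 (sub_mem_ball_of_mem_box hx hz hθ)).le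
  set ρ := ‖z - (x, 0)‖
  have hsplit : 1 / ρ ^ 2 = √ρ * ρ ^ (-(5 / 2) : ℝ) := by
    rw [Real.sqrt_eq_rpow, ← Real.rpow_add hρ, ← Real.rpow_natCast, one_div,
      ← Real.rpow_neg hρ.le]
    norm_num
  calc |regKernel i 0 x z.1 z.2| ≤ b * (1 + b / a) / regDist 0 x z.1 z.2 ^ 2 :=
        abs_regKernel_le ha hx hz i
    _ ≤ b * (1 + b / a) / (lowerConst a * ρ) ^ 2 := by gcongr
    _ = b * (1 + b / a) / lowerConst a ^ 2 * (√ρ * ρ ^ (-(5 / 2) : ℝ)) := by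
        rw [← hsplit]
        field_simp
    _ ≤ b * (1 + b / a) / lowerConst a ^ 2 * (√(2 * b + 4) * ρ ^ (-(5 / 2) : ℝ)) := by gcongr
    _ = b * (1 + b / a) / lowerConst a ^ 2 * √(2 * b + 4) * ρ ^ (-(5 / 2) : ℝ) := by ring

lemma abs_regKernel_zero_sub_le_rpow {z : Plane × ℝ} (ha : 0 < a) (hδ : 0 < δ) (hx : x ∈ box a b)
    (hz : z.1 ∈ box a b) (hθ : z.2 ∈ Ioc 0 π) (i : Fin 2) :
    |regKernel i 0 x z.1 z.2 - regKernel i δ x z.1 z.2| ≤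
      3 * (b * (1 + b / a)) * √δ * lowerConst a ^ (-(5 / 2) : ℝ) *
        ‖z - (x, 0)‖ ^ (-(5 / 2) : ℝ) := by
  have hb := pos_of_mem_box hx
  have hc := lowerConst_pos ha
  have hρ : 0 < ‖z - (x, 0)‖ := norm_sub_pos_of_angle_pos hθ.1
  have hlow := lowerConst_mul_norm_le_of_mem_box (δ := 0) ha hx hz hθ
  calc |regKernel i 0 x z.1 z.2 - regKernel i δ x z.1 z.2|
      ≤ 3 * (b * (1 + b / a)) * √δ * regDist 0 x z.1 z.2 ^ (-(5 / 2) : ℝ) :=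
        abs_regKernel_zero_sub_le ha hδ hx hz i ((mul_pos hc hρ).trans_le hlow)
    _ ≤ 3 * (b * (1 + b / a)) * √δ * (lowerConst a * ‖z - (x, 0)‖) ^ (-(5 / 2) : ℝ) := by
        gcongr ?_ * ?_
        exact Real.rpow_le_rpow_of_nonpos (mul_pos hc hρ) hlow (by norm_num)
    _ = 3 * (b * (1 + b / a)) * √δ * lowerConst a ^ (-(5 / 2) : ℝ) *
          ‖z - (x, 0)‖ ^ (-(5 / 2) : ℝ) := by rw [Real.mul_rpow hc.le hρ.le, mul_assoc _ (_ ^ _)]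

lemma norm_regKernelDeriv_le_cube {z : Plane × ℝ} (ha : 0 < a) (hδ : 0 < δ) (hx : x ∈ box a b)
    (hz : z.1 ∈ box a b) (hθ : z.2 ∈ Ioc 0 π) (i : Fin 2) :
    ‖regKernelDeriv i δ x z.1 z.2‖ ≤
      (b + 3 * (b * (1 + b / a) * (1 + b / a))) * (2 / lowerConst a) ^ 3 *
        (1 / (‖z - (x, 0)‖ + δ) ^ 3) := by
  have hb := pos_of_mem_box hx
  have hc := lowerConst_pos ha
  have hlow := lowerConst_mul_norm_le_of_mem_box (δ := δ) ha hx hz hθ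
  have hδ_le : lowerConst a * δ ≤ regDist δ x z.1 z.2 :=
    (mul_le_of_le_one_left hδ.le (min_le_left _ _)).trans
      (le_regDist (ha.le.trans hx.1.le) (ha.le.trans hz.1.le))
  have hsum : lowerConst a / 2 * (‖z - (x, 0)‖ + δ) ≤ regDist δ x z.1 z.2 := by linarith
  calc ‖regKernelDeriv i δ x z.1 z.2‖
      ≤ (b + 3 * (b * (1 + b / a) * (1 + b / a))) / regDist δ x z.1 z.2 ^ 3 :=
        norm_regKernelDeriv_le ha hδ hx hz i
    _ ≤ (b + 3 * (b * (1 + b / a) * (1 + b / a))) /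
          (lowerConst a / 2 * (‖z - (x, 0)‖ + δ)) ^ 3 := by gcongr
    _ = (b + 3 * (b * (1 + b / a) * (1 + b / a))) * (2 / lowerConst a) ^ 3 *
          (1 / (‖z - (x, 0)‖ + δ) ^ 3) := by
        rw [mul_pow, div_pow, div_pow]
        field_simp

namespace IsVorticity

variable (hw : IsVorticity a b m w)
include hw

lemma bound_nonneg : 0 ≤ m := (abs_nonneg _).trans (hw.abs_le 0)

lemma integrable : Integrable w := by
  have hbox : IntegrableOn w (box a b) :=
    Measure.integrableOn_of_bounded (M := m)
      ((measure_mono inter_subset_right).trans_lt measure_ball_lt_top).ne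
      hw.measurable.aestronglyMeasurable (Eventually.of_forall hw.abs_le)
  exact (integrableOn_iff_integrable_of_support_subset fun y hy =>
    not_not.1 fun h => hy (hw.eq_zero_of_notMem y h)).1 hbox

lemma aestronglyMeasurable_regKernel_mul (i : Fin 2) (δ : ℝ) (x : Plane) (μ : Measure (Plane × ℝ)) :
    AEStronglyMeasurable (fun z => regKernel i δ x z.1 z.2 * w z.1) μ :=
  (((measurable_regKernel i δ).comp measurable_prodMk_left).mul
    (hw.measurable.comp measurable_fst)).aestronglyMeasurable

lemma integrable_and_integral_abs_le (ha : 0 < a) (hx : x ∈ box a b) (i : Fin 2) :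
    Integrable (fun z => regKernel i 0 x z.1 z.2 * w z.1) angleMeasure ∧
      ∫ z, |regKernel i 0 x z.1 z.2 * w z.1| ∂angleMeasure ≤ velBound a b m := by
  have := pos_of_mem_box hx
  have := hw.bound_nonneg
  have := lowerConst_pos ha
  refine integrable_and_integral_abs_le_of_power_bound (by positivity)
    (hw.aestronglyMeasurable_regKernel_mul i 0 x _) hx
    (fun z hz => by rw [hw.eq_zero_of_notMem _ hz, mul_zero]) fun z hz hθ => ?_
  rw [abs_mul, mul_comm, mul_assoc]
  exact mul_le_mul (hw.abs_le _) (abs_regKernel_zero_le_rpow ha hx hz hθ i) (abs_nonneg _) ‹_›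

lemma integrable_regKernel_mul (ha : 0 < a) (hδ : 0 < δ) (hx : x ∈ box a b) (i : Fin 2) :
    Integrable (fun z => regKernel i δ x z.1 z.2 * w z.1) angleMeasure := by
  have hb := pos_of_mem_box hx
  refine ((hw.integrable.abs.comp_fst _).const_mul (b * (1 + b / a) / δ ^ 2)).mono'
    (hw.aestronglyMeasurable_regKernel_mul i δ x _) (Eventually.of_forall fun z => ?_)
  by_cases hz : z.1 ∈ box a b
  · rw [norm_mul]
    refine mul_le_mul_of_nonneg_right ((abs_regKernel_le ha hx hz i).trans ?_) (abs_nonneg _)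
    have := le_regDist (δ := δ) (θ := z.2) (ha.le.trans hx.1.le) (ha.le.trans hz.1.le)
    gcongr
  · simp [hw.eq_zero_of_notMem _ hz]

lemma abs_regVel_zero_le (ha : 0 < a) (hx : x ∈ box a b) (i : Fin 2) :
    |regVel i 0 w x| ≤ velBound a b m := by
  rw [regVel, abs_mul, abs_of_pos (by positivity)]
  exact (one_div_two_pi_mul_le (abs_nonneg _)).trans
    (abs_integral_le_integral_abs.trans (hw.integrable_and_integral_abs_le ha hx i).2)

lemma abs_regVel_sub_le (ha : 0 < a) (hδ : 0 < δ) (hx : x ∈ box a b) (i : Fin 2) :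
    |regVel i 0 w x - regVel i δ w x| ≤ regErr a b m * √δ := by
  have := pos_of_mem_box hx
  have := hw.bound_nonneg
  have hc := lowerConst_pos ha
  have hK : AEStronglyMeasurable
      (fun z => regKernel i 0 x z.1 z.2 * w z.1 - regKernel i δ x z.1 z.2 * w z.1) angleMeasure :=
    (hw.aestronglyMeasurable_regKernel_mul i 0 x _).sub
      (hw.aestronglyMeasurable_regKernel_mul i δ x _)
  have h := (integrable_and_integral_abs_le_of_power_bound
    (c := m * (3 * (b * (1 + b / a)) * √δ * lowerConst a ^ (-(5 / 2) : ℝ))) (by positivity) hK hx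
    (fun z hz => by rw [hw.eq_zero_of_notMem _ hz]; ring) fun z hz hθ => by
      rw [← sub_mul, abs_mul, mul_comm, mul_assoc]
      exact mul_le_mul (hw.abs_le _) (abs_regKernel_zero_sub_le_rpow ha hδ hx hz hθ i)
        (abs_nonneg _) ‹_›).2
  rw [regVel, regVel, ← mul_sub, abs_mul, abs_of_pos (by positivity),
    ← integral_sub (hw.integrable_and_integral_abs_le ha hx i).1
      (hw.integrable_regKernel_mul ha hδ hx i)]
  refine (one_div_two_pi_mul_le (abs_nonneg _)).trans
    (abs_integral_le_integral_abs.trans (h.trans_eq ?_))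
  rw [regErr]
  ring

lemma norm_smul_regKernelDeriv_le (ha : 0 < a) (hδ : 0 < δ) (hx : x ∈ box a b) (i : Fin 2)
    (z : Plane × ℝ) : ‖w z.1 • regKernelDeriv i δ x z.1 z.2‖ ≤
      |w z.1| * ((b + 3 * (b * (1 + b / a) * (1 + b / a))) / δ ^ 3) := by
  have hb := pos_of_mem_box hx
  by_cases hz : z.1 ∈ box a b
  · rw [norm_smul, Real.norm_eq_abs]
    refine mul_le_mul_of_nonneg_left ((norm_regKernelDeriv_le ha hδ hx hz i).trans ?_)
      (abs_nonneg _)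
    have := le_regDist (δ := δ) (θ := z.2) (ha.le.trans hx.1.le) (ha.le.trans hz.1.le)
    gcongr
  · simp [hw.eq_zero_of_notMem _ hz]

lemma aestronglyMeasurable_smul_regKernelDeriv (i : Fin 2) (δ : ℝ) (x : Plane)
    (μ : Measure (Plane × ℝ)) :
    AEStronglyMeasurable (fun z => w z.1 • regKernelDeriv i δ x z.1 z.2) μ :=
  ((hw.measurable.comp measurable_fst).stronglyMeasurable.smul
    (stronglyMeasurable_regKernelDeriv i δ x)).aestronglyMeasurable

lemma integrable_smul_regKernelDeriv (ha : 0 < a) (hδ : 0 < δ) (hx : x ∈ box a b) (i : Fin 2) :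
    Integrable (fun z => w z.1 • regKernelDeriv i δ x z.1 z.2) angleMeasure :=
  ((hw.integrable.abs.comp_fst _).mul_const _).mono'
    (hw.aestronglyMeasurable_smul_regKernelDeriv i δ x _)
    (Eventually.of_forall (hw.norm_smul_regKernelDeriv_le ha hδ hx i))

lemma hasFDerivAt_regVel (ha : 0 < a) (hδ : 0 < δ) (hx : x ∈ box a b) (i : Fin 2) :
    HasFDerivAt (regVel i δ w) (regVelDeriv i δ w x) x := by
  have hderiv (z : Plane × ℝ) (x' : Plane) (hx' : x' ∈ box a b) :
      HasFDerivAt (fun x => regKernel i δ x z.1 z.2 * w z.1)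
        (w z.1 • regKernelDeriv i δ x' z.1 z.2) x' := by
    by_cases hz : z.1 ∈ box a b
    · exact (hasFDerivAt_regKernel i (Real.sqrt_pos.1 (regDist_pos ha hδ hx' hz z.2))).mul_const _
    · simpa [hw.eq_zero_of_notMem _ hz] using hasFDerivAt_const (0 : ℝ) x'
  have hint := hasFDerivAt_integral_of_dominated_of_fderiv_le (𝕜 := ℝ) (μ := angleMeasure)
    ((isOpen_box a b).mem_nhds hx)
    (Eventually.of_forall fun x' => hw.aestronglyMeasurable_regKernel_mul i δ x' _)
    (hw.integrable_regKernel_mul ha hδ hx i)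
    (hw.aestronglyMeasurable_smul_regKernelDeriv i δ x _)
    (Eventually.of_forall fun z x' hx' => hw.norm_smul_regKernelDeriv_le ha hδ hx' i z)
    ((hw.integrable.abs.comp_fst _).mul_const _) (Eventually.of_forall hderiv)
  exact hint.const_mul (1 / (2 * π))

lemma norm_regVelDeriv_le (ha : 0 < a) (hδ : 0 < δ) (hx : x ∈ box a b) (i : Fin 2) :
    ‖regVelDeriv i δ w x‖ ≤ regLip a b m * log ((2 * b + 4 + δ) / δ) := by
  have hb := pos_of_mem_box hx
  have hm := hw.bound_nonneg
  have := lowerConst_pos ha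
  set c := (b + 3 * (b * (1 + b / a) * (1 + b / a))) * (2 / lowerConst a) ^ 3 with hcdef
  have : 0 ≤ c := by positivity
  have h := (integrable_and_integral_norm_le_of_radial_bound
    (G := fun t => m * c * (1 / (t + δ) ^ 3)) (fun t ht => by positivity)
    ((integrableOn_one_div_norm_add_cube hδ (2 * b + 4)).const_mul _)
    (hw.aestronglyMeasurable_smul_regKernelDeriv i δ x _) hx
    (fun z hz => by rw [hw.eq_zero_of_notMem _ hz, zero_smul]) fun z hz hθ => by
      rw [norm_smul, Real.norm_eq_abs, mul_assoc]
      exact mul_le_mul (hw.abs_le _) (norm_regKernelDeriv_le_cube ha hδ hx hz hθ i)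
        (norm_nonneg _) hm).2
  rw [integral_const_mul] at h
  rw [regVelDeriv, norm_smul, Real.norm_eq_abs, abs_of_pos (by positivity)]
  calc 1 / (2 * π) * ‖∫ z, w z.1 • regKernelDeriv i δ x z.1 z.2 ∂angleMeasure‖
      ≤ ‖∫ z, w z.1 • regKernelDeriv i δ x z.1 z.2 ∂angleMeasure‖ :=
        one_div_two_pi_mul_le (norm_nonneg _)
    _ ≤ m * c * ∫ z in Metric.ball (0 : Plane × ℝ) (2 * b + 4), 1 / (‖z‖ + δ) ^ 3 :=
        (norm_integral_le_integral_norm _).trans h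
    _ ≤ m * c * (3 * ballVolume * log ((2 * b + 4 + δ) / δ)) := by
        gcongr
        exact integral_one_div_norm_add_cube_le (by positivity) hδ
    _ = regLip a b m * log ((2 * b + 4 + δ) / δ) := by
        rw [regLip, ← hcdef]
        ring

end IsVorticity

lemma regKernelDeriv_zero_unitVec_zero (δ : ℝ) (x y : Plane) (θ : ℝ) :
    regKernelDeriv 0 δ x y θ (unitVec 0) =
      -(3 * kernelNum 0 x y θ * (x 0 - y 0) / regDist δ x y θ ^ 5) := by
  have hnum : kernelNumDeriv 0 y θ (unitVec 0) = 0 := by simp [kernelNumDeriv, unitVec]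
  have hbracket : bracketDeriv x y θ (unitVec 0) = 2 * (x 0 - y 0) := by
    simp [bracketDeriv, unitVec, EuclideanSpace.inner_single_right]
  simp only [regKernelDeriv, sub_apply, smul_apply, smul_eq_mul, hnum, hbracket]
  ring

lemma regKernelDeriv_one_unitVec_one (δ : ℝ) (x y : Plane) (θ : ℝ) :
    regKernelDeriv 1 δ x y θ (unitVec 1) =
      -(3 * kernelNum 1 x y θ * (x 1 - y 1 * cos θ) / regDist δ x y θ ^ 5) := by
  have hnum : kernelNumDeriv 1 y θ (unitVec 1) = 0 := by simp [kernelNumDeriv, unitVec]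
  have hbracket : bracketDeriv x y θ (unitVec 1) =
      2 * (x 1 - y 1) + 2 * y 1 * (1 - cos θ) := by
    simp [bracketDeriv, unitVec, EuclideanSpace.inner_single_right, mul_sub]
  simp only [regKernelDeriv, sub_apply, smul_apply, smul_eq_mul, hnum, hbracket]
  ring

-- The weighted divergence of the kernel is the `θ`-derivative of `y₂ (x₁ - y₁) sin θ / regDist³`.
lemma hasDerivAt_sin_div_regDist (ha : 0 < a) (hδ : 0 < δ) (hx : x ∈ box a b) (hy : y ∈ box a b)
    (θ : ℝ) :
    HasDerivAt (fun θ => y 1 * (x 0 - y 0) * (sin θ / regDist δ x y θ ^ 3))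
      (x 1 * (regKernelDeriv 0 δ x y θ (unitVec 0) + regKernelDeriv 1 δ x y θ (unitVec 1)) +
        regKernel 1 δ x y θ) θ := by
  have hd := regDist_pos ha hδ hx hy θ
  have hbracket : HasDerivAt (fun θ => bracket x y θ + δ ^ 2) (2 * x 1 * y 1 * sin θ) θ := by
    have := ((((Real.hasDerivAt_cos θ).const_sub 1).const_mul (2 * x 1 * y 1)).const_add
      (‖x - y‖ ^ 2)).add_const (δ ^ 2)
    simpa [bracket] using this
  have hdist : HasDerivAt (fun θ => regDist δ x y θ)
      (2 * x 1 * y 1 * sin θ / (2 * regDist δ x y θ)) θ :=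
    hbracket.sqrt (Real.sqrt_pos.1 hd).ne'
  refine (((Real.hasDerivAt_sin θ).div (hdist.pow 3) (pow_pos hd 3).ne').const_mul
    (y 1 * (x 0 - y 0))).congr_deriv ?_
  simp only [regKernelDeriv_zero_unitVec_zero, regKernelDeriv_one_unitVec_one, regKernel, kernelNum,
    Matrix.cons_val_zero, Matrix.cons_val_one, Matrix.cons_val_fin_one, Pi.pow_apply]
  field_simp
  rw [Real.sin_sq]
  ring

lemma integral_div_regKernel (ha : 0 < a) (hδ : 0 < δ) (hx : x ∈ box a b) (hy : y ∈ box a b) :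
    ∫ θ in (0 : ℝ)..π, (x 1 * (regKernelDeriv 0 δ x y θ (unitVec 0) +
      regKernelDeriv 1 δ x y θ (unitVec 1)) + regKernel 1 δ x y θ) = 0 := by
  have hdist : Continuous fun θ => regDist δ x y θ := by
    unfold regDist bracket
    fun_prop
  have hpow (n : ℕ) (θ : ℝ) : regDist δ x y θ ^ n ≠ 0 :=
    (pow_pos (regDist_pos ha hδ hx hy θ) n).ne'
  have hcont : Continuous fun θ => x 1 * (regKernelDeriv 0 δ x y θ (unitVec 0) +
      regKernelDeriv 1 δ x y θ (unitVec 1)) + regKernel 1 δ x y θ := by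
    simp only [regKernelDeriv, regKernel, kernelNumDeriv, kernelNum, bracketDeriv,
      sub_apply, add_apply, smul_apply]
    fun_prop (disch := exact hpow _)
  rw [intervalIntegral.integral_eq_sub_of_hasDerivAt
    (fun θ _ => hasDerivAt_sin_div_regDist ha hδ hx hy θ) (hcont.intervalIntegrable _ _)]
  simp

lemma integrable_div_regKernel_mul (ha : 0 < a) (hδ : 0 < δ) (hw : IsVorticity a b m w)
    (hx : x ∈ box a b) :
    Integrable (fun z => x 1 * ((w z.1 • regKernelDeriv 0 δ x z.1 z.2) (unitVec 0) +
      (w z.1 • regKernelDeriv 1 δ x z.1 z.2) (unitVec 1))) angleMeasure := by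
  have hint (i) := (hw.integrable_smul_regKernelDeriv ha hδ hx i).apply_continuousLinearMap
    (unitVec i)
  exact ((hint 0).add (hint 1)).const_mul _

lemma integral_div_regKernel_mul (ha : 0 < a) (hδ : 0 < δ) (hw : IsVorticity a b m w)
    (hx : x ∈ box a b) :
    ∫ z, (x 1 * ((w z.1 • regKernelDeriv 0 δ x z.1 z.2) (unitVec 0) +
      (w z.1 • regKernelDeriv 1 δ x z.1 z.2) (unitVec 1)) + regKernel 1 δ x z.1 z.2 * w z.1)
      ∂angleMeasure = 0 := by
  have hint := (integrable_div_regKernel_mul ha hδ hw hx).add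
    (hw.integrable_regKernel_mul ha hδ hx 1)
  rw [angleMeasure, integral_prod _ (by exact hint)]
  refine integral_eq_zero_of_ae (Eventually.of_forall fun y => ?_)
  by_cases hy : y ∈ box a b
  · have hfactor (θ : ℝ) : x 1 * ((w y • regKernelDeriv 0 δ x y θ) (unitVec 0) +
        (w y • regKernelDeriv 1 δ x y θ) (unitVec 1)) + regKernel 1 δ x y θ * w y =
        w y * (x 1 * (regKernelDeriv 0 δ x y θ (unitVec 0) +
          regKernelDeriv 1 δ x y θ (unitVec 1)) + regKernel 1 δ x y θ) := by
      simp only [smul_apply, smul_eq_mul]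
      ring
    simp only [hfactor, ← intervalIntegral.integral_of_le Real.pi_pos.le,
      intervalIntegral.integral_const_mul, integral_div_regKernel ha hδ hx hy, mul_zero,
      Pi.zero_apply]
  · simp [hw.eq_zero_of_notMem _ hy]

lemma div_regVel (ha : 0 < a) (hδ : 0 < δ) (hw : IsVorticity a b m w) (hx : x ∈ box a b) :
    x 1 * (regVelDeriv 0 δ w x (unitVec 0) + regVelDeriv 1 δ w x (unitVec 1)) +
      regVel 1 δ w x = 0 := by
  have hint (i) := hw.integrable_smul_regKernelDeriv ha hδ hx i
  have happly (i) := (hint i).apply_continuousLinearMap (unitVec i)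
  rw [regVelDeriv, regVelDeriv, regVel, smul_apply, smul_apply,
    ContinuousLinearMap.integral_apply (hint 0), ContinuousLinearMap.integral_apply (hint 1),
    smul_eq_mul, smul_eq_mul, ← mul_add, mul_left_comm, ← mul_add,
    ← integral_add (happly 0) (happly 1), ← integral_const_mul,
    ← integral_add (integrable_div_regKernel_mul ha hδ hw hx)
      (hw.integrable_regKernel_mul ha hδ hx 1),
    integral_div_regKernel_mul ha hδ hw hx, mul_zero]

lemma kernelNum_div_bracket_rpow (hx : 0 ≤ x 1) (hy : 0 ≤ y 1) (i : Fin 2) (θ : ℝ) :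
    kernelNum i x y θ / bracket x y θ ^ (3 / 2 : ℝ) = regKernel i 0 x y θ := by
  rw [regKernel, regDist, zero_pow two_ne_zero, add_zero, Real.sqrt_eq_rpow,
    ← Real.rpow_mul_natCast (bracket_nonneg hx hy θ)]
  norm_num

lemma velocity_apply (ha : 0 < a) (hw : IsVorticity a b m w) (hx : x ∈ box a b) (i : Fin 2) :
    velocity w x i = regVel i 0 w x := by
  have h : regVel i 0 w x = ∫ y, (1 / (2 * π) * ∫ θ in (0 : ℝ)..π,
      kernelNum i x y θ / bracket x y θ ^ (3 / 2 : ℝ)) * w y := by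
    rw [regVel, angleMeasure, integral_prod _ (hw.integrable_and_integral_abs_le ha hx i).1,
      ← integral_const_mul]
    refine integral_congr_ae (Eventually.of_forall fun y => ?_)
    by_cases hy : y ∈ box a b
    · simp only [kernelNum_div_bracket_rpow (ha.le.trans hx.1.le) (ha.le.trans hy.1.le),
        integral_mul_const, intervalIntegral.integral_of_le Real.pi_pos.le, mul_assoc]
    · simp [hw.eq_zero_of_notMem y hy]
  rw [h]
  fin_cases i <;> rfl

lemma norm_le_abs_add_abs (x : Plane) : ‖x‖ ≤ |x 0| + |x 1| := by
  rw [EuclideanSpace.norm_eq, Fin.sum_univ_two]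
  refine Real.sqrt_le_iff.2 ⟨by positivity, ?_⟩
  simp only [Real.norm_eq_abs]
  nlinarith [abs_nonneg (x 0), abs_nonneg (x 1)]

/-- The velocity generated by the regularized kernel. -/
def regField (δ : ℝ) (w : Plane → ℝ) (x : Plane) : Plane :=
  regVel 0 δ w x • unitVec 0 + regVel 1 δ w x • unitVec 1

lemma regField_apply (δ : ℝ) (w : Plane → ℝ) (x : Plane) (i : Fin 2) :
    regField δ w x i = regVel i δ w x := by
  fin_cases i <;> simp [regField, unitVec]

namespace IsVorticity

variable (hw : IsVorticity a b m w)
include hw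

lemma norm_velocity_sub_regField_le (ha : 0 < a) (hδ : 0 < δ) (hx : x ∈ box a b) :
    ‖velocity w x - regField δ w x‖ ≤ 2 * (regErr a b m * √δ) := by
  have h (i) : |(velocity w x - regField δ w x) i| ≤ regErr a b m * √δ := by
    rw [PiLp.sub_apply, velocity_apply ha hw hx, regField_apply]
    exact hw.abs_regVel_sub_le ha hδ hx i
  linarith [norm_le_abs_add_abs (velocity w x - regField δ w x), h 0, h 1]

lemma norm_velocity_le (ha : 0 < a) (hx : x ∈ box a b) : ‖velocity w x‖ ≤ 2 * velBound a b m := by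
  have h (i) : |velocity w x i| ≤ velBound a b m := by
    rw [velocity_apply ha hw hx]
    exact hw.abs_regVel_zero_le ha hx i
  linarith [norm_le_abs_add_abs (velocity w x), h 0, h 1]

lemma norm_regField_sub_le (ha : 0 < a) (hδ : 0 < δ) (hx : x ∈ box a b) (hy : y ∈ box a b) :
    ‖regField δ w x - regField δ w y‖ ≤
      2 * (regLip a b m * log ((2 * b + 4 + δ) / δ)) * ‖x - y‖ := by
  have h (i) : |(regField δ w x - regField δ w y) i| ≤
      regLip a b m * log ((2 * b + 4 + δ) / δ) * ‖x - y‖ := by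
    rw [PiLp.sub_apply, regField_apply, regField_apply]
    exact (convex_box a b).norm_image_sub_le_of_norm_hasFDerivWithin_le (𝕜 := ℝ)
      (fun z hz => (hw.hasFDerivAt_regVel ha hδ hz i).hasFDerivWithinAt)
      (fun z hz => hw.norm_regVelDeriv_le ha hδ hz i) hy hx
  linarith [norm_le_abs_add_abs (regField δ w x - regField δ w y), h 0, h 1]

lemma hasFDerivAt_regField (ha : 0 < a) (hδ : 0 < δ) (hx : x ∈ box a b) :
    HasFDerivAt (regField δ w) ((regVelDeriv 0 δ w x).smulRight (unitVec 0) +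
      (regVelDeriv 1 δ w x).smulRight (unitVec 1)) x :=
  ((hw.hasFDerivAt_regVel ha hδ hx 0).smul_const (unitVec 0)).add
    ((hw.hasFDerivAt_regVel ha hδ hx 1).smul_const (unitVec 1))

lemma ringDiv_regField (ha : 0 < a) (hδ : 0 < δ) (hx : x ∈ box a b) :
    ringDiv (regField δ w) x = 0 := by
  rw [ringDiv, (hw.hasFDerivAt_regField ha hδ hx).fderiv, trace_eq_entries, regField_apply,
    ← div_regVel ha hδ hw hx]
  simp [unitVec]

end IsVorticity

end RegularizedVelocity

section WeakDivergence

variable {K : ℝ≥0} {G : Plane → Plane} {q : Plane → ℝ}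

lemma eq_sum_unitVec (v : Plane) : v = v 0 • unitVec 0 + v 1 • unitVec 1 := by
  ext i
  fin_cases i <;> simp [unitVec]

lemma lipschitzWith_coord (hG : LipschitzWith K G) (i : Fin 2) :
    LipschitzWith K fun x => G x i :=
  LipschitzWith.of_dist_le_mul fun x y => by
    rw [Real.dist_eq]
    exact (abs_coord_le (G x - G y) i).trans (by rw [← dist_eq_norm]; exact hG.dist_le_mul x y)

lemma measurable_trace_fderiv (G : Plane → Plane) :
    Measurable fun x => LinearMap.trace ℝ Plane (fderiv ℝ G x) := by
  simp only [trace_eq_entries]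
  exact ((continuous_coord 0).measurable.comp (measurable_fderiv_apply_const ℝ G (unitVec 0))).add
    ((continuous_coord 1).measurable.comp (measurable_fderiv_apply_const ℝ G (unitVec 1)))

lemma abs_trace_fderiv_le (hG : LipschitzWith K G) (x : Plane) :
    |LinearMap.trace ℝ Plane (fderiv ℝ G x)| ≤ 2 * K :=
  (abs_trace_le _).trans (by gcongr; exact norm_fderiv_le_of_lipschitz ℝ hG)

lemma integral_fderiv_coord_mul (hG : LipschitzWith K G) (hq : ContDiff ℝ 1 q)
    (hqc : HasCompactSupport q) (i : Fin 2) :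
    ∫ x, fderiv ℝ G x (unitVec i) i * q x = -∫ x, fderiv ℝ q x (unitVec i) * G x i := by
  obtain ⟨D, hD⟩ := hq.lipschitzWith_of_hasCompactSupport hqc one_ne_zero
  have hline : ∀ᵐ x, lineDeriv ℝ (fun x => G x i) x (unitVec i) = fderiv ℝ G x (unitVec i) i := by
    filter_upwards [hG.ae_differentiableAt (μ := volume)] with x hx
    exact ((hasFDerivAt_coord i (G x)).comp x hx.hasFDerivAt).hasLineDerivAt (unitVec i)
      |>.lineDeriv
  calc ∫ x, fderiv ℝ G x (unitVec i) i * q x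
      = ∫ x, lineDeriv ℝ (fun x => G x i) x (unitVec i) * q x :=
        integral_congr_ae (hline.mono fun x hx => by simp only [hx])
    _ = ∫ x, lineDeriv ℝ q x (-unitVec i) * G x i :=
        (lipschitzWith_coord hG i).integral_lineDeriv_mul_eq hD hqc (unitVec i)
    _ = -∫ x, fderiv ℝ q x (unitVec i) * G x i := by
        rw [← integral_neg]
        congr with x
        rw [(hq.differentiable one_ne_zero x).lineDeriv_eq_fderiv, map_neg, neg_mul]

lemma integral_trace_fderiv_mul (hG : LipschitzWith K G) (hq : ContDiff ℝ 1 q)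
    (hqc : HasCompactSupport q) :
    ∫ x, LinearMap.trace ℝ Plane (fderiv ℝ G x) * q x = -∫ x, fderiv ℝ q x (G x) := by
  have hint (i) : Integrable fun x => fderiv ℝ G x (unitVec i) i * q x :=
    (hq.continuous.integrable_of_hasCompactSupport hqc).bdd_mul (c := K)
      ((continuous_coord i).measurable.comp
        (measurable_fderiv_apply_const ℝ G (unitVec i))).aestronglyMeasurable
      (Eventually.of_forall fun x => (abs_entry_le _ i i).trans (norm_fderiv_le_of_lipschitz ℝ hG))
  have hint' (i) : Integrable fun x => fderiv ℝ q x (unitVec i) * G x i :=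
    (((hq.continuous_fderiv one_ne_zero).clm_apply continuous_const).mul
      (lipschitzWith_coord hG i).continuous).integrable_of_hasCompactSupport
      ((hqc.fderiv_apply ℝ (unitVec i)).mul_right)
  have hsplit (x) : fderiv ℝ q x (G x) =
      fderiv ℝ q x (unitVec 0) * G x 0 + fderiv ℝ q x (unitVec 1) * G x 1 := by
    conv_lhs => rw [eq_sum_unitVec (G x), map_add, map_smul, map_smul]
    simp only [smul_eq_mul, mul_comm]
  simp only [hsplit, trace_eq_entries, add_mul]
  rw [integral_add (hint 0) (hint 1), integral_add (hint' 0) (hint' 1),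
    integral_fderiv_coord_mul hG hq hqc, integral_fderiv_coord_mul hG hq hqc, neg_add]

lemma integral_ringDiv_mul (hG : LipschitzWith K G) (hq : ContDiff ℝ 1 q)
    (hqc : HasCompactSupport q) :
    ∫ x, ringDiv G x * q x = -∫ x, x 1 * fderiv ℝ q x (G x) := by
  have hxq : ContDiff ℝ 1 fun x : Plane => x 1 * q x :=
    (EuclideanSpace.proj (𝕜 := ℝ) (1 : Fin 2)).contDiff.mul hq
  have hxqc : HasCompactSupport fun x : Plane => x 1 * q x := hqc.mul_left
  have hfderiv (x v : Plane) :
      fderiv ℝ (fun x : Plane => x 1 * q x) x v = x 1 * fderiv ℝ q x v + v 1 * q x := by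
    rw [((hasFDerivAt_coord 1 x).fun_mul (hq.differentiable one_ne_zero x).hasFDerivAt).fderiv]
    simp [mul_comm]
  have htrace : Integrable fun x => LinearMap.trace ℝ Plane (fderiv ℝ G x) * (x 1 * q x) :=
    (hxq.continuous.integrable_of_hasCompactSupport hxqc).bdd_mul
      (measurable_trace_fderiv G).aestronglyMeasurable
      (Eventually.of_forall fun x => abs_trace_fderiv_le hG x)
  have hcoord : Integrable fun x => G x 1 * q x :=
    ((lipschitzWith_coord hG 1).continuous.mul
      hq.continuous).integrable_of_hasCompactSupport hqc.mul_left
  have hgrad : Integrable fun x => x 1 * fderiv ℝ q x (G x) :=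
    ((continuous_coord 1).mul ((hq.continuous_fderiv one_ne_zero).clm_apply
      hG.continuous)).integrable_of_hasCompactSupport
      (((hqc.fderiv ℝ).mono' fun x hx => subset_tsupport _ fun h => hx (by simp [h])).mul_left)
  calc ∫ x, ringDiv G x * q x
      = ∫ x, (LinearMap.trace ℝ Plane (fderiv ℝ G x) * (x 1 * q x) + G x 1 * q x) := by
        congr with x
        rw [ringDiv]
        ring
    _ = -∫ x, x 1 * fderiv ℝ q x (G x) := by
        rw [integral_add htrace hcoord, integral_trace_fderiv_mul hG hxq hxqc]
        simp only [hfderiv]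
        rw [integral_add hgrad hcoord]
        ring

lemma locallyIntegrable_ringDiv (hG : LipschitzWith K G) : LocallyIntegrable (ringDiv G) := by
  have hbound : Continuous fun x : Plane => |x 1| * (2 * K) + |G x 1| :=
    ((continuous_coord 1).abs.mul continuous_const).add (lipschitzWith_coord hG 1).continuous.abs
  have hmeas : Measurable (ringDiv G) :=
    ((continuous_coord 1).measurable.mul (measurable_trace_fderiv G)).add
      (lipschitzWith_coord hG 1).continuous.measurable
  refine hbound.locallyIntegrable.mono hmeas.aestronglyMeasurable (Eventually.of_forall fun x => ?_)
  rw [Real.norm_eq_abs, Real.norm_of_nonneg (r := |x 1| * (2 * K) + |G x 1|) (by positivity),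
    ringDiv]
  refine (abs_add_le _ _).trans ?_
  rw [abs_mul]
  gcongr
  exact abs_trace_fderiv_le hG x

lemma ae_ringDiv_eq_zero {U : Set Plane} (hU : IsOpen U) (hG : LipschitzWith K G)
    (hweak : ∀ f : Plane → ℝ, ContDiff ℝ ((⊤ : ℕ∞) : WithTop ℕ∞) f → HasCompactSupport f →
      tsupport f ⊆ U → ∫ x, x 1 * fderiv ℝ f x (G x) = 0) :
    ∀ᵐ x, x ∈ U → ringDiv G x = 0 := by
  refine hU.ae_eq_zero_of_integral_contDiff_smul_eq_zero
    ((locallyIntegrable_ringDiv hG).locallyIntegrableOn U) fun f hf hfc hfU => ?_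
  simp only [smul_eq_mul, mul_comm (f _)]
  rw [integral_ringDiv_mul hG (hf.of_le (by exact_mod_cast le_top)) hfc, hweak f hf hfc hfU,
    neg_zero]

lemma isOpen_halfPlane : IsOpen halfPlane := isOpen_lt continuous_const (continuous_coord 1)

variable {ε C_F L t : ℝ} {F : ℝ → Plane → Plane}

lemma IsExternalField.lipschitzWith (hF : IsExternalField ε C_F L F) (ht : 0 ≤ t) :
    LipschitzWith (L / |log ε|).toNNReal (F t) :=
  LipschitzWith.of_dist_le_mul fun x y => by
    rw [dist_eq_norm, dist_eq_norm]
    exact (hF.lipschitz t ht x y).trans (by gcongr; exact Real.le_coe_toNNReal _)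

lemma IsVorticity.isSolenoidalField_regField_add {a b m δ : ℝ} {w : Plane → ℝ}
    (hw : IsVorticity a b m w) (ha : 0 < a) (hδ : 0 < δ) (hF : IsExternalField ε C_F L F)
    (ht : 0 ≤ t) :
    IsSolenoidalField (box a b)
      (2 * (regLip a b m * log ((2 * b + 4 + δ) / δ)) + L / |log ε|).toNNReal
      (2 * velBound a b m + 2 * (regErr a b m * √δ) + C_F / |log ε|)
      (fun x => regField δ w x + F t x) where
  lipschitzOnWith := LipschitzOnWith.of_dist_le_mul fun x hx y hy => by
    rw [dist_eq_norm, dist_eq_norm, add_sub_add_comm]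
    calc ‖regField δ w x - regField δ w y + (F t x - F t y)‖
        ≤ (2 * (regLip a b m * log ((2 * b + 4 + δ) / δ)) + L / |log ε|) * ‖x - y‖ := by
          rw [add_mul]
          exact (norm_add_le _ _).trans
            (add_le_add (hw.norm_regField_sub_le ha hδ hx hy) (hF.lipschitz t ht x y))
      _ ≤ _ := by gcongr; exact Real.le_coe_toNNReal _
  norm_le x hx := by
    have hreg : ‖regField δ w x‖ ≤ ‖velocity w x‖ + ‖velocity w x - regField δ w x‖ := by
      simpa only [sub_sub_cancel] using norm_sub_le (velocity w x) (velocity w x - regField δ w x)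
    linarith [norm_add_le (regField δ w x) (F t x), hF.bound t ht x, hw.norm_velocity_le ha hx,
      hw.norm_velocity_sub_regField_le ha hδ hx]
  ringDiv_eq_zero := by
    have hFt := hF.lipschitzWith ht
    filter_upwards [hFt.ae_differentiableAt (μ := volume),
      ae_ringDiv_eq_zero isOpen_halfPlane hFt (hF.divergence_free t ht)] with x hdiff hzero hx
    have hreg := hw.ringDiv_regField ha hδ hx
    have hext := hzero (ha.trans hx.1)
    rw [ringDiv] at hreg hext ⊢
    rw [fderiv_fun_add (hw.hasFDerivAt_regField ha hδ hx).differentiableAt hdiff,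
      ContinuousLinearMap.toLinearMap_add, map_add, PiLp.add_apply]
    linear_combination hreg + hext

end WeakDivergence

section TimeAverage

/-- The average of `W` over the times between `s` and `s'`. -/
def timeAvg (W : ℝ → Plane → ℝ) (s s' : ℝ) (y : Plane) : ℝ := (s' - s)⁻¹ * ∫ τ in s..s', W τ y

lemma timeAvg_eq_setIntegral (W : ℝ → Plane → ℝ) (s s' : ℝ) (y : Plane) :
    timeAvg W s s' y = (s' - s)⁻¹ * (if s ≤ s' then 1 else -1) * ∫ τ in uIoc s s', W τ y := by
  rw [timeAvg, intervalIntegral.intervalIntegral_eq_integral_uIoc, smul_eq_mul, mul_assoc]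

variable {a b m δ s s' : ℝ} {W : ℝ → Plane → ℝ} {x : Plane}

lemma isVorticity_timeAvg (hW : Measurable (Function.uncurry W))
    (hv : ∀ τ ∈ uIoc s s', IsVorticity a b m (W τ)) (hs : s ≠ s') :
    IsVorticity a b m (timeAvg W s s') where
  measurable := by
    have h : StronglyMeasurable fun y => ∫ τ in uIoc s s', W τ y :=
      hW.stronglyMeasurable.integral_prod_left
    simpa only [funext (timeAvg_eq_setIntegral W s s')] using h.measurable.const_mul _
  abs_le y := by
    rw [timeAvg, abs_mul, abs_inv, inv_mul_le_iff₀ (abs_pos.2 (sub_ne_zero.2 hs.symm)), mul_comm]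
    exact intervalIntegral.norm_integral_le_of_norm_le_const (f := fun τ => W τ y)
      fun τ hτ => (hv τ hτ).abs_le y
  eq_zero_of_notMem y hy := by
    rw [timeAvg_eq_setIntegral, setIntegral_eq_zero_of_forall_eq_zero
      fun τ hτ => (hv τ hτ).eq_zero_of_notMem y hy, mul_zero]

lemma integrable_regKernel_mul_prod (ha : 0 < a) (hδ : 0 < δ) (hW : Measurable (Function.uncurry W))
    (hv : ∀ τ ∈ uIoc s s', IsVorticity a b m (W τ)) (hx : x ∈ box a b) (i : Fin 2) :
    Integrable (fun p : ℝ × (Plane × ℝ) => regKernel i δ x p.2.1 p.2.2 * W p.1 p.2.1)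
      ((volume.restrict (uIoc s s')).prod angleMeasure) := by
  have : IsFiniteMeasure (volume.restrict (uIoc s s')) := ⟨by simp [uIoc]⟩
  have hone : IsVorticity a b 1 ((box a b).indicator fun _ => 1) :=
    ⟨measurable_const.indicator (isOpen_box a b).measurableSet,
      fun y => by by_cases h : y ∈ box a b <;> simp [h], fun y hy => indicator_of_notMem hy _⟩
  refine (((hone.integrable_regKernel_mul ha hδ hx i).norm.const_mul m).comp_snd _).mono'
    (((measurable_regKernel i δ).comp (measurable_const.prodMk measurable_snd)).mul
      (hW.comp (measurable_fst.prodMk (measurable_fst.comp measurable_snd)))).aestronglyMeasurable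
      ?_
  filter_upwards [Measure.quasiMeasurePreserving_fst.ae (ae_restrict_mem measurableSet_uIoc)]
    with p hp
  by_cases hy : p.2.1 ∈ box a b
  · rw [norm_mul, norm_mul, indicator_of_mem hy, norm_one, mul_one, mul_comm]
    gcongr
    exact (hv p.1 hp).abs_le p.2.1
  · simp [(hv p.1 hp).eq_zero_of_notMem _ hy, indicator_of_notMem hy]

lemma intervalIntegrable_regVel (ha : 0 < a) (hδ : 0 < δ) (hW : Measurable (Function.uncurry W))
    (hv : ∀ τ ∈ uIoc s s', IsVorticity a b m (W τ)) (hx : x ∈ box a b) (i : Fin 2) :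
    IntervalIntegrable (fun τ => regVel i δ (W τ) x) volume s s' :=
  intervalIntegrable_iff.2
    ((integrable_regKernel_mul_prod ha hδ hW hv hx i).integral_prod_left.const_mul _)

lemma regVel_timeAvg (ha : 0 < a) (hδ : 0 < δ) (hW : Measurable (Function.uncurry W))
    (hv : ∀ τ ∈ uIoc s s', IsVorticity a b m (W τ)) (hx : x ∈ box a b) (i : Fin 2) :
    regVel i δ (timeAvg W s s') x = (s' - s)⁻¹ * ∫ τ in s..s', regVel i δ (W τ) x := by
  have hpull (z : Plane × ℝ) : regKernel i δ x z.1 z.2 * timeAvg W s s' z.1 =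
      (s' - s)⁻¹ * (if s ≤ s' then 1 else -1) *
        ∫ τ in uIoc s s', regKernel i δ x z.1 z.2 * W τ z.1 := by
    rw [timeAvg_eq_setIntegral, integral_const_mul]
    ring
  have hswap : ∫ z, (∫ τ in uIoc s s', regKernel i δ x z.1 z.2 * W τ z.1) ∂angleMeasure =
      ∫ τ in uIoc s s', (∫ z, regKernel i δ x z.1 z.2 * W τ z.1 ∂angleMeasure) :=
    (integral_integral_swap (integrable_regKernel_mul_prod ha hδ hW hv hx i)).symm
  simp only [regVel, hpull, intervalIntegral.intervalIntegral_eq_integral_uIoc, smul_eq_mul]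
  rw [integral_const_mul, integral_const_mul,
    hswap]
  ring

lemma intervalIntegrable_regVel_smul (ha : 0 < a) (hδ : 0 < δ)
    (hW : Measurable (Function.uncurry W)) (hv : ∀ τ ∈ uIoc s s', IsVorticity a b m (W τ))
    (hx : x ∈ box a b) (i : Fin 2) (v : Plane) :
    IntervalIntegrable (fun τ => regVel i δ (W τ) x • v) volume s s' :=
  have h := intervalIntegrable_regVel ha hδ hW hv hx i
  ⟨h.1.smul_const v, h.2.smul_const v⟩

lemma intervalIntegrable_regField (ha : 0 < a) (hδ : 0 < δ) (hW : Measurable (Function.uncurry W))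
    (hv : ∀ τ ∈ uIoc s s', IsVorticity a b m (W τ)) (hx : x ∈ box a b) :
    IntervalIntegrable (fun τ => regField δ (W τ) x) volume s s' :=
  (intervalIntegrable_regVel_smul ha hδ hW hv hx 0 _).add
    (intervalIntegrable_regVel_smul ha hδ hW hv hx 1 _)

lemma regField_timeAvg (ha : 0 < a) (hδ : 0 < δ) (hW : Measurable (Function.uncurry W))
    (hv : ∀ τ ∈ uIoc s s', IsVorticity a b m (W τ)) (hx : x ∈ box a b) :
    regField δ (timeAvg W s s') x = (s' - s)⁻¹ • ∫ τ in s..s', regField δ (W τ) x := by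
  simp only [regField, regVel_timeAvg ha hδ hW hv hx]
  rw [intervalIntegral.integral_add (intervalIntegrable_regVel_smul ha hδ hW hv hx 0 _)
      (intervalIntegrable_regVel_smul ha hδ hW hv hx 1 _),
    intervalIntegral.integral_smul_const, intervalIntegral.integral_smul_const, smul_add,
    smul_smul, smul_smul]

end TimeAverage

section ConfinedFlow

lemma exists_subset_box {C : Set Plane} (hC : IsCompact C) (hCh : C ⊆ halfPlane) :
    ∃ a > 0, ∃ b > 0, C ⊆ box a b := by
  obtain ⟨a, ha, hCa⟩ := hC.exists_forall_le' (continuous_coord 1).continuousOn hCh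
  obtain ⟨b, hb, hCb⟩ := hC.isBounded.subset_ball_lt 0 0
  exact ⟨a / 2, half_pos ha, b, hb, fun x hx => ⟨(half_lt_self ha).trans_le (hCa x hx), hCb hx⟩⟩

lemma exists_closedBall_subset_box {C : Set Plane} (hC : IsCompact C) (hCh : C ⊆ halfPlane) :
    ∃ a > 0, ∃ b > 0, ∃ ρ > 0, ∀ x ∈ C, Metric.closedBall x ρ ⊆ box a b := by
  obtain ⟨ρ, hρ, hCρ⟩ := hC.exists_cthickening_subset_open isOpen_halfPlane hCh
  obtain ⟨a, ha, b, hb, hbox⟩ := exists_subset_box hC.cthickening hCρ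
  exact ⟨a, ha, b, hb, ρ, hρ,
    fun x hx => (Metric.closedBall_subset_cthickening hx ρ).trans hbox⟩

section ReducedFlow

variable {F : ℝ → Plane → Plane} {ω : ℝ → Plane → ℝ} {φ : ℝ → Plane → Plane} {K : Set Plane}
  {s : ℝ}

lemma IsReducedFlow.injOn_spaceTime (h : IsReducedFlow F ω φ) :
    InjOn (fun p : ℝ × Plane => (p.1, φ p.1 p.2)) (Ici 0 ×ˢ halfPlane) := by
  rintro ⟨t, x⟩ ⟨ht, hx⟩ ⟨t', x'⟩ ⟨-, hx'⟩ he
  obtain ⟨rfl, hφ⟩ := Prod.mk.inj he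
  exact Prod.ext rfl ((h.bijOn t ht).injOn hx hx' hφ)

/- The vorticity at negative times is arbitrary, so joint measurability can hold only after a
modification there. -/
lemma IsReducedFlow.exists_measurable (h : IsReducedFlow F ω φ) (h0 : Measurable (ω 0)) :
    ∃ W : ℝ → Plane → ℝ, Measurable (Function.uncurry W) ∧ ∀ s, 0 ≤ s → W s = ω s := by
  set D : Set (ℝ × Plane) := Ici 0 ×ˢ halfPlane
  let Θ : ℝ × Plane → ℝ × Plane := fun p => (p.1, φ p.1 p.2)
  have hΘ : MeasurableEmbedding (D.domRestrict Θ) :=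
    (continuousOn_fst.prodMk h.continuousOn).measurableEmbedding
      (measurableSet_Ici.prod isOpen_halfPlane.measurableSet) h.injOn_spaceTime
  let g : D → ℝ := fun p => φ p.1.1 p.1.2 1 / p.1.2 1 * ω 0 p.1.2
  have hg : Measurable g := by
    have hφ : Measurable fun p : D => φ p.1.1 p.1.2 :=
      (continuousOn_iff_continuous_domRestrict.1 h.continuousOn).measurable
    have hx : Measurable fun p : D => p.1.2 := measurable_snd.comp measurable_subtype_coe
    exact (((continuous_coord 1).measurable.comp hφ).div
      ((continuous_coord 1).measurable.comp hx)).mul (h0.comp hx)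
  refine ⟨fun s y => Function.extend (D.domRestrict Θ) g 0 (s, y),
    hΘ.measurable_extend hg measurable_const, fun s hs => ?_⟩
  ext y
  by_cases hy : y ∈ halfPlane
  · obtain ⟨x, hx, rfl⟩ := (h.bijOn s hs).surjOn hy
    exact (hΘ.injective.extend_apply g 0 ⟨(s, x), hs, hx⟩).trans (h.transport x hx s hs).symm
  · rw [h.extension s hs y hy]
    refine (Function.extend_apply' _ _ _ ?_).trans rfl
    rintro ⟨⟨⟨t, x⟩, ht, hx⟩, he⟩
    obtain ⟨rfl, rfl⟩ := Prod.mk.inj he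
    exact hy ((h.bijOn t ht).mapsTo hx)

lemma IsReducedFlow.eq_zero_of_notMem_image (h : IsReducedFlow F ω φ)
    (hoff : ∀ x ∉ K, ω 0 x = 0) (hs : 0 ≤ s) {y : Plane} (hy : y ∉ φ s '' K) : ω s y = 0 := by
  by_cases hyh : y ∈ halfPlane
  · obtain ⟨x, hx, rfl⟩ := (h.bijOn s hs).surjOn hyh
    rw [h.transport x hx s hs, hoff x fun hxK => hy ⟨x, hxK, rfl⟩, mul_zero]
  · exact h.extension s hs y hyh

lemma IsReducedFlow.isVorticity (h : IsReducedFlow F ω φ) {a b a₀ b₀ m₀ : ℝ}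
    (h0 : IsVorticity a₀ b₀ m₀ (ω 0)) (ha₀ : 0 < a₀) (hb : 0 ≤ b) (hK : K ⊆ box a₀ b₀)
    (hoff : ∀ x ∉ K, ω 0 x = 0) (hs : 0 ≤ s) (hsK : MapsTo (φ s) K (box a b)) :
    IsVorticity a b (b / a₀ * m₀) (ω s) where
  measurable := by
    obtain ⟨W, hW, hWω⟩ := h.exists_measurable h0.measurable
    rw [← hWω s hs]
    exact hW.comp measurable_prodMk_left
  abs_le y := by
    have hm₀ := h0.bound_nonneg
    by_cases hy : y ∈ φ s '' K
    · obtain ⟨x, hx, rfl⟩ := hy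
      have hx₀ : 0 < x 1 := ha₀.trans (hK hx).1
      rw [h.transport x hx₀ s hs, abs_mul, abs_div, abs_of_pos hx₀]
      gcongr
      · exact (abs_coord_le _ 1).trans (norm_lt_of_mem_box (hsK hx)).le
      · exact (hK hx).1.le
      · exact h0.abs_le x
    · rw [h.eq_zero_of_notMem_image hoff hs hy, abs_zero]
      positivity
  eq_zero_of_notMem y hy :=
    h.eq_zero_of_notMem_image hoff hs fun hyK => hy (hsK.image_subset hyK)

end ReducedFlow

/-- A reduced flow in an external field which, up to the time `S`, keeps the compact set `K` of
particles at a positive distance from the boundary of `box a b`, and whose vorticity is carried by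
`K` and bounded by `m`. -/
structure IsConfinedFlow (ε C_F L S a b m : ℝ) (K : Set Plane) (F : ℝ → Plane → Plane)
    (ω : ℝ → Plane → ℝ) (φ : ℝ → Plane → Plane) : Prop where
  field : IsExternalField ε C_F L F
  flow : IsReducedFlow F ω φ
  lower_pos : 0 < a
  upper_pos : 0 < b
  compact : IsCompact K
  subset : K ⊆ halfPlane
  tube : ∃ ρ > 0, ∀ s ∈ Icc 0 S, ∀ x ∈ K, Metric.closedBall (φ s x) ρ ⊆ box a b
  vorticity : ∀ s ∈ Icc 0 S, IsVorticity a b m (ω s)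
  eq_zero_of_notMem : ∀ x ∉ K, ω 0 x = 0

lemma IsReducedFlow.exists_isConfinedFlow {ε C_F L m₀ : ℝ} {K : Set Plane}
    {F : ℝ → Plane → Plane} {ω : ℝ → Plane → ℝ} {φ : ℝ → Plane → Plane}
    (h : IsReducedFlow F ω φ) (hF : IsExternalField ε C_F L F) (hK : IsCompact K)
    (hKh : K ⊆ halfPlane) (h0 : Measurable (ω 0)) (hbd : ∀ x, |ω 0 x| ≤ m₀)
    (hoff : ∀ x ∉ K, ω 0 x = 0) (S : ℝ) :
    ∃ a b m, IsConfinedFlow ε C_F L S a b m K F ω φ := by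
  have hsub : Icc 0 S ×ˢ K ⊆ Ici 0 ×ˢ halfPlane := prod_mono Icc_subset_Ici_self hKh
  obtain ⟨a₀, ha₀, b₀, -, hK₀⟩ := exists_subset_box hK hKh
  obtain ⟨a, ha, b, hb, ρ, hρ, htube⟩ := exists_closedBall_subset_box
    ((isCompact_Icc.prod hK).image_of_continuousOn (h.continuousOn.mono hsub))
    (image_subset_iff.2 fun p hp => (h.bijOn p.1 (hsub hp).1).mapsTo (hsub hp).2)
  have htube' : ∀ s ∈ Icc 0 S, ∀ x ∈ K, Metric.closedBall (φ s x) ρ ⊆ box a b :=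
    fun s hs x hx => htube _ (mem_image_of_mem _ (mk_mem_prod hs hx))
  have h0K : IsVorticity a₀ b₀ m₀ (ω 0) := ⟨h0, hbd, fun y hy => hoff y fun hyK => hy (hK₀ hyK)⟩
  exact ⟨a, b, b / a₀ * m₀, hF, h, ha, hb, hK, hKh, ⟨ρ, hρ, htube'⟩, fun s hs =>
    h.isVorticity h0K ha₀ hb.le hK₀ hoff hs.1
      fun x hx => htube' s hs x hx (Metric.mem_closedBall_self hρ.le), hoff⟩

lemma exists_forall_norm_sub_le {E α : Type*} [NormedAddCommGroup E] [PseudoMetricSpace α]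
    {I : Set ℝ} {K : Set α} {f : ℝ → α → E} {η : ℝ} (hI : IsCompact I) (hK : IsCompact K)
    (hf : ContinuousOn (fun p : ℝ × α => f p.1 p.2) (I ×ˢ K)) (hη : 0 < η) :
    ∃ h₀ > 0, ∀ s ∈ I, ∀ s' ∈ I, |s' - s| < h₀ → ∀ x ∈ K, ‖f s' x - f s x‖ ≤ η := by
  obtain ⟨h₀, hh₀, hunif⟩ := Metric.uniformContinuousOn_iff.1
    ((hI.prod hK).uniformContinuousOn_of_continuous hf) η hη
  refine ⟨h₀, hh₀, fun s hs s' hs' hss x hx => ?_⟩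
  rw [← dist_eq_norm]
  refine (hunif (s', x) ⟨hs', hx⟩ (s, x) ⟨hs, hx⟩ ?_).le
  rwa [Prod.dist_eq, dist_self, Real.dist_eq, max_eq_left (abs_nonneg _)]

lemma regErr_nonneg {a b m : ℝ} (ha : 0 < a) (hb : 0 < b) (hm : 0 ≤ m) : 0 ≤ regErr a b m := by
  have := powerIntegral_nonneg b
  have := lowerConst_pos ha
  unfold regErr
  positivity

lemma regLip_nonneg {a b m : ℝ} (ha : 0 < a) (hb : 0 < b) (hm : 0 ≤ m) : 0 ≤ regLip a b m := by
  have := lowerConst_pos ha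
  have : 0 ≤ ballVolume := measureReal_nonneg
  unfold regLip
  positivity

namespace IsConfinedFlow

variable {ε C_F L S a b m δ s s' : ℝ} {K : Set Plane} {F : ℝ → Plane → Plane}
  {ω : ℝ → Plane → ℝ} {φ : ℝ → Plane → Plane} {x : Plane}
  (h : IsConfinedFlow ε C_F L S a b m K F ω φ)
include h

lemma mem_box (hs : s ∈ Icc 0 S) (hx : x ∈ K) : φ s x ∈ box a b := by
  obtain ⟨ρ, hρ, htube⟩ := h.tube
  exact htube s hs x hx (Metric.mem_closedBall_self hρ.le)

lemma continuousOn_flow : ContinuousOn (fun p : ℝ × Plane => φ p.1 p.2) (Icc 0 S ×ˢ K) :=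
  h.flow.continuousOn.mono (prod_mono Icc_subset_Ici_self h.subset)

lemma continuousOn_time (hs : s ∈ Icc 0 S) : ContinuousOn (φ s) K :=
  h.continuousOn_flow.comp (continuousOn_const.prodMk continuousOn_id) fun _ hx => ⟨hs, hx⟩

lemma continuousOn_field : ContinuousOn (fun p : ℝ × Plane => F p.1 (φ p.1 p.2)) (Icc 0 S ×ˢ K) :=
  h.field.continuousOn.comp (continuousOn_fst.prodMk h.continuousOn_flow)
    fun _ hp => ⟨hp.1.1, mem_univ _⟩

lemma norm_velocity_add_le (hs : s ∈ Icc 0 S) (hx : x ∈ K) :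
    ‖velocity (ω s) (φ s x) + F s (φ s x)‖ ≤ 2 * velBound a b m + C_F / |log ε| :=
  (norm_add_le _ _).trans (add_le_add
    ((h.vorticity s hs).norm_velocity_le h.lower_pos (h.mem_box hs hx)) (h.field.bound s hs.1 _))

lemma hasDerivAt_flow (hs : 0 < s) (hx : x ∈ K) :
    HasDerivAt (fun t => φ t x) (velocity (ω s) (φ s x) + F s (φ s x)) s :=
  (h.flow.ode x (h.subset hx) s hs.le).hasDerivAt (Ici_mem_nhds hs)

lemma intervalIntegrable_velocity_add (hs : s ∈ Icc 0 S) (hs' : s' ∈ Icc 0 S) (hx : x ∈ K) :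
    IntervalIntegrable (fun τ => velocity (ω τ) (φ τ x) + F τ (φ τ x)) volume s s' := by
  have hderiv : ∀ τ ∈ Ioo (min s s') (max s s'),
      deriv (fun t => φ t x) τ = velocity (ω τ) (φ τ x) + F τ (φ τ x) := fun τ hτ =>
    (h.hasDerivAt_flow ((le_min hs.1 hs'.1).trans_lt hτ.1) hx).deriv
  rw [intervalIntegrable_iff, uIoc, integrableOn_Ioc_iff_integrableOn_Ioo]
  refine IntegrableOn.congr_fun (Measure.integrableOn_of_bounded
    (M := 2 * velBound a b m + C_F / |log ε|) measure_Ioo_lt_top.ne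
    (measurable_deriv _).aestronglyMeasurable ?_) hderiv measurableSet_Ioo
  filter_upwards [ae_restrict_mem measurableSet_Ioo] with τ hτ
  rw [hderiv τ hτ]
  exact h.norm_velocity_add_le (uIcc_subset_Icc hs hs' (Ioo_subset_Icc_self hτ)) hx

lemma integral_velocity_add (hs : s ∈ Icc 0 S) (hs' : s' ∈ Icc 0 S) (hx : x ∈ K) :
    ∫ τ in s..s', (velocity (ω τ) (φ τ x) + F τ (φ τ x)) = φ s' x - φ s x :=
  intervalIntegral.integral_eq_sub_of_hasDeriv_right
    (fun τ hτ => (h.flow.ode x (h.subset hx) τ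
      (uIcc_subset_Icc hs hs' hτ).1).continuousWithinAt.mono
        ((uIcc_subset_Icc hs hs').trans Icc_subset_Ici_self))
    (fun _ hτ => (h.hasDerivAt_flow ((le_min hs.1 hs'.1).trans_lt hτ.1) hx).hasDerivWithinAt)
    (h.intervalIntegrable_velocity_add hs hs' hx)

lemma exists_isVorticity_regField_eq_average (hs : s ∈ Icc 0 S) (hs' : s' ∈ Icc 0 S)
    (hss : s ≠ s') (hδ : 0 < δ) :
    ∃ w, IsVorticity a b m w ∧ ∀ x ∈ box a b,
      IntervalIntegrable (fun τ => regField δ (ω τ) x) volume s s' ∧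
      (s' - s) • regField δ w x = ∫ τ in s..s', regField δ (ω τ) x := by
  have hsub : uIcc s s' ⊆ Icc 0 S := uIcc_subset_Icc hs hs'
  have h0 : (0 : ℝ) ∈ Icc 0 S := left_mem_Icc.2 (hs.1.trans hs.2)
  obtain ⟨W, hW, hWω⟩ := h.flow.exists_measurable (h.vorticity 0 h0).measurable
  have hv : ∀ τ ∈ uIoc s s', IsVorticity a b m (W τ) := fun τ hτ => by
    have hτS := hsub (uIoc_subset_uIcc hτ)
    rw [hWω τ hτS.1]
    exact h.vorticity τ hτS
  refine ⟨timeAvg W s s', isVorticity_timeAvg hW hv hss, fun x hx => ⟨?_, ?_⟩⟩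
  · refine (intervalIntegrable_regField h.lower_pos hδ hW hv hx).congr fun τ hτ => ?_
    simp only [hWω τ (hsub (uIoc_subset_uIcc hτ)).1]
  · rw [regField_timeAvg h.lower_pos hδ hW hv hx, smul_inv_smul₀ (sub_ne_zero.2 hss.symm)]
    exact intervalIntegral.integral_congr fun τ hτ => by simp only [hWω τ (hsub hτ).1]

lemma norm_velocity_add_sub_regField_add_le (hδ : 0 < δ) (hs : s ∈ Icc 0 S) (hs' : s' ∈ Icc 0 S)
    (hx : x ∈ K) :
    ‖velocity (ω s') (φ s' x) + F s' (φ s' x) - (regField δ (ω s') (φ s x) + F s (φ s x))‖ ≤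
      2 * (regErr a b m * √δ) +
        2 * (regLip a b m * log ((2 * b + 4 + δ) / δ)) * ‖φ s' x - φ s x‖ +
        ‖F s' (φ s' x) - F s (φ s x)‖ := by
  have hw := h.vorticity s' hs'
  calc ‖velocity (ω s') (φ s' x) + F s' (φ s' x) - (regField δ (ω s') (φ s x) + F s (φ s x))‖
      = ‖(velocity (ω s') (φ s' x) - regField δ (ω s') (φ s' x)) +
          (regField δ (ω s') (φ s' x) - regField δ (ω s') (φ s x)) +
          (F s' (φ s' x) - F s (φ s x))‖ := by
        congr 1
        abel
    _ ≤ _ := norm_add₃_le.trans (by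
        gcongr
        · exact hw.norm_velocity_sub_regField_le h.lower_pos hδ (h.mem_box hs' hx)
        · exact hw.norm_regField_sub_le h.lower_pos hδ (h.mem_box hs' hx) (h.mem_box hs hx))

lemma exists_isVorticity_norm_flow_sub_le {e : ℝ} (hδ : 0 < δ) (hs : s ∈ Icc 0 S)
    (hs' : s' ∈ Icc 0 S) (hss : s ≠ s')
    (he : ∀ τ ∈ uIoc s s', ∀ x ∈ K, ‖velocity (ω τ) (φ τ x) + F τ (φ τ x) -
      (regField δ (ω τ) (φ s x) + F s (φ s x))‖ ≤ e) :
    ∃ w, IsVorticity a b m w ∧ ∀ x ∈ K,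
      ‖φ s' x - φ s x - (s' - s) • (regField δ w (φ s x) + F s (φ s x))‖ ≤ |s' - s| * e := by
  obtain ⟨w, hw, havg⟩ := h.exists_isVorticity_regField_eq_average hs hs' hss hδ
  refine ⟨w, hw, fun x hx => ?_⟩
  obtain ⟨hint, hwx⟩ := havg _ (h.mem_box hs hx)
  have hconst : IntervalIntegrable (fun _ : ℝ => F s (φ s x)) volume s s' :=
    intervalIntegrable_const
  rw [← h.integral_velocity_add hs hs' hx, smul_add, hwx, ← intervalIntegral.integral_const,
    ← intervalIntegral.integral_add hint hconst,
    ← intervalIntegral.integral_sub (h.intervalIntegrable_velocity_add hs hs' hx)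
      (hint.add hconst), mul_comm]
  exact intervalIntegral.norm_integral_le_of_norm_le_const fun τ hτ => he τ hτ x hx

/- The field of a step is generated by the average over the step of the vorticity: the velocity
depends linearly on the vorticity, so no continuity in time of the velocity is needed. -/
lemma hasEulerSteps (hδ : 0 < δ) :
    HasEulerSteps (box a b) K (Icc 0 S) φ
      (2 * (regLip a b m * log ((2 * b + 4 + δ) / δ)) + L / |log ε|).toNNReal
      ((2 * regErr a b m + 2) * √δ) := by
  set Λ := 2 * (regLip a b m * log ((2 * b + 4 + δ) / δ))
  have hδs : 0 < √δ := Real.sqrt_pos.2 hδ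
  obtain ⟨h₁, hh₁, hF⟩ := exists_forall_norm_sub_le (f := fun s x => F s (φ s x)) isCompact_Icc
    h.compact h.continuousOn_field hδs
  obtain ⟨h₂, hh₂, hφ⟩ := exists_forall_norm_sub_le (f := fun s x => Λ • φ s x) isCompact_Icc
    h.compact (h.continuousOn_flow.const_smul Λ) hδs
  refine ⟨2 * velBound a b m + 2 * (regErr a b m * √δ) + C_F / |log ε|, min h₁ h₂ / 2,
    by positivity, fun s hs s' hs' hss => ?_⟩
  rcases eq_or_ne s s' with rfl | hne
  · exact ⟨_, (h.vorticity s hs).isSolenoidalField_regField_add h.lower_pos hδ h.field hs.1,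
      fun _ _ => by simp⟩
  have he : ∀ τ ∈ uIoc s s', ∀ x ∈ K, ‖velocity (ω τ) (φ τ x) + F τ (φ τ x) -
      (regField δ (ω τ) (φ s x) + F s (φ s x))‖ ≤ (2 * regErr a b m + 2) * √δ := by
    intro τ hτ x hx
    have hτS := uIcc_subset_Icc hs hs' (uIoc_subset_uIcc hτ)
    have hτs : |τ - s| < min h₁ h₂ :=
      ((abs_sub_left_of_mem_uIcc (uIoc_subset_uIcc hτ)).trans hss).trans_lt
        (half_lt_self (lt_min hh₁ hh₂))
    have hφτ : Λ * ‖φ τ x - φ s x‖ ≤ √δ := by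
      refine le_trans ?_ (hφ s hs τ hτS (hτs.trans_le (min_le_right _ _)) x hx)
      rw [← smul_sub, norm_smul]
      gcongr
      exact Real.le_norm_self Λ
    linarith [h.norm_velocity_add_sub_regField_add_le hδ hs hτS hx,
      hF s hs τ hτS (hτs.trans_le (min_le_left _ _)) x hx]
  obtain ⟨w, hw, hwK⟩ := h.exists_isVorticity_norm_flow_sub_le hδ hs hs' hne he
  exact ⟨_, hw.isSolenoidalField_regField_add h.lower_pos hδ h.field hs.1, hwK⟩

end IsConfinedFlow

end ConfinedFlow

section SelfInteraction

/-- The radial component of the Biot–Savart kernel, without the factor `1 / (2π)`. -/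
def radialKernel (x y : Plane) : ℝ := ∫ θ in Ioc 0 π, regKernel 1 0 x y θ

lemma regDist_comm (δ : ℝ) (x y : Plane) (θ : ℝ) : regDist δ x y θ = regDist δ y x θ := by
  unfold regDist bracket
  rw [norm_sub_rev]
  ring_nf

lemma regKernel_one_eq (δ : ℝ) (x y : Plane) (θ : ℝ) :
    regKernel 1 δ x y θ = y 1 * (x 0 - y 0) * cos θ / regDist δ x y θ ^ 3 := rfl

lemma regKernel_one_swap_mul_coord (δ : ℝ) (x y : Plane) (θ : ℝ) :
    regKernel 1 δ y x θ * y 1 = -(regKernel 1 δ x y θ * x 1) := by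
  rw [regKernel_one_eq, regKernel_one_eq, regDist_comm δ y x]
  ring

lemma regKernel_one_add_swap (δ : ℝ) (x y : Plane) (θ : ℝ) :
    regKernel 1 δ x y θ + regKernel 1 δ y x θ =
      -((x - y) 0 * (x - y) 1 * cos θ) / regDist δ x y θ ^ 3 := by
  rw [regKernel_one_eq, regKernel_one_eq, regDist_comm δ y x, PiLp.sub_apply, PiLp.sub_apply]
  ring

lemma radialKernel_swap_mul_coord (x y : Plane) :
    radialKernel y x * y 1 = -(radialKernel x y * x 1) := by
  simp only [radialKernel, ← integral_mul_const, regKernel_one_swap_mul_coord 0 x y, integral_neg]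

lemma radialKernel_self (x : Plane) : radialKernel x x = 0 := by
  simp [radialKernel, regKernel_one_eq]

lemma measurable_regVel (i : Fin 2) (δ : ℝ) {w : Plane → ℝ} (hw : Measurable w) :
    Measurable (regVel i δ w) :=
  (((measurable_regKernel i δ).mul (hw.comp (measurable_fst.comp
    measurable_snd))).stronglyMeasurable.integral_prod_right'
      (ν := angleMeasure)).measurable.const_mul _

lemma two_mul_integral_prod_self {α : Type*} [MeasurableSpace α] {μ : Measure α} [SFinite μ]
    {g : α × α → ℝ} (hg : Integrable g (μ.prod μ)) :
    2 * ∫ p, g p ∂μ.prod μ = ∫ p, (g p + g p.swap) ∂μ.prod μ := by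
  have hswap : Integrable (fun p => g p.swap) (μ.prod μ) := hg.swap
  rw [integral_add hg hswap, integral_prod_swap, two_mul]

variable {a b m m₁ m₂ : ℝ} {w w₁ w₂ : Plane → ℝ} {x y : Plane}

lemma IsVorticity.coord_mul (hw : IsVorticity a b m w) :
    IsVorticity a b (|b| * m) fun x => x 1 * w x where
  measurable := (continuous_coord 1).measurable.mul hw.measurable
  abs_le y := by
    by_cases hy : y ∈ box a b
    · have hyb : |y 1| ≤ |b| :=
        ((abs_coord_le y 1).trans (norm_lt_of_mem_box hy).le).trans (le_abs_self b)
      rw [abs_mul]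
      exact mul_le_mul hyb (hw.abs_le y) (abs_nonneg _) (abs_nonneg _)
    · rw [hw.eq_zero_of_notMem y hy, mul_zero, abs_zero]
      exact mul_nonneg (abs_nonneg b) hw.bound_nonneg
  eq_zero_of_notMem y hy := by rw [hw.eq_zero_of_notMem y hy, mul_zero]

lemma integrable_regKernel_mul_mul (ha : 0 < a) (h₁ : IsVorticity a b m₁ w₁)
    (h₂ : IsVorticity a b m₂ w₂) (i : Fin 2) :
    Integrable (fun p : Plane × Plane × ℝ => regKernel i 0 p.1 p.2.1 p.2.2 * w₂ p.2.1 * w₁ p.1)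
      (volume.prod angleMeasure) := by
  have hmeas : Measurable fun p : Plane × Plane × ℝ =>
      regKernel i 0 p.1 p.2.1 p.2.2 * w₂ p.2.1 * w₁ p.1 :=
    ((measurable_regKernel i 0).mul (h₂.measurable.comp
      (measurable_fst.comp measurable_snd))).mul (h₁.measurable.comp measurable_fst)
  refine (integrable_prod_iff hmeas.aestronglyMeasurable).2 ⟨Eventually.of_forall fun x => ?_,
    (h₁.integrable.abs.const_mul (velBound a b m₂)).mono'
      hmeas.norm.stronglyMeasurable.integral_prod_right'.aestronglyMeasurable
      (Eventually.of_forall fun x => ?_)⟩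
  · by_cases hx : x ∈ box a b
    · exact (h₂.integrable_and_integral_abs_le ha hx i).1.mul_const (w₁ x)
    · simp [h₁.eq_zero_of_notMem x hx]
  · by_cases hx : x ∈ box a b
    · simp only [norm_mul, integral_mul_const]
      rw [norm_norm, Real.norm_eq_abs (w₁ x),
        Real.norm_of_nonneg (integral_nonneg fun z => by positivity)]
      gcongr
      simpa only [Real.norm_eq_abs, abs_mul] using (h₂.integrable_and_integral_abs_le ha hx i).2
    · simp [h₁.eq_zero_of_notMem x hx]

lemma integrable_radialKernel_mul_mul (ha : 0 < a) (h₁ : IsVorticity a b m₁ w₁)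
    (h₂ : IsVorticity a b m₂ w₂) :
    Integrable (fun p : Plane × Plane => radialKernel p.1 p.2 * w₂ p.2 * w₁ p.1)
      (volume.prod volume) := by
  have hassoc := (measurePreserving_prodAssoc volume volume
    (volume.restrict (Ioc 0 π))).integrable_comp_of_integrable
      (integrable_regKernel_mul_mul ha h₁ h₂ 1)
  refine hassoc.integral_prod_left.congr (Eventually.of_forall fun p => ?_)
  simp [integral_mul_const, radialKernel, MeasurableEquiv.prodAssoc]

lemma integral_regVel_mul (ha : 0 < a) (h₁ : IsVorticity a b m₁ w₁) (h₂ : IsVorticity a b m₂ w₂) :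
    ∫ x, regVel 1 0 w₂ x * w₁ x = 1 / (2 * π) *
      ∫ p : Plane × Plane, radialKernel p.1 p.2 * w₂ p.2 * w₁ p.1 ∂(volume.prod volume) := by
  rw [integral_prod _ (integrable_radialKernel_mul_mul ha h₁ h₂), ← integral_const_mul]
  refine integral_congr_ae (Eventually.of_forall fun x => ?_)
  by_cases hx : x ∈ box a b
  · simp only [integral_mul_const]
    rw [regVel, angleMeasure, integral_prod _ (h₂.integrable_and_integral_abs_le ha hx 1).1]
    simp only [integral_mul_const, radialKernel, mul_assoc]
  · simp [h₁.eq_zero_of_notMem x hx]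

-- The integrand of the double integral is antisymmetric under exchange of the two points.
lemma integral_coord_mul_regVel_mul_eq_zero (ha : 0 < a) (hw : IsVorticity a b m w) :
    ∫ x, x 1 * regVel 1 0 w x * w x = 0 := by
  have hint := integrable_radialKernel_mul_mul ha hw.coord_mul hw
  have hanti (p : Plane × Plane) : radialKernel p.1 p.2 * w p.2 * (p.1 1 * w p.1) +
      radialKernel p.2 p.1 * w p.1 * (p.2 1 * w p.2) = 0 := by
    linear_combination w p.1 * w p.2 * radialKernel_swap_mul_coord p.1 p.2
  have hzero := two_mul_integral_prod_self hint
  simp only [Prod.fst_swap, Prod.snd_swap, hanti, integral_zero] at hzero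
  calc ∫ x, x 1 * regVel 1 0 w x * w x = ∫ x, regVel 1 0 w x * (x 1 * w x) := by
        congr with x
        ring
    _ = 0 := by
        rw [integral_regVel_mul ha hw.coord_mul hw, (mul_eq_zero_iff_left two_ne_zero).1 hzero,
          mul_zero]

lemma integral_sq_div_sqrt_cube_le {r β : ℝ} (hr : 0 < r) (hβ : 0 < β) (c : ℝ) :
    ∫ θ in (0 : ℝ)..c, r ^ 2 / √(r ^ 2 + β ^ 2 * θ ^ 2) ^ 3 ≤ 1 / β := by
  have hpos (θ : ℝ) : 0 < r ^ 2 + β ^ 2 * θ ^ 2 := by positivity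
  have hsqrt (θ : ℝ) : 0 < √(r ^ 2 + β ^ 2 * θ ^ 2) := Real.sqrt_pos.2 (hpos θ)
  have hderiv (θ : ℝ) : HasDerivAt (fun θ => θ / √(r ^ 2 + β ^ 2 * θ ^ 2))
      (r ^ 2 / √(r ^ 2 + β ^ 2 * θ ^ 2) ^ 3) θ := by
    have h : HasDerivAt (fun θ => r ^ 2 + β ^ 2 * θ ^ 2) (β ^ 2 * (2 * θ)) θ := by
      simpa using ((hasDerivAt_pow 2 θ).const_mul (β ^ 2)).const_add (r ^ 2)
    refine ((hasDerivAt_id θ).div (h.sqrt (hpos θ).ne') (hsqrt θ).ne').congr_deriv ?_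
    have hsq := Real.sq_sqrt (hpos θ).le
    have := (hsqrt θ).ne'
    set s := √(r ^ 2 + β ^ 2 * θ ^ 2)
    simp only [id]
    field_simp
    linear_combination hsq
  have hcont : Continuous fun θ : ℝ => r ^ 2 / √(r ^ 2 + β ^ 2 * θ ^ 2) ^ 3 :=
    continuous_const.div (by fun_prop) fun θ => (pow_pos (hsqrt θ) 3).ne'
  rw [intervalIntegral.integral_eq_sub_of_hasDerivAt (fun θ _ => hderiv θ)
    (hcont.intervalIntegrable _ _), zero_div, sub_zero, div_le_div_iff₀ (hsqrt c) hβ, one_mul]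
  refine Real.le_sqrt_of_sq_le ?_
  linarith [mul_pow c β 2, sq_nonneg r]

lemma sqrt_sq_add_le_regDist {α θ : ℝ} (hα : 0 ≤ α) (hx : α ≤ x 1) (hy : α ≤ y 1)
    (hθ : |θ| ≤ π) : √(‖x - y‖ ^ 2 + (2 * α / π) ^ 2 * θ ^ 2) ≤ regDist 0 x y θ := by
  refine Real.sqrt_le_sqrt ?_
  have hquad : 2 / π ^ 2 * θ ^ 2 ≤ 1 - cos θ :=
    le_sub_comm.1 (Real.cos_le_one_sub_mul_cos_sq hθ)
  calc ‖x - y‖ ^ 2 + (2 * α / π) ^ 2 * θ ^ 2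
      = ‖x - y‖ ^ 2 + 2 * (α * α) * (2 / π ^ 2 * θ ^ 2) := by ring
    _ ≤ ‖x - y‖ ^ 2 + 2 * (x 1 * y 1) * (1 - cos θ) := by
      have hmul : α * α ≤ x 1 * y 1 := mul_le_mul hx hy hα (hα.trans hx)
      have := (mul_nonneg hα hα).trans hmul
      have := sub_nonneg.2 (Real.cos_le_one θ)
      gcongr _ + 2 * ?_ * ?_
    _ = bracket x y θ + 0 ^ 2 := by rw [bracket]; ring

lemma abs_regKernel_one_add_swap_le {α θ : ℝ} (hα : 0 ≤ α) (hx : α ≤ x 1) (hy : α ≤ y 1)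
    (hne : x ≠ y) (hθ : |θ| ≤ π) :
    |regKernel 1 0 x y θ + regKernel 1 0 y x θ| ≤
      ‖x - y‖ ^ 2 / √(‖x - y‖ ^ 2 + (2 * α / π) ^ 2 * θ ^ 2) ^ 3 := by
  have hr : 0 < ‖x - y‖ := norm_sub_pos_iff.2 hne
  have hdist := sqrt_sq_add_le_regDist hα hx hy hθ
  rw [regKernel_one_add_swap, abs_div, abs_neg, abs_mul, abs_mul,
    abs_of_nonneg (pow_nonneg regDist_nonneg 3)]
  calc |(x - y) 0| * |(x - y) 1| * |cos θ| / regDist 0 x y θ ^ 3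
      ≤ ‖x - y‖ * ‖x - y‖ * 1 / √(‖x - y‖ ^ 2 + (2 * α / π) ^ 2 * θ ^ 2) ^ 3 := by
        gcongr
        exacts [abs_coord_le _ 0, abs_coord_le _ 1, Real.abs_cos_le_one θ]
    _ = _ := by ring

lemma continuous_regKernel_angle {α : ℝ} (hα : 0 ≤ α) (hx : α ≤ x 1) (hy : α ≤ y 1)
    (hne : x ≠ y) (i : Fin 2) : Continuous fun θ => regKernel i 0 x y θ := by
  have hpair : Continuous fun θ : ℝ => (x, y, θ) := by fun_prop
  have hpos (θ : ℝ) : 0 < regDist 0 x y θ :=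
    (norm_sub_pos_iff.2 hne).trans_le (norm_sub_le_regDist (hα.trans hx) (hα.trans hy))
  exact ((continuous_kernelNum i).comp hpair).div (((continuous_regDist 0).comp hpair).pow 3)
    fun θ => (pow_pos (hpos θ) 3).ne'

lemma abs_radialKernel_add_swap_le {α : ℝ} (hα : 0 < α) (hx : α ≤ x 1) (hy : α ≤ y 1) :
    |radialKernel x y + radialKernel y x| ≤ π / (2 * α) := by
  have hpi := Real.pi_pos
  rcases eq_or_ne x y with rfl | hne
  · rw [radialKernel_self, add_zero, abs_zero]
    positivity
  have hr : 0 < ‖x - y‖ := norm_sub_pos_iff.2 hne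
  have hmaj : Continuous fun θ : ℝ =>
      ‖x - y‖ ^ 2 / √(‖x - y‖ ^ 2 + (2 * α / π) ^ 2 * θ ^ 2) ^ 3 :=
    continuous_const.div (by fun_prop) fun θ => by positivity
  rw [radialKernel, radialKernel, ← integral_add
    (continuous_regKernel_angle hα.le hx hy hne 1).integrableOn_Ioc
    (continuous_regKernel_angle hα.le hy hx hne.symm 1).integrableOn_Ioc]
  calc |∫ θ in Ioc 0 π, (regKernel 1 0 x y θ + regKernel 1 0 y x θ)|
      ≤ ∫ θ in Ioc 0 π, ‖x - y‖ ^ 2 / √(‖x - y‖ ^ 2 + (2 * α / π) ^ 2 * θ ^ 2) ^ 3 := by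
        rw [← Real.norm_eq_abs]
        refine norm_integral_le_of_norm_le (μ := volume.restrict (Ioc 0 π))
          hmaj.integrableOn_Ioc ?_
        filter_upwards [ae_restrict_mem measurableSet_Ioc] with θ hθ
        exact abs_regKernel_one_add_swap_le hα.le hx hy hne ((abs_of_pos hθ.1).trans_le hθ.2)
    _ = ∫ θ in (0 : ℝ)..π, ‖x - y‖ ^ 2 / √(‖x - y‖ ^ 2 + (2 * α / π) ^ 2 * θ ^ 2) ^ 3 :=
        (intervalIntegral.integral_of_le hpi.le).symm
    _ ≤ 1 / (2 * α / π) := integral_sq_div_sqrt_cube_le hr (by positivity) _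
    _ = π / (2 * α) := one_div_div _ _

lemma abs_integral_regVel_mul_le {α : ℝ} (ha : 0 < a) (hα : 0 < α) (hw : IsVorticity a b m w)
    (hnonneg : ∀ x, 0 ≤ w x) (hsupp : ∀ x, w x ≠ 0 → α ≤ x 1) :
    |∫ x, regVel 1 0 w x * w x| ≤ 1 / (8 * α) * (∫ x, w x) ^ 2 := by
  have hsymm := two_mul_integral_prod_self (integrable_radialKernel_mul_mul ha hw hw)
  have hle (p : Plane × Plane) : ‖radialKernel p.1 p.2 * w p.2 * w p.1 +
      radialKernel p.2 p.1 * w p.1 * w p.2‖ ≤ π / (2 * α) * (w p.1 * w p.2) := by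
    have hw₀ := mul_nonneg (hnonneg p.1) (hnonneg p.2)
    rw [show radialKernel p.1 p.2 * w p.2 * w p.1 + radialKernel p.2 p.1 * w p.1 * w p.2 =
      (radialKernel p.1 p.2 + radialKernel p.2 p.1) * (w p.1 * w p.2) by ring,
      Real.norm_eq_abs, abs_mul, abs_of_nonneg hw₀]
    rcases hw₀.eq_or_lt with h | h
    · rw [← h, mul_zero, mul_zero]
    · gcongr
      exact abs_radialKernel_add_swap_le hα (hsupp _ (left_ne_zero_of_mul h.ne'))
        (hsupp _ (right_ne_zero_of_mul h.ne'))
  have hbound := norm_integral_le_of_norm_le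
    ((hw.integrable.mul_prod hw.integrable).const_mul (π / (2 * α))) (Eventually.of_forall hle)
  rw [integral_const_mul, integral_prod_mul w w, ← sq, Real.norm_eq_abs] at hbound
  simp only [Prod.fst_swap, Prod.snd_swap] at hsymm
  rw [← hsymm, abs_mul, abs_two] at hbound
  rw [integral_regVel_mul ha hw hw, abs_mul, abs_of_pos (by positivity)]
  calc _ ≤ 1 / (2 * π) * (π / (2 * α) * (∫ x, w x) ^ 2 / 2) := by
        gcongr
        linarith
    _ = 1 / (8 * α) * (∫ x, w x) ^ 2 := by
        field_simp
        ring

end SelfInteraction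

section VolumePreservation

lemma tendsto_sqrt_mul_exp_log {B c : ℝ} (hB : 0 < B) (hc : c < 1 / 2) :
    Tendsto (fun δ => √δ * exp (c * log ((B + δ) / δ))) (𝓝[>] 0) (𝓝 0) := by
  have hbase : Tendsto (fun δ : ℝ => (B + δ) ^ c) (𝓝[>] 0) (𝓝 ((B + 0) ^ c)) :=
    ((continuousAt_const.add continuousAt_id).rpow_const (Or.inl (by simpa using hB.ne'))).mono_left
      nhdsWithin_le_nhds
  have hpow : Tendsto (fun δ : ℝ => δ ^ (1 / 2 - c)) (𝓝[>] 0) (𝓝 (0 ^ (1 / 2 - c))) :=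
    (Real.continuousAt_rpow_const 0 _ (Or.inr (by linarith))).mono_left nhdsWithin_le_nhds
  rw [Real.zero_rpow (by linarith)] at hpow
  have hprod := hbase.mul hpow
  rw [mul_zero] at hprod
  refine hprod.congr' ?_
  filter_upwards [self_mem_nhdsWithin] with δ (hδ : 0 < δ)
  have hBδ : 0 < B + δ := by linarith
  rw [Real.sqrt_eq_rpow, Real.rpow_sub hδ, mul_comm c, ← Real.rpow_def_of_pos (by positivity),
    Real.div_rpow hBδ.le hδ.le]
  ring

lemma map_restrict_of_measure_image {α : Type*} [TopologicalSpace α] [T2Space α]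
    [MeasurableSpace α] [BorelSpace α] {μ : Measure α} [IsFiniteMeasureOnCompacts μ] {f : α → α}
    {K : Set α} (hK : IsCompact K) (hf : ContinuousOn f K)
    (hμ : ∀ A ⊆ K, IsCompact A → μ (f '' A) = μ A) :
    (μ.restrict K).map f = μ.restrict (f '' K) := by
  have hclosed : ∀ C : Set α, IsClosed C → (μ.restrict K).map f C = μ.restrict (f '' K) C := by
    intro C hC
    have hA : IsCompact (K ∩ f ⁻¹' C) :=
      hK.of_isClosed_subset (hf.preimage_isClosed_of_isClosed hK.isClosed hC) inter_subset_left
    rw [Measure.map_apply_of_aemeasurable (hf.aemeasurable hK.measurableSet) hC.measurableSet,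
      Measure.restrict_apply' hK.measurableSet, Measure.restrict_apply hC.measurableSet, inter_comm,
      ← hμ _ inter_subset_left hA, image_inter_preimage, inter_comm]
  have : IsFiniteMeasure (μ.restrict K) := isFiniteMeasure_restrict.2 hK.measure_ne_top
  exact ext_of_generate_finite _ (BorelSpace.measurable_eq.trans borel_eq_generateFrom_isClosed)
    isPiSystem_isClosed hclosed (hclosed univ isClosed_univ)

lemma setIntegral_div_ringVolume {A : Set Plane} (hA : MeasurableSet A) (hA0 : A ⊆ halfPlane)
    (f : Plane → ℝ) : ∫ x in A, f x / x 1 ∂ringVolume = ∫ x in A, f x := by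
  rw [ringVolume, restrict_withDensity hA, integral_withDensity_eq_integral_toReal_smul
    (continuous_coord 1).measurable.ennreal_ofReal (Eventually.of_forall fun _ =>
      ENNReal.ofReal_lt_top)]
  refine setIntegral_congr_fun hA fun x hx => ?_
  have hx1 : 0 < x 1 := hA0 hx
  simp only [ENNReal.toReal_ofReal hx1.le, smul_eq_mul]
  field_simp

namespace IsConfinedFlow

variable {ε C_F L S a b m p q t : ℝ} {A K : Set Plane} {F : ℝ → Plane → Plane}
  {ω : ℝ → Plane → ℝ} {φ : ℝ → Plane → Plane}
  (h : IsConfinedFlow ε C_F L S a b m K F ω φ)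
include h

lemma lip_nonneg : 0 ≤ L / |log ε| := by
  have hlip := (norm_nonneg _).trans (h.field.lipschitz 0 le_rfl (unitVec 0) 0)
  rwa [sub_zero, norm_unitVec, mul_one] at hlip

/- The Lipschitz constant of the regularized velocity is of order `log (1 / δ)` and its error of
order `√δ`: over a short time the exponential growth `δ ^ (-c)` of the error, `c < 1 / 2`, is
harmless. -/
lemma exists_hasEulerSteps (hp : p ∈ Icc 0 S) (hq : q ∈ Icc 0 S) (hAK : A ⊆ K)
    (hpq : 2 * regLip a b m * |q - p| < 1 / 2) {η : ℝ} (hη : 0 < η) :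
    ∃ Λ e, 0 ≤ e ∧ HasEulerSteps (box a b) A (uIcc p q) φ Λ e ∧
      |q - p| * e * exp (Λ * |q - p|) ≤ η := by
  have hm := (h.vorticity p hp).bound_nonneg
  have hE := regErr_nonneg h.lower_pos h.upper_pos hm
  have hR := regLip_nonneg h.lower_pos h.upper_pos hm
  have hB : 0 < 2 * b + 4 := by linarith [h.upper_pos]
  have hlim := (tendsto_sqrt_mul_exp_log hB hpq).const_mul
    (|q - p| * (2 * regErr a b m + 2) * exp (L / |log ε| * |q - p|))
  rw [mul_zero] at hlim
  obtain ⟨δ, hsmall, hδ : 0 < δ⟩ :=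
    ((hlim.eventually_le_const hη).and self_mem_nhdsWithin).exists
  set ℓ := log ((2 * b + 4 + δ) / δ)
  have hℓ : 0 ≤ ℓ := Real.log_nonneg (by rw [le_div_iff₀ hδ]; linarith)
  have hexp : exp ((2 * (regLip a b m * ℓ) + L / |log ε|) * |q - p|) =
      exp (L / |log ε| * |q - p|) * exp (2 * regLip a b m * |q - p| * ℓ) := by
    rw [← Real.exp_add]
    ring_nf
  refine ⟨_, _, by positivity, (h.hasEulerSteps hδ).mono hAK (uIcc_subset_Icc hp hq), ?_⟩
  rw [Real.coe_toNNReal _ (add_nonneg (by positivity) h.lip_nonneg), hexp]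
  exact le_of_eq_of_le (by ring) hsmall

lemma ringVolume_image_le (hp : p ∈ Icc 0 S) (hq : q ∈ Icc 0 S) (hA : IsCompact A) (hAK : A ⊆ K)
    (hpq : 2 * regLip a b m * |q - p| < 1 / 2) : ringVolume (φ p '' A) ≤ ringVolume (φ q '' A) := by
  obtain ⟨ρ, hρ, htube⟩ := h.tube
  exact ringVolume_image_le_of_hasEulerSteps (isOpen_box a b) h.lower_pos
    (fun _ => coord_mem_Icc_of_mem_box) hρ hA ((h.continuousOn_time hp).mono hAK)
    ((h.continuousOn_time hq).mono hAK)
    (fun s hs x hx => htube s (uIcc_subset_Icc hp hq hs) x (hAK hx))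
    fun _ => h.exists_hasEulerSteps hp hq hAK hpq

lemma ringVolume_image (hA : IsCompact A) (hAK : A ⊆ K) (ht : t ∈ Icc 0 S) :
    ringVolume (φ t '' A) = ringVolume A := by
  have hR := regLip_nonneg h.lower_pos h.upper_pos (h.vorticity t ht).bound_nonneg
  set τ := 1 / (8 * (regLip a b m + 1))
  have hτ : 0 < τ := by positivity
  have hshort : ∀ r : ℝ, |r| ≤ τ → 2 * regLip a b m * |r| < 1 / 2 := fun r hr => by
    calc 2 * regLip a b m * |r| ≤ 2 * (regLip a b m + 1) * τ := by gcongr; linarith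
      _ < 1 / 2 := by simp only [τ]; field_simp; norm_num
  have hsteps : ∀ n : ℕ, ∀ t ∈ Icc 0 S, t ≤ n * τ → ringVolume (φ t '' A) = ringVolume A := by
    intro n
    induction n with
    | zero =>
      intro t ht htn
      obtain rfl : t = 0 := le_antisymm (by simpa using htn) ht.1
      congr 1
      exact (image_congr fun x hx => h.flow.initial x (h.subset (hAK hx))).trans (image_id' A)
    | succ n ih =>
      intro t ht htn
      push_cast at htn
      have hs : max 0 (t - τ) ∈ Icc 0 S := ⟨le_max_left _ _, max_le (ht.1.trans ht.2)
        (by linarith [ht.2])⟩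
      have hts : |t - max 0 (t - τ)| ≤ τ := by
        rw [abs_of_nonneg (sub_nonneg.2 (max_le ht.1 (by linarith)))]
        linarith [le_max_right 0 (t - τ)]
      rw [← ih _ hs (max_le (by positivity) (by linarith))]
      exact le_antisymm
        (h.ringVolume_image_le ht hs hA hAK (hshort _ (by rwa [abs_sub_comm])))
        (h.ringVolume_image_le hs ht hA hAK (hshort _ hts))
  obtain ⟨n, hn⟩ := exists_nat_ge (t / τ)
  exact hsteps n t ht ((div_le_iff₀ hτ).1 hn)

lemma map_restrict_ringVolume (ht : t ∈ Icc 0 S) :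
    (ringVolume.restrict K).map (φ t) = ringVolume.restrict (φ t '' K) :=
  map_restrict_of_measure_image h.compact (h.continuousOn_time ht)
    fun _ hAK hA => h.ringVolume_image hA hAK ht

lemma integral_mul_vorticity (ht : t ∈ Icc 0 S) {f : Plane → ℝ} (hf : Measurable f) :
    ∫ x, f x * ω t x = ∫ x in K, f (φ t x) * ω 0 x := by
  have hcont := h.continuousOn_time ht
  have himage : φ t '' K ⊆ halfPlane := ((h.flow.bijOn t ht.1).mapsTo.mono_left
    h.subset).image_subset
  have hquot : Measurable fun x => f x * ω t x / x 1 :=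
    (hf.mul (h.vorticity t ht).measurable).div (continuous_coord 1).measurable
  calc ∫ x, f x * ω t x
      = ∫ x in φ t '' K, f x * ω t x :=
        (setIntegral_eq_integral_of_forall_compl_eq_zero fun x hx => by
          rw [h.flow.eq_zero_of_notMem_image h.eq_zero_of_notMem ht.1 hx, mul_zero]).symm
    _ = ∫ x in φ t '' K, f x * ω t x / x 1 ∂ringVolume :=
        (setIntegral_div_ringVolume (h.compact.image_of_continuousOn hcont).measurableSet himage
          _).symm
    _ = ∫ x in K, f (φ t x) * ω t (φ t x) / φ t x 1 ∂ringVolume := by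
        rw [← h.map_restrict_ringVolume ht, integral_map
          (hcont.aemeasurable h.compact.measurableSet) hquot.aestronglyMeasurable]
    _ = ∫ x in K, f (φ t x) * ω 0 x / x 1 ∂ringVolume :=
        setIntegral_congr_fun h.compact.measurableSet fun x hx => by
          have : 0 < x 1 := h.subset hx
          have : 0 < φ t x 1 := himage (mem_image_of_mem _ hx)
          simp only [h.flow.transport x (h.subset hx) t ht.1]
          field_simp
    _ = ∫ x in K, f (φ t x) * ω 0 x :=
        setIntegral_div_ringVolume h.compact.measurableSet h.subset _

lemma vorticity_nonneg (ht : 0 ≤ t) (h0 : ∀ x, 0 ≤ ω 0 x) (y : Plane) : 0 ≤ ω t y := by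
  by_cases hy : y ∈ halfPlane
  · obtain ⟨x, hx, rfl⟩ := (h.flow.bijOn t ht).surjOn hy
    rw [h.flow.transport x hx t ht]
    exact mul_nonneg (div_nonneg (le_of_lt hy) (le_of_lt hx)) (h0 x)
  · exact (h.flow.extension t ht y hy).ge

end IsConfinedFlow

end VolumePreservation

section TransportedMoments

section ParametricIntegral

variable {α : Type*} [MeasurableSpace α] {μ : Measure α} {K : Set α} {w : α → ℝ}

lemma continuousOn_setIntegral_mul [TopologicalSpace α] [OpensMeasurableSpace α] [T2Space α]
    {I : Set ℝ} {g : ℝ → α → ℝ} (hI : IsCompact I) (hK : IsCompact K) (hw : IntegrableOn w K μ)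
    (hg : ContinuousOn (fun p : ℝ × α => g p.1 p.2) (I ×ˢ K)) :
    ContinuousOn (fun s => ∫ x in K, g s x * w x ∂μ) I := by
  obtain ⟨c, hc⟩ := (hI.prod hK).exists_bound_of_continuousOn hg
  have hgs : ∀ s ∈ I, ContinuousOn (g s) K := fun s hs =>
    hg.comp (continuousOn_const.prodMk continuousOn_id) fun x hx => ⟨hs, hx⟩
  have hKm := hK.measurableSet
  refine continuousOn_of_dominated (bound := fun x => c * ‖w x‖)
    (fun s hs => (hw.continuousOn_mul (hgs s hs) hK).aestronglyMeasurable)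
    (fun s hs => ae_restrict_of_forall_mem hKm fun x hx => ?_) (hw.norm.const_mul c)
    (ae_restrict_of_forall_mem hKm fun x hx =>
      (hg.comp (continuousOn_id.prodMk continuousOn_const) fun s hs => ⟨hs, hx⟩).mul_const _)
  rw [norm_mul]
  gcongr
  exact hc (s, x) ⟨hs, hx⟩

lemma hasDerivAt_setIntegral_mul {I : Set ℝ} {g g' : ℝ → α → ℝ} {c t : ℝ}
    (hK : MeasurableSet K) (hw : IntegrableOn w K μ) (hI : I ∈ 𝓝 t)
    (hg : ∀ s ∈ I, IntegrableOn (fun x => g s x * w x) K μ)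
    (hg't : AEStronglyMeasurable (g' t) (μ.restrict K))
    (hg' : ∀ s ∈ I, ∀ x ∈ K, |g' s x| ≤ c)
    (hderiv : ∀ s ∈ I, ∀ x ∈ K, HasDerivAt (fun s => g s x) (g' s x) s) :
    HasDerivAt (fun s => ∫ x in K, g s x * w x ∂μ) (∫ x in K, g' t x * w x ∂μ) t := by
  refine (hasDerivAt_integral_of_dominated_loc_of_deriv_le (bound := fun x => c * ‖w x‖)
    (F := fun s x => g s x * w x) (F' := fun s x => g' s x * w x) hI
    (by filter_upwards [hI] with s hs using (hg s hs).aestronglyMeasurable)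
    (hg t (mem_of_mem_nhds hI)) (hg't.mul hw.aestronglyMeasurable)
    (ae_restrict_of_forall_mem hK fun x hx s hs => ?_) (hw.norm.const_mul c)
    (ae_restrict_of_forall_mem hK fun x hx s hs => (hderiv s hs x hx).mul_const _)).2
  rw [norm_mul]
  gcongr
  exact hg' s hs x hx

end ParametricIntegral

namespace IsConfinedFlow

variable {ε C_F L S a b m s t : ℝ} {K : Set Plane} {F : ℝ → Plane → Plane}
  {ω : ℝ → Plane → ℝ} {φ : ℝ → Plane → Plane} {x : Plane}
  (h : IsConfinedFlow ε C_F L S a b m K F ω φ)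
include h

lemma integrableOn_initial (hS : 0 ≤ S) : IntegrableOn (ω 0) K :=
  (h.vorticity 0 (left_mem_Icc.2 hS)).integrable.integrableOn

lemma continuousOn_moment {f : Plane → ℝ} (hf : Continuous f) :
    ContinuousOn (fun s => ∫ x, f x * ω s x) (Icc 0 S) := by
  rcases lt_or_ge S 0 with hS | hS
  · simp [Icc_eq_empty_of_lt hS]
  · exact (continuousOn_setIntegral_mul isCompact_Icc h.compact (h.integrableOn_initial hS)
      (hf.comp_continuousOn h.continuousOn_flow)).congr
        fun s hs => h.integral_mul_vorticity hs hf.measurable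

lemma integral_vorticity (ht : t ∈ Icc 0 S) : ∫ x, ω t x = ∫ x, ω 0 x := by
  have h0 : (0 : ℝ) ∈ Icc 0 S := left_mem_Icc.2 (ht.1.trans ht.2)
  simpa only [one_mul] using (h.integral_mul_vorticity ht (f := fun _ => 1) measurable_const).trans
    (h.integral_mul_vorticity h0 (f := fun _ => 1) measurable_const).symm

lemma velocity_add_apply_one (hs : s ∈ Icc 0 S) (hx : x ∈ K) :
    (velocity (ω s) (φ s x) + F s (φ s x)) 1 = regVel 1 0 (ω s) (φ s x) + F s (φ s x) 1 := by
  rw [PiLp.add_apply, velocity_apply h.lower_pos (h.vorticity s hs) (h.mem_box hs hx)]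

lemma abs_regVel_add_le (hs : s ∈ Icc 0 S) (hx : x ∈ K) :
    |regVel 1 0 (ω s) (φ s x) + F s (φ s x) 1| ≤ 2 * velBound a b m + C_F / |log ε| := by
  rw [← h.velocity_add_apply_one hs hx]
  exact (abs_coord_le _ 1).trans (h.norm_velocity_add_le hs hx)

lemma hasDerivAt_radial (hs : s ∈ Ioc 0 S) (hx : x ∈ K) :
    HasDerivAt (fun s => φ s x 1) (regVel 1 0 (ω s) (φ s x) + F s (φ s x) 1) s := by
  rw [← h.velocity_add_apply_one (Ioc_subset_Icc_self hs) hx]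
  exact (EuclideanSpace.proj (𝕜 := ℝ) (1 : Fin 2) : Plane →L[ℝ] ℝ).hasFDerivAt.comp_hasDerivAt s
    (h.hasDerivAt_flow hs.1 hx)

lemma continuous_field_coord (ht : 0 ≤ t) : Continuous fun x => F t x 1 :=
  (continuous_coord 1).comp (h.field.lipschitzWith ht).continuous

lemma exists_forall_abs_deriv_le {f' : ℝ → ℝ} (hf' : Continuous f') :
    ∃ c, ∀ s ∈ Icc 0 S, ∀ x ∈ K,
      |f' (φ s x 1) * (regVel 1 0 (ω s) (φ s x) + F s (φ s x) 1)| ≤ c := by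
  obtain ⟨c, hc⟩ := (isCompact_Icc.prod h.compact).exists_bound_of_continuousOn
    (hf'.comp_continuousOn ((continuous_coord 1).comp_continuousOn h.continuousOn_flow))
  refine ⟨c * (2 * velBound a b m + C_F / |log ε|), fun s hs x hx => ?_⟩
  have hfc : |f' (φ s x 1)| ≤ c := hc (s, x) ⟨hs, hx⟩
  rw [abs_mul]
  exact mul_le_mul hfc (h.abs_regVel_add_le hs hx) (abs_nonneg _) ((abs_nonneg _).trans hfc)

lemma hasDerivAt_moment (ht : t ∈ Ioo 0 S) {f f' : ℝ → ℝ} (hf : ∀ r, HasDerivAt f (f' r) r)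
    (hf' : Continuous f') :
    HasDerivAt (fun s => ∫ x, f (x 1) * ω s x)
      (∫ x, f' (x 1) * (regVel 1 0 (ω t) x + F t x 1) * ω t x) t := by
  have htS : t ∈ Icc 0 S := Ioo_subset_Icc_self ht
  have hw := h.integrableOn_initial (ht.1.trans ht.2).le
  have hfc : Continuous fun x : Plane => f (x 1) :=
    (continuous_iff_continuousAt.2 fun r => (hf r).continuousAt).comp (continuous_coord 1)
  have hrate : Measurable fun x => f' (x 1) * (regVel 1 0 (ω t) x + F t x 1) :=
    (hf'.measurable.comp (continuous_coord 1).measurable).mul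
      ((measurable_regVel 1 0 (h.vorticity t htS).measurable).add
        (h.continuous_field_coord htS.1).measurable)
  have hnhds : Ioo 0 S ∈ 𝓝 t := isOpen_Ioo.mem_nhds ht
  obtain ⟨c, hc⟩ := h.exists_forall_abs_deriv_le hf'
  rw [h.integral_mul_vorticity htS hrate]
  refine (hasDerivAt_setIntegral_mul (g := fun s x => f (φ s x 1))
    (g' := fun s x => f' (φ s x 1) * (regVel 1 0 (ω s) (φ s x) + F s (φ s x) 1))
    h.compact.measurableSet hw hnhds
    (fun s hs => hw.continuousOn_mul (hfc.comp_continuousOn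
      (h.continuousOn_time (Ioo_subset_Icc_self hs))) h.compact)
    (hrate.comp_aemeasurable ((h.continuousOn_time htS).aemeasurable
      h.compact.measurableSet)).aestronglyMeasurable
    (fun s hs => hc s (Ioo_subset_Icc_self hs))
    (fun s hs x hx => (hf _).comp s
      (h.hasDerivAt_radial (Ioo_subset_Ioc_self hs) hx))).congr_of_eventuallyEq ?_
  filter_upwards [hnhds] with s hs using
    h.integral_mul_vorticity (Ioo_subset_Icc_self hs) hfc.measurable

end IsConfinedFlow

end TransportedMoments

section AxialMoment

lemma integrable_sub_mul_mul {α : Type*} [MeasurableSpace α] {μ : Measure α} {f g w : α → ℝ}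
    (hg : Integrable (fun x => g x * w x) μ) (hfg : Integrable (fun x => f x * g x * w x) μ)
    (c : ℝ) : Integrable (fun x => (f x - c) * g x * w x) μ :=
  (hfg.sub (hg.const_mul c)).congr (Eventually.of_forall fun x => by simp only [Pi.sub_apply]; ring)

lemma integral_sub_mul_mul {α : Type*} [MeasurableSpace α] {μ : Measure α} {f g w : α → ℝ}
    (hg : Integrable (fun x => g x * w x) μ) (hfg : Integrable (fun x => f x * g x * w x) μ)
    (c : ℝ) :
    ∫ x, (f x - c) * g x * w x ∂μ = (∫ x, f x * g x * w x ∂μ) - c * ∫ x, g x * w x ∂μ := by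
  rw [← integral_const_mul, ← integral_sub hfg (hg.const_mul c)]
  exact integral_congr_ae (Eventually.of_forall fun x => by ring)

lemma integral_sub_sq_mul {α : Type*} [MeasurableSpace α] {μ : Measure α} {f w : α → ℝ}
    (h0 : Integrable w μ) (h1 : Integrable (fun x => f x * w x) μ)
    (h2 : Integrable (fun x => f x ^ 2 * w x) μ) (c : ℝ) :
    ∫ x, (f x - c) ^ 2 * w x ∂μ =
      (∫ x, f x ^ 2 * w x ∂μ) - 2 * c * (∫ x, f x * w x ∂μ) + c ^ 2 * ∫ x, w x ∂μ := by
  have h21 : Integrable (fun x => f x ^ 2 * w x - 2 * c * (f x * w x)) μ := h2.sub (h1.const_mul _)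
  rw [← integral_const_mul, ← integral_const_mul, ← integral_sub h2 (h1.const_mul _),
    ← integral_add h21 (h0.const_mul _)]
  exact integral_congr_ae (Eventually.of_forall fun x => by ring)

lemma center_apply {w : Plane → ℝ} (hw : Integrable fun x => w x • x) (i : Fin 2) :
    center w i = (∫ x, w x)⁻¹ * ∫ x, x i * w x := by
  have hproj := (EuclideanSpace.proj (𝕜 := ℝ) i : Plane →L[ℝ] ℝ).integral_comp_comm hw
  rw [center, PiLp.smul_apply, smul_eq_mul]
  congr 1
  exact hproj.symm.trans (integral_congr_ae (Eventually.of_forall fun x => mul_comm _ _))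

namespace IsVorticity

variable {a b m c α β : ℝ} {f w : Plane → ℝ} (hw : IsVorticity a b m w)
include hw

lemma integrable_mul_of_abs_le (hf : Measurable f) (hc : ∀ x ∈ box a b, |f x| ≤ c) :
    Integrable fun x => f x * w x := by
  refine (hw.integrable.norm.const_mul c).mono' (hf.mul hw.measurable).aestronglyMeasurable
    (Eventually.of_forall fun x => ?_)
  by_cases hx : x ∈ box a b
  · rw [norm_mul]
    gcongr
    exact hc x hx
  · simp [hw.eq_zero_of_notMem x hx]

lemma integrable_mul_of_continuous (hf : Continuous f) : Integrable fun x => f x * w x := by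
  obtain ⟨c, hc⟩ :=
    (isCompact_closedBall (0 : Plane) b).exists_bound_of_continuousOn hf.continuousOn
  exact hw.integrable_mul_of_abs_le hf.measurable fun x hx =>
    hc x (mem_closedBall_zero_iff.2 (norm_lt_of_mem_box hx).le)

lemma center_apply (i : Fin 2) : center w i = (∫ x, w x)⁻¹ * ∫ x, x i * w x := by
  refine VortexRing.center_apply ((hw.integrable_mul_of_continuous continuous_norm).norm.mono'
    (hw.measurable.smul measurable_id).aestronglyMeasurable (Eventually.of_forall fun x => ?_)) i
  simp [norm_smul, mul_comm]

lemma integral_coord_sub_sq_mul (c : ℝ) :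
    ∫ x, (x 1 - c) ^ 2 * w x =
      (∫ x, x 1 ^ 2 * w x) - 2 * c * (∫ x, x 1 * w x) + c ^ 2 * ∫ x, w x :=
  integral_sub_sq_mul hw.integrable (hw.integrable_mul_of_continuous (continuous_coord 1))
    (hw.integrable_mul_of_continuous ((continuous_coord 1).pow 2)) c

lemma axialMoment_eq (hA : 0 < ∫ x, w x) :
    axialMoment w = (∫ x, x 1 ^ 2 * w x) - (∫ x, x 1 * w x) ^ 2 / ∫ x, w x := by
  rw [axialMoment, hw.integral_coord_sub_sq_mul, hw.center_apply]
  field_simp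
  ring

lemma axialMoment_le_integral_sub_sq_mul (hA : 0 < ∫ x, w x) (c : ℝ) :
    axialMoment w ≤ ∫ x, (x 1 - c) ^ 2 * w x := by
  have hsq : ∫ x, (x 1 - c) ^ 2 * w x =
      axialMoment w + ((∫ x, x 1 * w x) - c * ∫ x, w x) ^ 2 / ∫ x, w x := by
    rw [hw.integral_coord_sub_sq_mul, hw.axialMoment_eq hA]
    field_simp
    ring
  rw [hsq]
  exact le_add_of_nonneg_right (by positivity)

lemma center_mem_Icc (hnonneg : ∀ x, 0 ≤ w x) (hA : 0 < ∫ x, w x)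
    (hstrip : ∀ x, w x ≠ 0 → x 1 ∈ Icc α β) : center w 1 ∈ Icc α β := by
  have hint := hw.integrable_mul_of_continuous (continuous_coord 1)
  have hlower : α * ∫ x, w x ≤ ∫ x, x 1 * w x := by
    rw [← integral_const_mul]
    refine integral_mono (hw.integrable.const_mul _) hint fun x => ?_
    rcases eq_or_ne (w x) 0 with hx | hx
    · simp [hx]
    · exact mul_le_mul_of_nonneg_right (hstrip x hx).1 (hnonneg x)
  have hupper : ∫ x, x 1 * w x ≤ β * ∫ x, w x := by
    rw [← integral_const_mul]
    refine integral_mono hint (hw.integrable.const_mul _) fun x => ?_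
    rcases eq_or_ne (w x) 0 with hx | hx
    · simp [hx]
    · exact mul_le_mul_of_nonneg_right (hstrip x hx).2 (hnonneg x)
  rw [hw.center_apply, inv_mul_eq_div]
  exact ⟨(le_div_iff₀ hA).2 hlower, (div_le_iff₀ hA).2 hupper⟩

lemma integrable_regVel_mul (ha : 0 < a) (i : Fin 2) :
    Integrable fun x => regVel i 0 w x * w x :=
  hw.integrable_mul_of_abs_le (measurable_regVel i 0 hw.measurable)
    fun _ hx => hw.abs_regVel_zero_le ha hx i

lemma integrable_coord_mul_regVel_mul (ha : 0 < a) (i : Fin 2) :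
    Integrable fun x => x 1 * regVel i 0 w x * w x := by
  refine hw.integrable_mul_of_abs_le (c := b * velBound a b m)
    ((continuous_coord 1).measurable.mul (measurable_regVel i 0 hw.measurable)) fun x hx => ?_
  have hxb := (norm_lt_of_mem_box hx).le
  rw [abs_mul]
  exact mul_le_mul ((abs_coord_le x 1).trans hxb) (hw.abs_regVel_zero_le ha hx i) (abs_nonneg _)
    ((norm_nonneg _).trans hxb)

lemma integral_coord_sub_mul_regVel_mul (ha : 0 < a) (c : ℝ) :
    ∫ x, (x 1 - c) * regVel 1 0 w x * w x = -(c * ∫ x, regVel 1 0 w x * w x) := by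
  rw [integral_sub_mul_mul (hw.integrable_regVel_mul ha 1)
    (hw.integrable_coord_mul_regVel_mul ha 1), integral_coord_mul_regVel_mul_eq_zero ha hw,
    zero_sub]

lemma abs_integral_sub_center_mul_regVel_mul_le (ha : 0 < a) (hα : 0 < α)
    (hnonneg : ∀ x, 0 ≤ w x) (hA : 0 < ∫ x, w x) (hstrip : ∀ x, w x ≠ 0 → x 1 ∈ Icc α β) :
    |∫ x, (x 1 - center w 1) * regVel 1 0 w x * w x| ≤ β / (8 * α) * (∫ x, w x) ^ 2 := by
  obtain ⟨hαc, hcβ⟩ := hw.center_mem_Icc hnonneg hA hstrip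
  rw [hw.integral_coord_sub_mul_regVel_mul ha, abs_neg, abs_mul, abs_of_pos (hα.trans_le hαc)]
  calc center w 1 * |∫ x, regVel 1 0 w x * w x| ≤ β * (1 / (8 * α) * (∫ x, w x) ^ 2) := by
        gcongr
        · exact hα.le.trans (hαc.trans hcβ)
        · exact abs_integral_regVel_mul_le ha hα hw hnonneg fun x hx => (hstrip x hx).1
    _ = β / (8 * α) * (∫ x, w x) ^ 2 := by ring

lemma abs_integral_sub_center_mul_mul_le (hnonneg : ∀ x, 0 ≤ w x) (hA : 0 < ∫ x, w x)
    (hstrip : ∀ x, w x ≠ 0 → x 1 ∈ Icc α β) (hc : ∀ x, |f x| ≤ c) :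
    |∫ x, (x 1 - center w 1) * f x * w x| ≤ (β - α) * c * ∫ x, w x := by
  have hcenter := hw.center_mem_Icc hnonneg hA hstrip
  rw [← integral_const_mul, ← Real.norm_eq_abs]
  refine norm_integral_le_of_norm_le (hw.integrable.const_mul _) (Eventually.of_forall fun x => ?_)
  rcases eq_or_ne (w x) 0 with hx | hx
  · simp [hx]
  · have hdist : |x 1 - center w 1| ≤ β - α :=
      abs_sub_le_iff.2 ⟨sub_le_sub (hstrip x hx).2 hcenter.1, sub_le_sub hcenter.2 (hstrip x hx).1⟩
    rw [norm_mul, norm_mul, Real.norm_eq_abs, Real.norm_eq_abs, Real.norm_of_nonneg (hnonneg x)]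
    exact mul_le_mul_of_nonneg_right (mul_le_mul hdist (hc x) (abs_nonneg _)
      ((abs_nonneg _).trans hdist)) (hnonneg x)

lemma two_mul_integral_sub_center_mul_le (ha : 0 < a) (hα : 0 < α) (hnonneg : ∀ x, 0 ≤ w x)
    (hA : 0 < ∫ x, w x) (hstrip : ∀ x, w x ≠ 0 → x 1 ∈ Icc α β) (hf : Continuous f)
    (hc : ∀ x, |f x| ≤ c) :
    2 * ∫ x, (x 1 - center w 1) * (regVel 1 0 w x + f x) * w x ≤
      2 * (β - α) * c * (∫ x, w x) + β / (4 * α) * (∫ x, w x) ^ 2 := by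
  have hself : Integrable fun x => (x 1 - center w 1) * regVel 1 0 w x * w x :=
    integrable_sub_mul_mul (hw.integrable_regVel_mul ha 1)
      (hw.integrable_coord_mul_regVel_mul ha 1) _
  have hext : Integrable fun x => (x 1 - center w 1) * f x * w x :=
    hw.integrable_mul_of_continuous (((continuous_coord 1).sub continuous_const).mul hf)
  simp only [mul_add, add_mul]
  rw [integral_add hself hext]
  have hself_le :=
    le_of_abs_le (hw.abs_integral_sub_center_mul_regVel_mul_le ha hα hnonneg hA hstrip)
  have hext_le := le_of_abs_le (hw.abs_integral_sub_center_mul_mul_le hnonneg hA hstrip hc)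
  have hdiv : β / (4 * α) = 2 * (β / (8 * α)) := by ring
  rw [hdiv]
  linarith

end IsVorticity

namespace IsConfinedFlow

variable {ε C_F L S a b m s t α β : ℝ} {K : Set Plane} {F : ℝ → Plane → Plane}
  {ω : ℝ → Plane → ℝ} {φ : ℝ → Plane → Plane}
  (h : IsConfinedFlow ε C_F L S a b m K F ω φ)
include h

lemma axialMoment_eq (hA : 0 < ∫ x, ω 0 x) (hs : s ∈ Icc 0 S) :
    axialMoment (ω s) = (∫ x, x 1 ^ 2 * ω s x) - (∫ x, x 1 * ω s x) ^ 2 / ∫ x, ω 0 x := by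
  rw [← h.integral_vorticity hs] at hA ⊢
  exact (h.vorticity s hs).axialMoment_eq hA

lemma continuousOn_axialMoment (hA : 0 < ∫ x, ω 0 x) :
    ContinuousOn (fun s => axialMoment (ω s)) (Icc 0 S) :=
  ((h.continuousOn_moment ((continuous_coord 1).pow 2)).sub
    (((h.continuousOn_moment (continuous_coord 1)).pow 2).div_const _)).congr
      fun _ hs => h.axialMoment_eq hA hs

lemma integral_sub_center_mul_eq (ht : t ∈ Icc 0 S) :
    2 * ∫ x, (x 1 - center (ω t) 1) * (regVel 1 0 (ω t) x + F t x 1) * ω t x =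
      (∫ x, 2 * x 1 * (regVel 1 0 (ω t) x + F t x 1) * ω t x) -
        2 * (∫ x, x 1 * ω t x) * (∫ x, 1 * (regVel 1 0 (ω t) x + F t x 1) * ω t x) /
          ∫ x, ω 0 x := by
  have hw := h.vorticity t ht
  have hF := h.continuous_field_coord ht.1
  have hg : Integrable fun x => (regVel 1 0 (ω t) x + F t x 1) * ω t x :=
    ((hw.integrable_regVel_mul h.lower_pos 1).add (hw.integrable_mul_of_continuous hF)).congr
      (Eventually.of_forall fun x => (add_mul _ _ _).symm)
  have hxg : Integrable fun x => x 1 * (regVel 1 0 (ω t) x + F t x 1) * ω t x :=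
    ((hw.integrable_coord_mul_regVel_mul h.lower_pos 1).add
      (hw.integrable_mul_of_continuous ((continuous_coord 1).mul hF))).congr
      (Eventually.of_forall fun x => by simp only [Pi.add_apply, Pi.mul_apply]; ring)
  rw [integral_sub_mul_mul hg hxg, hw.center_apply, h.integral_vorticity ht]
  simp only [one_mul, mul_assoc, integral_const_mul]
  ring

lemma hasDerivAt_axialMoment (hA : 0 < ∫ x, ω 0 x) (ht : t ∈ Ioo 0 S) :
    HasDerivAt (fun s => axialMoment (ω s))
      (2 * ∫ x, (x 1 - center (ω t) 1) * (regVel 1 0 (ω t) x + F t x 1) * ω t x) t := by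
  have hsq := h.hasDerivAt_moment ht (f := fun r => r ^ 2) (f' := fun r => 2 * r)
    (fun r => by simpa using hasDerivAt_pow 2 r) (by fun_prop)
  have hlin := h.hasDerivAt_moment ht (f := fun r => r) (f' := fun _ => 1)
    (fun r => hasDerivAt_id r) continuous_const
  refine ((hsq.sub ((hlin.pow 2).div_const (∫ x, ω 0 x))).congr_deriv ?_).congr_of_eventuallyEq ?_
  · rw [h.integral_sub_center_mul_eq (Ioo_subset_Icc_self ht)]
    norm_num
  · filter_upwards [isOpen_Ioo.mem_nhds ht] with s hs using
      h.axialMoment_eq hA (Ioo_subset_Icc_self hs)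

lemma axialMoment_le (hS : 0 ≤ S) (hα : 0 < α) (hnonneg : ∀ x, 0 ≤ ω 0 x) (hA : 0 < ∫ x, ω 0 x)
    (hstrip : ∀ s ∈ Ioo 0 S, ∀ x, ω s x ≠ 0 → x 1 ∈ Icc α β) :
    axialMoment (ω S) ≤ axialMoment (ω 0) +
      (2 * (β - α) * (C_F / |log ε|) * (∫ x, ω 0 x) + β / (4 * α) * (∫ x, ω 0 x) ^ 2) * S := by
  have hderiv : ∀ s ∈ interior (Icc 0 S), deriv (fun s => axialMoment (ω s)) s ≤
      2 * (β - α) * (C_F / |log ε|) * (∫ x, ω 0 x) + β / (4 * α) * (∫ x, ω 0 x) ^ 2 := by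
    rw [interior_Icc]
    intro s hs
    have hsS := Ioo_subset_Icc_self hs
    rw [(h.hasDerivAt_axialMoment hA hs).deriv, ← h.integral_vorticity hsS]
    exact (h.vorticity s hsS).two_mul_integral_sub_center_mul_le h.lower_pos hα
      (h.vorticity_nonneg hsS.1 hnonneg) (by rwa [h.integral_vorticity hsS]) (hstrip s hs)
      (h.continuous_field_coord hsS.1)
      fun x => (abs_coord_le _ 1).trans (h.field.bound s hsS.1 x)
  have hdiff : DifferentiableOn ℝ (fun s => axialMoment (ω s)) (interior (Icc 0 S)) := by
    rw [interior_Icc]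
    exact fun s hs => (h.hasDerivAt_axialMoment hA hs).differentiableAt.differentiableWithinAt
  have hmvt := (convex_Icc 0 S).image_sub_le_mul_sub_of_deriv_le (h.continuousOn_axialMoment hA)
    hdiff hderiv 0 (left_mem_Icc.2 hS) S (right_mem_Icc.2 hS) hS
  rw [sub_zero] at hmvt
  linarith

end IsConfinedFlow

lemma sq_mul_abs_log_le {ε : ℝ} (h0 : 0 < ε) (h1 : ε < 1) : ε ^ 2 * |log ε| ≤ 1 := by
  have hlog := (Real.abs_log_mul_self_lt ε h0 h1.le).le
  calc ε ^ 2 * |log ε| = ε * |log ε * ε| := by rw [abs_mul, abs_of_pos h0]; ring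
    _ ≤ 1 * 1 := by gcongr
    _ = 1 := one_mul 1

namespace IsInitialDatum

variable {ε M : ℝ} {ζ₀ : Plane} {w : Plane → ℝ} (hd : IsInitialDatum ε M ζ₀ w)
include hd

lemma abs_le (x : Plane) : |w x| ≤ M / (ε ^ 2 * |log ε|) :=
  (abs_of_nonneg (hd.nonneg x)).trans_le (hd.bound x)

lemma isCompact_tsupport : IsCompact (tsupport w) :=
  (isCompact_closedBall ζ₀ ε).of_isClosed_subset (isClosed_tsupport w)
    (hd.support.trans Metric.ball_subset_closedBall)

lemma integral_eq (hε : log ε ≠ 0) : ∫ x, w x = 1 / |log ε| := by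
  rw [eq_div_iff (abs_ne_zero.2 hε), mul_comm]
  exact hd.intensity

lemma abs_coord_sub_le {x : Plane} (hx : w x ≠ 0) : |x 1 - ζ₀ 1| ≤ ε :=
  (abs_coord_le (x - ζ₀) 1).trans (mem_ball_iff_norm.1 (hd.support (subset_tsupport w hx))).le

lemma isVorticity : IsVorticity (ζ₀ 1 - ε) (‖ζ₀‖ + ε) (M / (ε ^ 2 * |log ε|)) w where
  measurable := hd.measurable
  abs_le := hd.abs_le
  eq_zero_of_notMem x hx := by
    contrapose! hx
    have hball := mem_ball_iff_norm.1 (hd.support (subset_tsupport w hx))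
    refine ⟨?_, mem_ball_zero_iff.2 ?_⟩
    · have hcoord := (_root_.abs_le.1 (abs_coord_le (x - ζ₀) 1)).1
      rw [PiLp.sub_apply] at hcoord
      change ζ₀ 1 - ε < x 1
      linarith
    · linarith [norm_sub_norm_le x ζ₀]

lemma axialMoment_le (hε : 0 < ε) (hε1 : ε < 1) : axialMoment w ≤ 1 / |log ε| ^ 2 := by
  have hlog : log ε ≠ 0 := (Real.log_neg hε hε1).ne
  have hA := hd.integral_eq hlog
  have hw := hd.isVorticity
  calc axialMoment w ≤ ∫ x, (x 1 - ζ₀ 1) ^ 2 * w x :=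
        hw.axialMoment_le_integral_sub_sq_mul (by rw [hA]; positivity) _
    _ ≤ ∫ x, ε ^ 2 * w x := by
        refine integral_mono (hw.integrable_mul_of_continuous
          (((continuous_coord 1).sub continuous_const).pow 2)) (hw.integrable.const_mul _)
          fun x => ?_
        rcases eq_or_ne (w x) 0 with hx | hx
        · simp [hx]
        · exact mul_le_mul_of_nonneg_right (sq_le_sq' (neg_le_of_abs_le (hd.abs_coord_sub_le hx))
            (le_of_abs_le (hd.abs_coord_sub_le hx))) (hd.nonneg x)
    _ = ε ^ 2 * |log ε| / |log ε| ^ 2 := by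
        rw [integral_const_mul, hA]
        field_simp
    _ ≤ 1 / |log ε| ^ 2 := by
        gcongr
        exact sq_mul_abs_log_le hε hε1

end IsInitialDatum

lemma coord_mem_Icc_of_lt_confinementTime {r₀ T s : ℝ} {ω : ℝ → Plane → ℝ} {x : Plane}
    (hs : s ∈ Ico 0 (confinementTime r₀ T ω)) (hx : x ∈ tsupport (ω s)) :
    x 1 ∈ Icc (r₀ / 2) (3 / 2 * r₀) := by
  have hne : (confinedTimes r₀ T ω).Nonempty := by
    by_contra! hempty
    have hpos := hs.1.trans_lt hs.2
    rw [confinementTime, hempty, Real.sSup_empty] at hpos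
    exact hpos.false
  obtain ⟨t, ht, hst⟩ := exists_lt_of_lt_csSup hne hs.2
  exact ht.2 s ⟨hs.1, hst.le⟩ x hx

lemma confinementTime_le {r₀ T : ℝ} (hT : 0 ≤ T) (ω : ℝ → Plane → ℝ) :
    confinementTime r₀ T ω ≤ T :=
  Real.sSup_le (fun _ hs => hs.1.2) hT

end AxialMoment

end VortexRing

end

theorem lemma2_general {ζ₀ : VortexRing.Plane} (hζ₀ : 0 < ζ₀ 1) {M C_F L T ε t : ℝ}
    (hε : 0 < ε) (hε1 : ε < 1) {F : ℝ → VortexRing.Plane → VortexRing.Plane}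
    {ω : ℝ → VortexRing.Plane → ℝ} (hF : VortexRing.IsExternalField ε C_F L F)
    (hd : VortexRing.IsInitialDatum ε M ζ₀ (ω 0)) (hω : VortexRing.IsReducedSolution F ω)
    (ht : t ∈ Set.Icc 0 (VortexRing.confinementTime (ζ₀ 1) T ω)) :
    VortexRing.axialMoment (ω t) ≤ (1 + (2 * ζ₀ 1 * C_F + 3 / 4) * t) / |Real.log ε| ^ 2 := by
  have hlog : Real.log ε ≠ 0 := (Real.log_neg hε hε1).ne
  have hA := hd.integral_eq hlog
  have hinitial := hd.axialMoment_le hε hε1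
  rcases ht.1.eq_or_lt with rfl | ht0
  · simpa only [mul_zero, add_zero] using hinitial
  have hstrip : ∀ s ∈ Set.Ico 0 t, ∀ x ∈ tsupport (ω s),
      x 1 ∈ Set.Icc (ζ₀ 1 / 2) (3 / 2 * ζ₀ 1) := fun s hs x hx =>
    VortexRing.coord_mem_Icc_of_lt_confinementTime ⟨hs.1, hs.2.trans_le ht.2⟩ hx
  have hhalf : tsupport (ω 0) ⊆ VortexRing.halfPlane := fun x hx =>
    (half_pos hζ₀).trans_le (hstrip 0 ⟨le_rfl, ht0⟩ x hx).1
  obtain ⟨φ, hφ⟩ := hω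
  obtain ⟨a, b, m, hflow⟩ := hφ.exists_isConfinedFlow hF hd.isCompact_tsupport hhalf hd.measurable
    hd.abs_le (fun _ => image_eq_zero_of_notMem_tsupport) t
  have hgrowth := hflow.axialMoment_le ht.1 (half_pos hζ₀) hd.nonneg (by rw [hA]; positivity)
    fun s hs x hx => hstrip s (Set.Ioo_subset_Ico_self hs) x (subset_tsupport _ hx)
  rw [hA] at hgrowth
  calc VortexRing.axialMoment (ω t) ≤ 1 / |Real.log ε| ^ 2 +
        (2 * (3 / 2 * ζ₀ 1 - ζ₀ 1 / 2) * (C_F / |Real.log ε|) * (1 / |Real.log ε|) +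
          3 / 2 * ζ₀ 1 / (4 * (ζ₀ 1 / 2)) * (1 / |Real.log ε|) ^ 2) * t := by linarith
    _ = (1 + (2 * ζ₀ 1 * C_F + 3 / 4) * t) / |Real.log ε| ^ 2 := by
      field_simp
      ring

theorem lemma2 (ζ₀ : VortexRing.Plane) (hζ₀ : 0 < ζ₀ 1) (M C_F L T : ℝ)
    (hM : 0 < M) (hC_F : 0 < C_F) (hL : 0 < L) (hT : 0 < T) :
    ∃ C : ℝ, 0 < C ∧ ∀ ε : ℝ, 0 < ε → ε < 1 → ε < ζ₀ 1 / 2 →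
      ∀ (F : ℝ → VortexRing.Plane → VortexRing.Plane) (ω : ℝ → VortexRing.Plane → ℝ),
        VortexRing.IsExternalField ε C_F L F →
        VortexRing.IsInitialDatum ε M ζ₀ (ω 0) →
        VortexRing.IsReducedSolution F ω →
        ∀ t ∈ Set.Icc 0 (VortexRing.confinementTime (ζ₀ 1) T ω),
          VortexRing.axialMoment (ω t) ≤ C / |Real.log ε| ^ 2 := by
  refine ⟨1 + (2 * ζ₀ 1 * C_F + 3 / 4) * T, by positivity, ?_⟩
  intro ε hε hε1 _ F ω hF hd hω t ht
  refine (lemma2_general hζ₀ hε hε1 hF hd hω ht).trans ?_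
  gcongr
  exact ht.2.trans (VortexRing.confinementTime_le hT.le ω)
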